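/- **Lemma 2.2 (Energy Inequality).** Let $n\in\mathbb N$, $0<s<1$ with $2s<n$, and $\kappa>1$. There is a constant $C=C(n,s,\kappa)>0$ such that the following holds. Let $K(t,x,v,w)$ be a measurable real function of $t\in\mathbb R$, $x,v,w\in\mathbb R^n$ with $$K(t,x,v,w)=K(t,x,w,v),\qquad K(t,x,v,v+w)=K(t,x,v,v-w),$$ $$\mathbf 1_{\{|v-w|\le 6\}}\,\kappa^{-1}|v-w|^{-(n+2s)}\le K(t,x,v,w)\le\kappa|v-w|^{-(n+2s)}\qquad(v\ne w),$$ and put $$\mathcal L_{t,x} g(v)=\mathrm{p.v.}\!\int K(t,x,v,w)[g(w)-g(v)]\,dw,\qquad B_{t,x}(g,h)=\tfrac12\iint K(t,x,v,w)[g(w)-g(v)][h(w)-h(v)]\,dw\,dv .$$ Let $T<S<0$, let $\Omega\subseteq\mathbb R^n$ be open, $\bar\Omega\subseteq\Omega$ compact, $Q=(T,0]\times\Omega$, $\bar Q=[S,0]\times\bar\Omega$, and $$\delta=\min\bigl(|T-S|,\ \operatorname{dist}(\bar\Omega,\Omega^{\mathsf C})\bigr),$$ where the distance to the empty set is $+\infty$.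 Let $R>0$, and let $\psi:\mathbb R^n\to\mathbb R$ be of class $C^{1,1}$ in a neighbourhood of $\{|v|\le R\}$ with $\int|\psi(w)|(1+|w|)^{-(n+2s)}\,dw<\infty$. Let $1\le r\le\infty$, $\frac1r+\frac1{r^*}=1$, and $a\in L^r(Q\times\mathbb R^n)$. Let $f\in L^2(Q;H^s(\mathbb R^n))$ be a weak solution of $(\partial_t+v\cdot\nabla_x)f=\mathcal L f+a$ on $Q$, that is, $$-\iiint f\,(\partial_t+v\cdot\nabla_x)\phi\,dv\,dx\,dt=-\iint_Q B_{t,x}(f,\phi)\,dx\,dt+\iiint a\,\phi\,dv\,dx\,dt\qquad\text{for all }\phi\in C_c^\infty\bigl((T,0)\times\Omega\times\mathbb R^n\bigr),$$ and suppose that $f(t,x,v)\le\psi(v)$ for almost every $(t,x,v)\in Q\times\mathbb R^n$ with $|v|\ge R$. Put $f_+=\max(f-\psi,0)$ and $f_-=\max(\psi-f,0)$, so that $f=f_++\psi-f_-$. Then $\mathcal L_{t,x}\psi(v)$ exists as a principal value for all $t,x$ and $|v|<R$, the integrals on the left-hand side below converge absolutely, and $$\iint_{\bar Q}B(f_+,f_+)\,dx\,dt-\iint_{\bar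 Q}B(f_+,f_-)\,dx\,dt\ \le\ \frac C\delta\Bigl[\max(R,1)\iint_Q\!\int f_+^2\,dv\,dx\,dt+\max(\delta,1)\Bigl(\sup_{(t,x)\in Q,\,|v|<R}|\mathcal L_{t,x}\psi(v)|\iint_Q\!\int f_+\,dv\,dx\,dt+\|a\|_{L^r(Q\times\mathbb R^n)}\|f_+\|_{L^{r^*}(Q\times\mathbb R^n)}\Bigr)\Bigr].$$ The right-hand side may be $+\infty$; there $0\cdot\infty=0$. In particular, if $R\ge1$ and $\delta\le1$, then $\max(R,1)=R$ and $\max(\delta,1)=1$. -/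

import Mathlib

open MeasureTheory Filter Topology Set
open scoped ENNReal NNReal ContDiff

namespace KineticNonlocal

noncomputable section

/-- The space `ℝⁿ` with its Euclidean norm, used for positions `x` and velocities `v`. -/
abbrev Space (n : ℕ) : Type := EuclideanSpace ℝ (Fin n)

/-- The standing assumptions on the kernel `K(t,x,v,w)`: measurability, the two symmetries, and
`1_{|v-w| ≤ 6} κ⁻¹ |v-w|^{-(n+2s)} ≤ K(t,x,v,w) ≤ κ |v-w|^{-(n+2s)}` (off the diagonal `v = w`,
where the bounds have no meaning). -/
structure IsKernel {n : ℕ} (s κ : ℝ) (K : ℝ → Space n → Space n → Space n → ℝ) : Prop where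
  measurable : Measurable fun q : ℝ × Space n × Space n × Space n => K q.1 q.2.1 q.2.2.1 q.2.2.2
  symm : ∀ t x v w, K t x v w = K t x w v
  symm_reflect : ∀ t x v w, K t x v (v + w) = K t x v (v - w)
  lower : ∀ t x v w, v ≠ w →
    (if ‖v - w‖ ≤ 6 then κ⁻¹ * ‖v - w‖ ^ (-((n : ℝ) + 2 * s)) else 0) ≤ K t x v w
  upper : ∀ t x v w, v ≠ w → K t x v w ≤ κ * ‖v - w‖ ^ (-((n : ℝ) + 2 * s))

/-- The integral of `K(t,x,v,w) [g(w) - g(v)]` over `|w - v| > ε`. -/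
def truncL {n : ℕ} (K : ℝ → Space n → Space n → Space n → ℝ) (t : ℝ) (x : Space n)
    (g : Space n → ℝ) (v : Space n) (ε : ℝ) : ℝ :=
  ∫ w in {w : Space n | ε < ‖w - v‖}, K t x v w * (g w - g v)

/-- The operator `(𝓛_{t,x} g)(v) = p.v. ∫ K(t,x,v,w) [g(w) - g(v)] dw`. -/
def opL {n : ℕ} (K : ℝ → Space n → Space n → Space n → ℝ) (t : ℝ) (x : Space n)
    (g : Space n → ℝ) (v : Space n) : ℝ :=
  limUnder (𝓝[>] (0 : ℝ)) (truncL K t x g v)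

/-- The integrand `K(t,x,v,w) [g(w) - g(v)] [h(w) - h(v)]` of the form `B`. -/
def formIntegrand {n : ℕ} (K : ℝ → Space n → Space n → Space n → ℝ) (t : ℝ) (x : Space n)
    (g h : Space n → ℝ) (q : Space n × Space n) : ℝ :=
  K t x q.1 q.2 * ((g q.2 - g q.1) * (h q.2 - h q.1))

/-- The bilinear form `B_{t,x}(g,h) = ½ ∬ K(t,x,v,w) [g(w) - g(v)] [h(w) - h(v)] dw dv`. -/
def formB {n : ℕ} (K : ℝ → Space n → Space n → Space n → ℝ) (t : ℝ) (x : Space n)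
    (g h : Space n → ℝ) : ℝ :=
  (1 / 2) * ∫ q : Space n × Space n, formIntegrand K t x g h q

/-- The set `Q × ℝⁿ` of all `(t,x,v)` with `(t,x) ∈ Q`. -/
def withVel {n : ℕ} (Q : Set (ℝ × Space n)) : Set (ℝ × Space n × Space n) :=
  {p | (p.1, p.2.1) ∈ Q}

/-- The square of the Gagliardo (Slobodeckij) seminorm of order `s`. -/
def gagliardoSq {n : ℕ} (s : ℝ) (g : Space n → ℝ) : ℝ≥0∞ :=
  ∫⁻ q : Space n × Space n,
    ENNReal.ofReal ((g q.2 - g q.1) ^ 2 * ‖q.1 - q.2‖ ^ (-((n : ℝ) + 2 * s)))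

/-- `f ∈ L²(Q; H^s(ℝⁿ))` for `0 < s < 1`, where `‖g‖²_{H^s} = ‖g‖²_{L²} + [g]²_s`, with `[g]_s` the
Gagliardo seminorm. -/
def MemL2Hs {n : ℕ} (s : ℝ) (Q : Set (ℝ × Space n)) (f : ℝ → Space n → Space n → ℝ) : Prop :=
  MemLp (fun p : ℝ × Space n × Space n => f p.1 p.2.1 p.2.2) 2 (volume.restrict (withVel Q)) ∧
    ∫⁻ p in Q, gagliardoSq s (f p.1 p.2) < ⊤

/-- The transport derivative `(∂_t + v · ∇_x) φ` at the point `p = (t,x,v)`. -/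
def transport {n : ℕ} (φ : ℝ × Space n × Space n → ℝ) (p : ℝ × Space n × Space n) : ℝ :=
  fderiv ℝ φ p (1, p.2.2, 0)

/-- `f` is a weak solution of `(∂_t + v · ∇_x) f = 𝓛 f + a` on `Q`: it lies in `L²(Q; H^s)` and
satisfies the equation tested against all smooth functions with compact support in
`interior Q × ℝⁿ`. No initial or boundary value is imposed. -/
structure IsWeakSolution {n : ℕ} (s : ℝ) (K : ℝ → Space n → Space n → Space n → ℝ)
    (a : ℝ × Space n × Space n → ℝ) (Q : Set (ℝ × Space n))
    (f : ℝ → Space n → Space n → ℝ) : Prop where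
  memL2Hs : MemL2Hs s Q f
  weak_eq : ∀ φ : ℝ × Space n × Space n → ℝ, ContDiff ℝ ∞ φ → HasCompactSupport φ →
    tsupport φ ⊆ withVel (interior Q) →
    -∫ p in withVel Q, f p.1 p.2.1 p.2.2 * transport φ p =
      -(∫ p in Q, formB K p.1 p.2 (f p.1 p.2) fun v => φ (p.1, p.2, v)) +
        ∫ p in withVel Q, a p * φ p

/-- `ψ` is of class `C^{1,1}` on a neighbourhood of the closed ball of radius `R`. -/
def IsC11NearBall {n : ℕ} (R : ℝ) (ψ : Space n → ℝ) : Prop :=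
  ∃ ρ > R, ∃ M : ℝ≥0, DifferentiableOn ℝ ψ (Metric.ball 0 ρ) ∧
    LipschitzOnWith M (fderiv ℝ ψ) (Metric.ball 0 ρ)

/-- The growth condition `∫ |ψ(w)| (1 + |w|)^{-(n+2s)} dw < ∞`, under which the tail of the integral
defining `𝓛 ψ` converges. -/
def HasModerateGrowth {n : ℕ} (s : ℝ) (ψ : Space n → ℝ) : Prop :=
  Integrable fun w : Space n => ψ w * (1 + ‖w‖) ^ (-((n : ℝ) + 2 * s))

/-- `f₊ = max(f - ψ, 0)`. -/
def plusPart {n : ℕ} (f : ℝ → Space n → Space n → ℝ) (ψ : Space n → ℝ) :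
    ℝ → Space n → Space n → ℝ :=
  fun t x v => max (f t x v - ψ v) 0

/-- `f₋ = max(ψ - f, 0)`, so that `f = f₊ + ψ - f₋`. -/
def minusPart {n : ℕ} (f : ℝ → Space n → Space n → ℝ) (ψ : Space n → ℝ) :
    ℝ → Space n → Space n → ℝ :=
  fun t x v => max (ψ v - f t x v) 0

/-- `δ = min(|T - S|, dist(Ω', Ωᶜ))`, where the distance to the empty set is `∞`. -/
def cylinderDist {n : ℕ} (T S : ℝ) (Ω Ω' : Set (Space n)) : ℝ :=
  (min (ENNReal.ofReal |T - S|) (⨅ x ∈ Ω', Metric.infEDist x Ωᶜ)).toReal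

/-- `sup |𝓛_{t,x} ψ(v)|` over `(t,x) ∈ Q` and `|v| < R`, as an extended number. -/
def supL {n : ℕ} (K : ℝ → Space n → Space n → Space n → ℝ) (Q : Set (ℝ × Space n)) (R : ℝ)
    (ψ : Space n → ℝ) : ℝ≥0∞ :=
  ⨆ p ∈ Q, ⨆ v ∈ Metric.ball (0 : Space n) R, ‖opL K p.1 p.2 ψ v‖ₑ

end

end KineticNonlocal

set_option linter.unusedSectionVars false

namespace KineticNonlocal


/-! ### Continuity of translations in integral pairings -/

section Translation

variable {X G : Type*} [NormedAddCommGroup X] [NormedSpace ℝ X] [FiniteDimensional ℝ X]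
  [MeasurableSpace X] [BorelSpace X] {μ : Measure X} [μ.IsAddHaarMeasure]
  [NormedAddCommGroup G]

/-! Formally, the equation is tested with `η f₊`, where `η ≥ 0` is a cutoff in `(t,x)`. As `ψ` does
not depend on `(t,x)`, the transport term becomes a derivative of `f₊²/2`, and `∫ η B(f,f₊) = ½ ∫
f₊² (∂_t + v·∇_x)η + ∫ η a f₊`. Since `f₊ - f₋ = f - ψ`, the quantity to estimate is `B(f₊,f₊) -
B(f₊,f₋) = B(f,f₊) - B(ψ,f₊)`, and `-B(ψ,f₊) = ∫ f₊ 𝓛ψ` by the symmetry of the kernel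
(`TaylorBound.integral_formIntegrand`). Only `|v| < R` matters, because `f₊` vanishes elsewhere;
there the transport derivative of `η` is at most `(4/δ) max(R,1)`. Only an upper bound on it is
needed, so `η` may drop to zero arbitrarily fast as `t` increases to `0`, and no trace of `f` at `t
= 0` enters (`exists_transport_cutoffs`). Finally `f₊ f₋ = 0` makes the integrand of `B(f₊,f₊) -
B(f₊,f₋)` pointwise nonnegative, so the part of it outside `Q̄` can be dropped when `η` tends to `1`
on `Q̄` (`ofReal_setIntegral_le_of_cutoffs`).

The real work is that `η f₊` is not an admissible test function: `f` has half a Gagliardo energy in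
`v` and no regularity in `(t,x)`. The form is written as an `L²` pairing of a fixed flux `W`
(`halfFlux`) with the weighted difference `wdiff` of the test function. A mollified test function
can then be exchanged for translated data, and translations are continuous in `L¹` and `L²`; no
regularity of the kernel is used. This removes the mollification in `v` altogether
(`weak_equation_mollified`). The mollification in `(t,x)` stays for a while and is applied on both
sides: the test function is a truncation of the averaged solution. The average commutes with
`v·∇_x`, so the chain rule and integration by parts are exact, without a commutator.

Letting the average and then the truncation height `N` go to their limits (`renormalized_equation`,
`localized_energy_le`) needs uniform energy bounds on the truncations. Subtracting `ψ` and cutting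
at `|v| = R` is no contraction for differences, but the barrier condition in a shell outside the
ball bounds the defect by `min(|v-w|,1)` times a function concentrated on the ball, which is square
integrable against the weight (`abs_trunc_sub_le`, `abs_posTrunc_sub_le`, `memLp_kweight`). -/

theorem eLpNorm_translate {h : X → G} {p : ℝ≥0∞} (hh : AEStronglyMeasurable h μ) (τ : X) :
    eLpNorm (fun x => h (x - τ)) p μ = eLpNorm h p μ :=
  eLpNorm_comp_measurePreserving hh (measurePreserving_sub_right μ τ)

/-- Composition with a continuously varying family of measure preserving maps is continuous in `L^p`
for finite `p`; the shifts are such a family. -/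
theorem tendsto_eLpNorm_translate_sub {h : X → G} {p : ℝ≥0∞} (hp1 : 1 ≤ p) (hp : p ≠ ⊤)
    (hh : MemLp h p μ) :
    Tendsto (fun τ : X => eLpNorm (fun x => h (x - τ) - h x) p μ) (𝓝 0) (𝓝 0) := by
  have : Fact (1 ≤ p) := ⟨hp1⟩
  let g : X → C(X, X) := fun τ => ⟨fun x => x - τ, by fun_prop⟩
  have hg : Continuous g := ContinuousMap.continuous_of_continuous_uncurry _ (by
    simp only [g, Function.uncurry_def, ContinuousMap.coe_mk]; fun_prop)
  have hgm : ∀ τ, MeasurePreserving (g τ) μ μ := fun τ => measurePreserving_sub_right μ τ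
  have hc : Continuous fun τ => Lp.compMeasurePreserving (g τ) (hgm τ) (hh.toLp h) :=
    (continuous_const (y := hh.toLp h)).compMeasurePreservingLp hg hgm hp
  have h0 : Lp.compMeasurePreserving (g 0) (hgm 0) (hh.toLp h) = hh.toLp h := by
    rw [Lp.toLp_compMeasurePreserving]
    congr 1
    ext x
    simp [g]
  have h1 := hc.tendsto 0
  rw [h0, tendsto_iff_edist_tendsto_0] at h1
  refine h1.congr fun τ => ?_
  rw [Lp.toLp_compMeasurePreserving, Lp.edist_toLp_toLp]
  rfl

/-- The bounded factor stays fixed while the integrable one moves, so only `L¹` continuity of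
translations is needed. This serves the transport and source terms, where the test function is
bounded but rough. -/
theorem continuous_integral_smul_translate [NormedSpace ℝ G] {A : X → G} (hA : Integrable A μ)
    {g : X → ℝ} (hg : AEStronglyMeasurable g μ) {N : ℝ} (hN : ∀ x, |g x| ≤ N) :
    Continuous fun τ : X => ∫ x, g x • A (x - τ) ∂μ := by
  have hint : ∀ τ, Integrable (fun x => g x • A (x - τ)) μ := fun τ =>
    (hA.comp_sub_right τ).bdd_smul N hg (Eventually.of_forall hN)
  have key := tendsto_eLpNorm_translate_sub le_rfl (by simp) (memLp_one_iff_integrable.2 hA)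
  rw [continuous_iff_continuousAt]
  intro τ₀
  rw [ContinuousAt, tendsto_iff_edist_tendsto_0]
  have k2 : Tendsto (fun τ : X => ENNReal.ofReal N *
      eLpNorm (fun x => A (x - (τ - τ₀)) - A x) 1 μ) (𝓝 τ₀) (𝓝 0) := by
    have : Tendsto (fun τ : X => τ - τ₀) (𝓝 τ₀) (𝓝 0) := by
      simpa using (show Continuous fun τ : X => τ - τ₀ by fun_prop).tendsto τ₀
    simpa using ENNReal.Tendsto.const_mul (key.comp this) (Or.inr ENNReal.ofReal_ne_top)
  refine tendsto_of_tendsto_of_tendsto_of_le_of_le tendsto_const_nhds k2 (fun _ => zero_le) ?_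
  intro τ
  simp only
  -- Translation invariance moves the comparison from `τ`, `τ₀` to `τ - τ₀`, `0`.
  have e1 : eLpNorm (fun x => A (x - (τ - τ₀)) - A x) 1 μ
      = eLpNorm (fun x => A (x - τ) - A (x - τ₀)) 1 μ := by
    rw [← eLpNorm_translate (h := fun x => A (x - (τ - τ₀)) - A x)
      ((hA.comp_sub_right _).sub hA).aestronglyMeasurable τ₀]
    congr 1; ext x; congr 2; abel
  rw [e1, edist_eq_enorm_sub, ← integral_sub (hint τ) (hint τ₀), eLpNorm_one_eq_lintegral_enorm]
  refine (enorm_integral_le_lintegral_enorm _).trans ?_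
  rw [← lintegral_const_mul' _ _ ENNReal.ofReal_ne_top]
  refine lintegral_mono fun x => ?_
  rw [← smul_sub, enorm_smul]
  gcongr
  rw [← ofReal_norm]
  exact ENNReal.ofReal_le_ofReal (hN x)

theorem lintegral_enorm_mul_le_eLpNorm_two {Y : Type*} [MeasurableSpace Y] {ν : Measure Y}
    {u w : Y → ℝ} (hu : AEStronglyMeasurable u ν) (hw : AEStronglyMeasurable w ν) :
    ∫⁻ x, ‖u x * w x‖ₑ ∂ν ≤ eLpNorm u 2 ν * eLpNorm w 2 ν := by
  have := eLpNorm_smul_le_mul_eLpNorm (p := 2) (q := 2) (r := 1) hw hu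
  rw [eLpNorm_one_eq_lintegral_enorm] at this
  exact this

/-- The `L²` counterpart, by Cauchy–Schwarz, which serves the nonlocal term. -/
theorem continuous_integral_translate_mul {W Ψ : X → ℝ} (hW : MemLp W 2 μ) (hΨ : MemLp Ψ 2 μ) :
    Continuous fun τ : X => ∫ x, W (x - τ) * Ψ x ∂μ := by
  have hWt : ∀ τ, MemLp (fun x => W (x - τ)) 2 μ := fun τ =>
    hW.comp_measurePreserving (measurePreserving_sub_right μ τ)
  have hint : ∀ τ, Integrable (fun x => W (x - τ) * Ψ x) μ := fun τ =>
    (hWt τ).integrable_mul hΨ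
  have key := tendsto_eLpNorm_translate_sub (p := 2) (by norm_num) (by simp) hW
  rw [continuous_iff_continuousAt]
  intro τ₀
  rw [ContinuousAt, tendsto_iff_edist_tendsto_0]
  have k2 : Tendsto (fun τ : X =>
      eLpNorm (fun x => W (x - (τ - τ₀)) - W x) 2 μ * eLpNorm Ψ 2 μ) (𝓝 τ₀) (𝓝 0) := by
    have : Tendsto (fun τ : X => τ - τ₀) (𝓝 τ₀) (𝓝 0) := by
      simpa using (show Continuous fun τ : X => τ - τ₀ by fun_prop).tendsto τ₀
    simpa using ENNReal.Tendsto.mul_const (key.comp this) (Or.inr hΨ.2.ne)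
  refine tendsto_of_tendsto_of_tendsto_of_le_of_le tendsto_const_nhds k2 (fun _ => zero_le) ?_
  intro τ
  simp only
  have e1 : eLpNorm (fun x => W (x - (τ - τ₀)) - W x) 2 μ
      = eLpNorm (fun x => W (x - τ) - W (x - τ₀)) 2 μ := by
    rw [← eLpNorm_translate (h := fun x => W (x - (τ - τ₀)) - W x)
      ((hWt _).sub hW).aestronglyMeasurable τ₀]
    congr 1; ext x; congr 2; abel
  rw [e1, edist_eq_enorm_sub, ← integral_sub (hint τ) (hint τ₀)]
  refine (enorm_integral_le_lintegral_enorm _).trans ?_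
  simp_rw [← sub_mul]
  exact lintegral_enorm_mul_le_eLpNorm_two ((hWt τ).sub (hWt τ₀)).aestronglyMeasurable
    hΨ.aestronglyMeasurable

end Translation

/-! ### Minkowski's inequality for averages -/

section Averaging

variable {V Y : Type*} [MeasurableSpace V] [MeasurableSpace Y]

/-- Minkowski's inequality for the average of a family of functions in `L²`. -/
theorem eLpNorm_two_integral_le {ν : Measure V} [IsProbabilityMeasure ν] {μ : Measure Y}
    [SFinite μ] {G : V → Y → ℝ} (hG : AEStronglyMeasurable (Function.uncurry G) (ν.prod μ))
    {c : ℝ≥0∞} (hc : ∀ᵐ q ∂ν, eLpNorm (G q) 2 μ ≤ c) :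
    eLpNorm (fun x => ∫ q, G q x ∂ν) 2 μ ≤ c := by
  have two : ∀ (h : Y → ℝ), eLpNorm h 2 μ = (∫⁻ x, ‖h x‖ₑ ^ (2:ℝ) ∂μ) ^ (1 / (2:ℝ)) := fun h => by
    rw [eLpNorm_eq_lintegral_rpow_enorm_toReal (by simp) (by simp)]; simp
  rw [two, one_div, ENNReal.rpow_inv_le_iff (by norm_num)]
  -- Jensen's inequality for the square under a probability measure; the rest is Tonelli.
  have h1 : ∀ᵐ x ∂μ, ‖∫ q, G q x ∂ν‖ₑ ^ (2:ℝ) ≤ ∫⁻ q, ‖G q x‖ₑ ^ (2:ℝ) ∂ν := by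
    have hs : AEStronglyMeasurable (fun z : Y × V => G z.2 z.1) (μ.prod ν) := hG.prod_swap
    filter_upwards [hs.prodMk_left] with x hx
    have h2 : ∫⁻ q, ‖G q x‖ₑ ∂ν ≤ eLpNorm (fun q => G q x) 2 ν := by
      rw [← eLpNorm_one_eq_lintegral_enorm]
      exact eLpNorm_le_eLpNorm_of_exponent_le (by norm_num) hx
    have h3 : ‖∫ q, G q x ∂ν‖ₑ ≤ eLpNorm (fun q => G q x) 2 ν :=
      (enorm_integral_le_lintegral_enorm _).trans h2
    rw [eLpNorm_eq_lintegral_rpow_enorm_toReal (by simp) (by simp)] at h3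
    simpa using (ENNReal.le_rpow_inv_iff (by norm_num : (0:ℝ) < 2)).1 (by simpa using h3)
  refine (lintegral_mono_ae h1).trans ?_
  rw [lintegral_lintegral_swap (by
    exact (hG.prod_swap.enorm.pow_const 2))]
  calc ∫⁻ q, ∫⁻ x, ‖G q x‖ₑ ^ (2:ℝ) ∂μ ∂ν ≤ ∫⁻ q, c ^ (2:ℝ) ∂ν := by
        refine lintegral_mono_ae ?_
        filter_upwards [hc] with q hq
        rwa [two, one_div, ENNReal.rpow_inv_le_iff (by norm_num)] at hq
    _ = c ^ (2:ℝ) := by simp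

end Averaging

/-! ### Dominated convergence with vanishing errors -/

section DominatedConvergence

variable {Y : Type*} [MeasurableSpace Y] {μ : Measure Y}

/-- Dominated convergence where the bound may be exceeded by errors that vanish in `L¹`. -/
theorem tendsto_integral_of_le_add {F : ℕ → Y → ℝ} {f b : Y → ℝ} {e : ℕ → Y → ℝ}
    (hF : ∀ k, AEStronglyMeasurable (F k) μ) (hb : Integrable b μ)
    (hfb : ∀ᵐ x ∂μ, |f x| ≤ b x)
    (hFe : ∀ k, ∀ᵐ x ∂μ, |F k x| ≤ b x + e k x)
    (he0 : ∀ k x, 0 ≤ e k x)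
    (he : Tendsto (fun k => ∫⁻ x, ‖e k x‖ₑ ∂μ) atTop (𝓝 0))
    (hlim : ∀ᵐ x ∂μ, Tendsto (fun k => F k x) atTop (𝓝 (f x))) :
    Tendsto (fun k => ∫ x, F k x ∂μ) atTop (𝓝 (∫ x, f x ∂μ)) := by
  -- Clamping to `[-b, b]` gives a sequence with the same limit to which ordinary dominated
  -- convergence applies, and it moves `F k` by at most `e k`.
  let F' : ℕ → Y → ℝ := fun k x => max (-b x) (min (F k x) (b x))
  have hF' : ∀ k, AEStronglyMeasurable (F' k) μ := fun k =>
    hb.aestronglyMeasurable.neg.sup ((hF k).inf hb.aestronglyMeasurable)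
  have hb0 : ∀ᵐ x ∂μ, 0 ≤ b x := by
    filter_upwards [hfb] with x hx using (abs_nonneg _).trans hx
  have hF'b : ∀ k, ∀ᵐ x ∂μ, ‖F' k x‖ ≤ b x := fun k => by
    filter_upwards [hb0] with x hx
    rw [Real.norm_eq_abs, abs_le]
    exact ⟨le_max_left _ _, max_le (by linarith) (min_le_right _ _)⟩
  have l1 : Tendsto (fun k => ∫ x, F' k x ∂μ) atTop (𝓝 (∫ x, f x ∂μ)) := by
    refine tendsto_integral_of_dominated_convergence b hF' hb hF'b ?_
    filter_upwards [hlim, hfb] with x hx hbx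
    have : f x = max (-b x) (min (f x) (b x)) := by
      rw [abs_le] at hbx
      rw [min_eq_left hbx.2, max_eq_right hbx.1]
    rw [this]
    exact tendsto_const_nhds.max (hx.min tendsto_const_nhds)
  have hdiff : ∀ k, ∀ᵐ x ∂μ, ‖F k x - F' k x‖ₑ ≤ ‖e k x‖ₑ := fun k => by
    filter_upwards [hFe k, hb0] with x hx hbx
    rw [← ofReal_norm, ← ofReal_norm]
    apply ENNReal.ofReal_le_ofReal
    have h0 := he0 k x
    rw [Real.norm_eq_abs, Real.norm_eq_abs, abs_of_nonneg h0, abs_le]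
    rw [abs_le] at hx
    simp only [F']
    rcases le_total (F k x) (b x) with h1 | h1
    · rw [min_eq_left h1]
      rcases le_total (-b x) (F k x) with h2 | h2
      · rw [max_eq_right h2]; constructor <;> linarith
      · rw [max_eq_left h2]; constructor <;> linarith
    · rw [min_eq_right h1, max_eq_right (by linarith)]; constructor <;> linarith
  have hfin : ∀ᶠ k in atTop, ∫⁻ x, ‖e k x‖ₑ ∂μ < ⊤ :=
    (he.eventually (gt_mem_nhds (by simp : (0:ℝ≥0∞) < ⊤)))
  have l2 : Tendsto (fun k => ∫ x, F k x ∂μ - ∫ x, F' k x ∂μ) atTop (𝓝 0) := by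
    rw [tendsto_zero_iff_enorm_tendsto_zero]
    refine tendsto_of_tendsto_of_tendsto_of_le_of_le' tendsto_const_nhds he
      (Eventually.of_forall fun _ => zero_le) ?_
    filter_upwards [hfin] with k hk
    have iF' : Integrable (F' k) μ := hb.mono' (hF' k) (hF'b k)
    have iD : Integrable (fun x => F k x - F' k x) μ :=
      ⟨(hF k).sub (hF' k), (lintegral_mono_ae (hdiff k)).trans_lt hk⟩
    have iF : Integrable (F k) μ := by
      have := iD.add iF'
      refine this.congr (Eventually.of_forall fun x => ?_)
      simp
    rw [← integral_sub iF iF']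
    exact (enorm_integral_le_lintegral_enorm _).trans (lintegral_mono_ae (hdiff k))
  simpa using l2.add l1

end DominatedConvergence

/-! ### Smoothing operators and their adjoints -/

section Convolution

open scoped Pointwise

variable {X : Type*} [NormedAddCommGroup X] [NormedSpace ℝ X] [FiniteDimensional ℝ X]
  [MeasurableSpace X] [BorelSpace X] {μ : Measure X} [μ.IsAddHaarMeasure]

/-- The average of translates of `g` against `κ`. -/
noncomputable def smoothing (μ : Measure X) (κ g : X → ℝ) (x : X) : ℝ := ∫ τ, κ τ * g (x + τ) ∂μ

theorem smoothing_eq_convolution (κ g : X → ℝ) :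
    smoothing μ κ g = convolution g (fun τ => κ (-τ)) (ContinuousLinearMap.lsmul ℝ ℝ) μ := by
  ext x
  rw [smoothing, convolution_def, ← integral_sub_right_eq_self _ x]
  refine integral_congr_ae (Eventually.of_forall fun t => ?_)
  simp only [ContinuousLinearMap.lsmul_apply, smul_eq_mul, neg_sub, add_sub_cancel]
  ring

variable {κ g : X → ℝ}

theorem contDiff_smoothing (hκ : ContDiff ℝ ∞ κ) (hκc : HasCompactSupport κ)
    (hg : LocallyIntegrable g μ) : ContDiff ℝ ∞ (smoothing μ κ g) := by
  rw [smoothing_eq_convolution]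
  exact HasCompactSupport.contDiff_convolution_right _ (hκc.comp_homeomorph (Homeomorph.neg X)) hg
    (hκ.comp contDiff_neg)

/-- All derivatives fall on the kernel. The sign comes from `smoothing` being a convolution with the
reflected kernel. -/
theorem fderiv_smoothing (hκ : ContDiff ℝ ∞ κ) (hκc : HasCompactSupport κ)
    (hg : LocallyIntegrable g μ) (x y : X) :
    fderiv ℝ (smoothing μ κ g) x y = -∫ τ, fderiv ℝ κ τ y * g (x + τ) ∂μ := by
  have hc : HasCompactSupport fun τ => κ (-τ) := hκc.comp_homeomorph (Homeomorph.neg X)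
  have hd : ContDiff ℝ ∞ fun τ => κ (-τ) := hκ.comp contDiff_neg
  have hd1 : ContDiff ℝ 1 fun τ => κ (-τ) := hd.of_le (by exact_mod_cast le_top)
  rw [smoothing_eq_convolution,
    (HasCompactSupport.hasFDerivAt_convolution_right _ hc hg hd1 x).fderiv,
    convolution_precompR_apply _ hg (hc.fderiv ℝ) (hd1.continuous_fderiv (by simp)),
    convolution_def, ← integral_neg]
  rw [← integral_sub_right_eq_self (fun τ => -(fderiv ℝ κ τ y * g (x + τ))) x]
  refine integral_congr_ae (Eventually.of_forall fun t => ?_)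
  have h1 : fderiv ℝ (fun τ => κ (-τ)) (x - t) y = - fderiv ℝ κ (t - x) y := by
    have e : HasFDerivAt (fun τ => κ (-τ))
        ((fderiv ℝ κ (-(x - t))).comp (-ContinuousLinearMap.id ℝ X)) (x - t) :=
      ((hκ.differentiable (by simp)) _).hasFDerivAt.comp _ (hasFDerivAt_id _).neg
    rw [e.fderiv]
    simp
  simp only [ContinuousLinearMap.lsmul_apply, smul_eq_mul, h1, add_sub_cancel]
  ring

theorem support_smoothing_subset :
    Function.support (smoothing μ κ g) ⊆
      Function.support g + Function.support (fun τ => κ (-τ)) := by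
  rw [smoothing_eq_convolution]
  exact support_convolution_subset _

/-- Fubini and the substitution `x ↦ x - τ` move the smoothing from the test function to the data.
The functionals `ℓ τ` cover both the derivative of the kernel, paired with a vector field, and the
kernel itself, paired with a scalar source. -/
theorem integral_apply_smoothing {G : Type*} [NormedAddCommGroup G] [NormedSpace ℝ G]
    [CompleteSpace G] {A : X → G} (hA : Integrable A μ) {ℓ : X → G →L[ℝ] ℝ}
    (hℓ : Integrable ℓ μ) (hg : Measurable g) {N : ℝ} (hN : ∀ x, |g x| ≤ N) :
    ∫ x, ∫ τ, ℓ τ (A x) * g (x + τ) ∂μ ∂μ = ∫ τ, ℓ τ (∫ x, g x • A (x - τ) ∂μ) ∂μ := by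
  have hint : Integrable (fun z : X × X => ℓ z.2 (A z.1) * g (z.1 + z.2)) (μ.prod μ) := by
    have h1 : Integrable (fun z : X × X => ‖A z.1‖ * ‖ℓ z.2‖) (μ.prod μ) := hA.norm.mul_prod hℓ.norm
    have hA' : AEStronglyMeasurable (fun z : X × X => A z.1) (μ.prod μ) := hA.1.comp_fst
    have hℓ' : AEStronglyMeasurable (fun z : X × X => ℓ z.2) (μ.prod μ) := hℓ.1.comp_snd
    refine (h1.mul_const N).mono' ?_ (Eventually.of_forall fun z => ?_)
    · have hm : Measurable fun z : X × X => g (z.1 + z.2) := hg.comp measurable_add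
      refine AEStronglyMeasurable.mul ?_ hm.aestronglyMeasurable
      exact (ContinuousLinearMap.apply ℝ ℝ (E := G)).flip.aestronglyMeasurable_comp₂ hℓ' hA'
    · rw [norm_mul]
      have := (ℓ z.2).le_opNorm (A z.1)
      calc ‖ℓ z.2 (A z.1)‖ * ‖g (z.1 + z.2)‖ ≤ (‖ℓ z.2‖ * ‖A z.1‖) * N := by
            gcongr; exact hN _
        _ = _ := by ring
  rw [integral_integral_swap hint]
  refine integral_congr_ae (Eventually.of_forall fun τ => ?_)
  have hgA : Integrable (fun x => g x • A (x - τ)) μ :=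
    (hA.comp_sub_right τ).bdd_smul N hg.aestronglyMeasurable (Eventually.of_forall hN)
  simp only
  rw [← ContinuousLinearMap.integral_comp_comm _ hgA,
    ← integral_sub_right_eq_self (fun x => ℓ τ (A x) * g (x + τ)) τ]
  refine integral_congr_ae (Eventually.of_forall fun x => ?_)
  simp only [sub_add_cancel, map_smul, smul_eq_mul]
  ring

/-- The same adjoint relation on the space with two velocities, where a shift acts through `J`.
Fubini is legitimate because Cauchy–Schwarz bounds the pairing uniformly in the shift. -/
theorem integral_mul_smoothing_diag {X' : Type*} [NormedAddCommGroup X'] [NormedSpace ℝ X']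
    [FiniteDimensional ℝ X'] [MeasurableSpace X'] [BorelSpace X'] {μ' : Measure X'}
    [μ'.IsAddHaarMeasure] {W Ψ : X' → ℝ} (hW : MemLp W 2 μ') (hΨ : MemLp Ψ 2 μ')
    (hΨm : Measurable Ψ) (hκ : Integrable κ μ) (J : X →L[ℝ] X') :
    ∫ P, W P * (∫ τ, κ τ * Ψ (P + J τ) ∂μ) ∂μ' =
      ∫ τ, κ τ * (∫ P, W (P - J τ) * Ψ P ∂μ') ∂μ := by
  have hsh : ∀ τ, ∫ P, W P * Ψ (P + J τ) ∂μ' = ∫ P, W (P - J τ) * Ψ P ∂μ' := fun τ => by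
    rw [← integral_sub_right_eq_self (fun x => W x * Ψ (x + J τ)) (J τ)]
    simp
  have hint : Integrable (fun z : X' × X => κ z.2 * (W z.1 * Ψ (z.1 + J z.2))) (μ'.prod μ) := by
    have hWz : AEStronglyMeasurable (fun z : X' × X => W z.1) (μ'.prod μ) := hW.1.comp_fst
    have hκz : AEStronglyMeasurable (fun z : X' × X => κ z.2) (μ'.prod μ) := hκ.1.comp_snd
    have hm : Measurable fun z : X' × X => Ψ (z.1 + J z.2) :=
      hΨm.comp (measurable_fst.add (J.continuous.measurable.comp measurable_snd))
    have hmz : AEStronglyMeasurable (fun z : X' × X => κ z.2 * (W z.1 * Ψ (z.1 + J z.2)))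
      (μ'.prod μ) := hκz.mul (hWz.mul hm.aestronglyMeasurable)
    refine ⟨hmz, ?_⟩
    rw [HasFiniteIntegral, lintegral_prod_symm _ hmz.enorm]
    have hb : ∀ τ, ∫⁻ P, ‖κ τ * (W P * Ψ (P + J τ))‖ₑ ∂μ' ≤
        ‖κ τ‖ₑ * (eLpNorm W 2 μ' * eLpNorm Ψ 2 μ') := fun τ => by
      simp_rw [enorm_mul (κ τ)]
      rw [lintegral_const_mul' _ _ enorm_ne_top]
      gcongr
      have hΨs : Measurable fun P => Ψ (P + J τ) := hΨm.comp (measurable_add_const _)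
      refine (lintegral_enorm_mul_le_eLpNorm_two hW.1 hΨs.aestronglyMeasurable).trans_eq ?_
      congr 1
      exact eLpNorm_comp_measurePreserving hΨ.1 (measurePreserving_add_right μ' (J τ))
    refine (lintegral_mono hb).trans_lt ?_
    rw [lintegral_mul_const' _ _ (ENNReal.mul_ne_top hW.2.ne hΨ.2.ne)]
    exact ENNReal.mul_lt_top hκ.2 (ENNReal.mul_lt_top hW.2 hΨ.2)
  calc ∫ P, W P * (∫ τ, κ τ * Ψ (P + J τ) ∂μ) ∂μ'
      = ∫ P, ∫ τ, κ τ * (W P * Ψ (P + J τ)) ∂μ ∂μ' := by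
        refine integral_congr_ae (Eventually.of_forall fun P => ?_)
        simp only
        rw [← integral_const_mul]
        congr 1; ext τ; ring
    _ = ∫ τ, ∫ P, κ τ * (W P * Ψ (P + J τ)) ∂μ' ∂μ := integral_integral_swap hint
    _ = _ := by
        refine integral_congr_ae (Eventually.of_forall fun τ => ?_)
        simp only
        rw [integral_const_mul, hsh]

/-- A continuous function vanishes at the origin if its integrals against all small bumps do. -/
theorem eq_zero_of_integral_bump_eq_zero {G : X → ℝ} (hG : Continuous G) {r : ℝ} (hr : 0 < r)
    (h : ∀ θ : X → ℝ, ContDiff ℝ ∞ θ → HasCompactSupport θ → tsupport θ ⊆ Metric.closedBall 0 r →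
      ∫ z, θ z * G z ∂μ = 0) : G 0 = 0 := by
  let φ : ℕ → ContDiffBump (0 : X) := fun k =>
    ⟨r / (2 * (k + 1)), r / (k + 1), by positivity, by
      apply div_lt_div_of_pos_left hr (by positivity)
      have : (0:ℝ) < k + 1 := by positivity
      linarith⟩
  have hφ : Tendsto (fun k => (φ k).rOut) atTop (𝓝 0) := by
    have := (tendsto_const_div_atTop_nhds_zero_nat r).comp (tendsto_add_atTop_nat 1)
    refine this.congr fun k => ?_
    simp [φ]
  have h1 := ContDiffBump.convolution_tendsto_right_of_continuous (μ := μ) hφ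
    (hG.comp continuous_neg) 0
  have h2 : ∀ k, convolution ((φ k).normed μ) (G ∘ Neg.neg) (ContinuousLinearMap.lsmul ℝ ℝ) μ 0
      = 0 := fun k => by
    rw [convolution_def]
    simp only [Function.comp, zero_sub, neg_neg, ContinuousLinearMap.lsmul_apply, smul_eq_mul]
    refine h _ (φ k).contDiff_normed (φ k).hasCompactSupport_normed ?_
    rw [ContDiffBump.tsupport_normed_eq]
    refine Metric.closedBall_subset_closedBall ?_
    change r / (k + 1) ≤ r
    exact div_le_self hr.le (by linarith [(Nat.cast_nonneg k : (0:ℝ) ≤ k)])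
  simp_rw [h2] at h1
  simpa using (tendsto_nhds_unique h1 tendsto_const_nhds)

end Convolution

/-! ### The weak equation with rough test functions -/

section MollifiedTest

variable {V E : Type*} [NormedAddCommGroup V] [NormedSpace ℝ V] [FiniteDimensional ℝ V]
  [MeasureSpace V] [BorelSpace V] [(volume : Measure V).IsAddHaarMeasure]
  [NormedAddCommGroup E] [NormedSpace ℝ E] [FiniteDimensional ℝ E]
  [MeasureSpace E] [BorelSpace E] [(volume : Measure E).IsAddHaarMeasure]

instance isAddHaarMeasure_volume_prod : (volume : Measure (V × E)).IsAddHaarMeasure :=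
  inferInstanceAs ((volume : Measure V).prod (volume : Measure E)).IsAddHaarMeasure

/-- The difference `g(p,w) - g(p,v)`, weighted by `k(v - w)`. -/
def wdiff (k : E → ℝ) (g : V × E → ℝ) (P : V × (E × E)) : ℝ :=
  (g (P.1, P.2.2) - g (P.1, P.2.1)) * k (P.2.1 - P.2.2)

theorem measurable_wdiff {k : E → ℝ} (hk : Measurable k) {g : V × E → ℝ} (hg : Measurable g) :
    Measurable (wdiff k g) := by
  unfold wdiff
  fun_prop

/-- The translations of `V × E`, acting diagonally on the velocities. -/
def diagShift (V E : Type*) [NormedAddCommGroup V] [NormedSpace ℝ V] [NormedAddCommGroup E]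
    [NormedSpace ℝ E] : V × E →L[ℝ] V × (E × E) :=
  (ContinuousLinearMap.fst ℝ V E).prod
    ((ContinuousLinearMap.snd ℝ V E).prod (ContinuousLinearMap.snd ℝ V E))

theorem diagShift_apply (τ : V × E) : diagShift V E τ = (τ.1, (τ.2, τ.2)) := rfl

/-- The weight depends on `v - w` alone, so shifting both velocities together leaves it unchanged.
-/
theorem wdiff_smoothing {k : E → ℝ} {κ g : V × E → ℝ} (hκ : Integrable κ)
    (hg : Measurable g) {N : ℝ} (hN : ∀ x, |g x| ≤ N) (P : V × (E × E)) :
    wdiff k (smoothing volume κ g) P = ∫ τ, κ τ * wdiff k g (P + diagShift V E τ) := by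
  have hi : ∀ x, Integrable fun τ => κ τ * g (x + τ) := fun x => by
    refine hκ.mul_bdd (c := N) ?_ (Eventually.of_forall fun _ => hN _)
    exact (hg.comp (measurable_const_add x)).aestronglyMeasurable
  rw [wdiff, smoothing, smoothing, ← integral_sub (hi _) (hi _), ← integral_mul_const]
  congr 1
  ext τ
  obtain ⟨p, v, w⟩ := P
  obtain ⟨q, z⟩ := τ
  simp only [wdiff, diagShift_apply, Prod.mk_add_mk, add_sub_add_right_eq_sub]
  ring

/-- The weak equation with mollified test functions `ρ * g`, where `g` is only bounded, with
compact support and finite nonlocal energy. All integrals are expressed by translating the data. -/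
theorem weak_equation_mollified {O : Set V} {B : Set E} {k : E → ℝ} (hk : Measurable k)
    {Fv : V × E → V} (hFv : Integrable Fv) {A : V × E → ℝ} (hA : Integrable A)
    {W : V × (E × E) → ℝ} (hW : MemLp W 2)
    (HW : ∀ φ : V × E → ℝ, ContDiff ℝ ∞ φ → HasCompactSupport φ → tsupport φ ⊆ O ×ˢ B →
      -∫ x, fderiv ℝ φ x (Fv x, 0) = -(∫ P, W P * wdiff k φ P) + ∫ x, A x * φ x)
    {g : V × E → ℝ} (hg : Measurable g) {N : ℝ} (hN : ∀ x, |g x| ≤ N)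
    {S : Set V} {D : Set E} (hS : IsCompact S) (hD : IsCompact D)
    (hgS : ∀ x, g x ≠ 0 → x ∈ S ×ˢ D) (hΨ : MemLp (wdiff k g) 2)
    {ρ : V → ℝ} (hρ : ContDiff ℝ ∞ ρ) (hρc : HasCompactSupport ρ)
    (hρO : ∀ p ∈ S, ∀ q ∈ tsupport ρ, p - q ∈ O)
    {r : ℝ} (hr : 0 < r) (hB : ∀ v ∈ D, ∀ z, ‖z‖ ≤ r → v - z ∈ B) :
    ∫ q, fderiv ℝ ρ q (∫ x, g x • Fv (x - (q, 0))) =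
      -(∫ q, ρ q * ∫ P, W (P - (q, 0)) * wdiff k g P) +
        ∫ q, ρ q * ∫ x, g x * A (x - (q, 0)) := by
  have hcC : Continuous fun τ : V × E => ∫ x, g x • Fv (x - τ) :=
    continuous_integral_smul_translate hFv hg.aestronglyMeasurable hN
  have hcA : Continuous fun τ : V × E => ∫ x, g x * A (x - τ) :=
    continuous_integral_smul_translate hA hg.aestronglyMeasurable hN
  have hcB : Continuous fun τ : V × E => ∫ P, W (P - diagShift V E τ) * wdiff k g P :=
    (continuous_integral_translate_mul hW hΨ).comp (diagShift V E).continuous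
  set C : V × E → V := fun τ => ∫ x, g x • Fv (x - τ) with hC
  set cA : V × E → ℝ := fun τ => ∫ x, g x * A (x - τ) with hcA_def
  set cB : V × E → ℝ := fun τ => ∫ P, W (P - diagShift V E τ) * wdiff k g P with hcB_def
  have hgint : Integrable g := by
    have hSD : MeasurableSet (S ×ˢ D) := (hS.prod hD).isClosed.measurableSet
    have : Integrable (indicator (S ×ˢ D) fun _ : V × E => N) :=
      (integrable_indicator_iff hSD).2 (integrableOn_const (hS.prod hD).measure_lt_top.ne)
    refine this.mono' hg.aestronglyMeasurable (Eventually.of_forall fun x => ?_)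
    by_cases hx : g x = 0
    · rw [hx, norm_zero]
      exact indicator_nonneg (fun y _ => (abs_nonneg _).trans (hN y)) x
    · rw [indicator_of_mem (hgS x hx)]; exact hN x
  -- The defect of the equation when the data are translated by `(q, z)`. It is continuous in `(q,
  -- z)` although `g` is rough, and the assertion is that its integral over `q` vanishes at `z = 0`.
  set Γ : V → E → ℝ := fun q z =>
    fderiv ℝ ρ q (C (q, z)) + ρ q * cB (q, z) - ρ q * cA (q, z) with hΓ
  have hρ1 : Continuous (fderiv ℝ ρ) := hρ.continuous_fderiv (by simp)
  have hΓc : Continuous fun τ : V × E => Γ τ.1 τ.2 := by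
    have h1 : Continuous fun τ : V × E => fderiv ℝ ρ τ.1 (C (τ.1, τ.2)) :=
      (hρ1.comp continuous_fst).clm_apply hcC
    have h2 : Continuous fun τ : V × E => ρ τ.1 := hρ.continuous.comp continuous_fst
    exact (h1.add (h2.mul hcB)).sub (h2.mul hcA)
  have hΓ0 : ∀ q ∉ tsupport ρ, ∀ z, Γ q z = 0 := fun q hq z => by
    have h1 : ρ q = 0 := image_eq_zero_of_notMem_tsupport hq
    have h2 : fderiv ℝ ρ q = 0 := fderiv_of_notMem_tsupport ℝ hq
    simp [hΓ, h1, h2]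
  -- With the product kernel `ρ ⊗ θ` the smoothed `g` is an admissible test function; as `θ` varies
  -- this determines `z ↦ ∫ Γ q z dq` near the origin.
  have key : ∀ θ : E → ℝ, ContDiff ℝ ∞ θ → HasCompactSupport θ →
      tsupport θ ⊆ Metric.closedBall 0 r → ∫ z, θ z * (∫ q, Γ q z) = 0 := by
    intro θ hθ hθc hθr
    set κ : V × E → ℝ := fun τ => ρ τ.1 * θ τ.2 with hκ_def
    have hκ : ContDiff ℝ ∞ κ := (hρ.comp contDiff_fst).mul (hθ.comp contDiff_snd)
    have hκs : Function.support κ ⊆ tsupport ρ ×ˢ tsupport θ := fun τ hτ => by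
      rw [Function.mem_support, hκ_def] at hτ
      exact ⟨subset_tsupport _ (left_ne_zero_of_mul hτ),
        subset_tsupport _ (right_ne_zero_of_mul hτ)⟩
    have hκc : HasCompactSupport κ :=
      HasCompactSupport.intro (hρc.isCompact.prod hθc.isCompact) fun τ hτ => by
        by_contra h; exact hτ (hκs h)
    have hκi : Integrable κ := hκ.continuous.integrable_of_hasCompactSupport hκc
    have hκ' : ∀ τ y, fderiv ℝ κ τ (y, 0) = θ τ.2 * fderiv ℝ ρ τ.1 y := by
      intro τ y
      have e1 : HasFDerivAt (fun τ : V × E => ρ τ.1)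
          ((fderiv ℝ ρ τ.1).comp (ContinuousLinearMap.fst ℝ V E)) τ :=
        (hρ.differentiable (by simp) τ.1).hasFDerivAt.comp τ hasFDerivAt_fst
      have e2 : HasFDerivAt (fun τ : V × E => θ τ.2)
          ((fderiv ℝ θ τ.2).comp (ContinuousLinearMap.snd ℝ V E)) τ :=
        (hθ.differentiable (by simp) τ.2).hasFDerivAt.comp τ hasFDerivAt_snd
      have e3 : HasFDerivAt κ _ τ := e1.mul e2
      rw [e3.fderiv]
      simp
    have hsupp : tsupport (smoothing volume κ g) ⊆ O ×ˢ B := by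
      let Kc : Set (V × E) :=
        (fun x : (V × E) × (V × E) => x.1 - x.2) '' ((S ×ˢ D) ×ˢ (tsupport ρ ×ˢ tsupport θ))
      have hKc : IsCompact Kc :=
        ((hS.prod hD).prod (hρc.isCompact.prod hθc.isCompact)).image (by fun_prop)
      have h1 : Function.support (smoothing volume κ g) ⊆ Kc := by
        refine support_smoothing_subset.trans ?_
        rintro _ ⟨a, ha, b, hb, rfl⟩
        exact ⟨(a, -b), ⟨hgS a ha, hκs hb⟩, by simp⟩
      refine (closure_minimal h1 hKc.isClosed).trans ?_
      rintro _ ⟨⟨a, b⟩, ⟨ha, hb⟩, rfl⟩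
      refine ⟨hρO _ ha.1 _ hb.1, hB _ ha.2 _ ?_⟩
      simpa using hθr hb.2
    have hcs : HasCompactSupport (smoothing volume κ g) := by
      rw [smoothing_eq_convolution]
      exact HasCompactSupport.convolution _
        (HasCompactSupport.intro (hS.prod hD) fun x hx => by
          by_contra h; exact hx (hgS x h))
        (hκc.comp_homeomorph (Homeomorph.neg _))
    have hW1 := HW _ (contDiff_smoothing hκ hκc hgint.locallyIntegrable) hcs hsupp
    have t1 : ∫ x, fderiv ℝ (smoothing volume κ g) x (Fv x, 0) =
        -∫ τ, θ τ.2 * fderiv ℝ ρ τ.1 (C τ) := by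
      let ℓ : V × E → V →L[ℝ] ℝ := fun τ => (fderiv ℝ κ τ).comp (ContinuousLinearMap.inl ℝ V E)
      have hℓ : Integrable ℓ := by
        have h1 : Continuous ℓ := (hκ.continuous_fderiv (by simp)).clm_comp continuous_const
        refine h1.integrable_of_hasCompactSupport ?_
        refine (hκc.fderiv ℝ).mono fun τ hτ => ?_
        rw [Function.mem_support] at hτ ⊢
        intro h
        exact hτ (by simp [ℓ, h])
      have h2 := integral_apply_smoothing hFv hℓ hg hN
      simp_rw [fderiv_smoothing hκ hκc hgint.locallyIntegrable, integral_neg]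
      congr 1
      refine Eq.trans ?_ (h2.trans ?_)
      · rfl
      · refine integral_congr_ae (Eventually.of_forall fun τ => ?_)
        change fderiv ℝ κ τ (C τ, 0) = _
        rw [hκ']
    have t2 : ∫ x, A x * smoothing volume κ g x = ∫ τ, κ τ * cA τ := by
      have h2 := integral_apply_smoothing hA (ℓ := fun τ => κ τ • ContinuousLinearMap.id ℝ ℝ)
        (hκi.smul_const _) hg hN
      refine Eq.trans ?_ (h2.trans ?_)
      · refine integral_congr_ae (Eventually.of_forall fun x => ?_)
        simp only [smoothing]
        rw [← integral_const_mul]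
        congr 1; ext τ
        simp; ring
      · simp [hcA_def]
    have t3 : ∫ P, W P * wdiff k (smoothing volume κ g) P = ∫ τ, κ τ * cB τ := by
      simp_rw [wdiff_smoothing hκi hg hN]
      exact integral_mul_smoothing_diag hW hΨ (measurable_wdiff hk hg) hκi (diagShift V E)
    rw [t1, t2, t3] at hW1
    have hcs' : ∀ f : V × E → ℝ, (∀ τ, κ τ = 0 → τ ∉ tsupport ρ ×ˢ tsupport θ → f τ = 0) →
        HasCompactSupport f := fun f hf =>
      HasCompactSupport.intro (hρc.isCompact.prod hθc.isCompact) fun τ hτ =>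
        hf τ (by by_contra h; exact hτ (hκs h)) hτ
    have i1 : Integrable fun τ : V × E => θ τ.2 * fderiv ℝ ρ τ.1 (C τ) := by
      refine Continuous.integrable_of_hasCompactSupport ?_ (hcs' _ fun τ _ hτ => ?_)
      · exact (hθ.continuous.comp continuous_snd).mul ((hρ1.comp continuous_fst).clm_apply hcC)
      · rw [mem_prod, not_and_or] at hτ
        rcases hτ with h | h
        · simp [fderiv_of_notMem_tsupport ℝ h]
        · simp [image_eq_zero_of_notMem_tsupport h]
    have i2 : Integrable fun τ : V × E => κ τ * cB τ :=
      (hκ.continuous.mul hcB).integrable_of_hasCompactSupport (hcs' _ fun τ h _ => by simp [h])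
    have i3 : Integrable fun τ : V × E => κ τ * cA τ :=
      (hκ.continuous.mul hcA).integrable_of_hasCompactSupport (hcs' _ fun τ h _ => by simp [h])
    have e1 : ∫ τ : V × E, θ τ.2 * Γ τ.1 τ.2 = 0 := by
      have : ∫ τ : V × E, θ τ.2 * Γ τ.1 τ.2 =
          (∫ τ : V × E, θ τ.2 * fderiv ℝ ρ τ.1 (C τ)) + (∫ τ, κ τ * cB τ) - ∫ τ, κ τ * cA τ := by
        rw [← integral_add i1 i2, ← integral_sub (by exact i1.add i2) i3]
        refine integral_congr_ae (Eventually.of_forall fun τ => ?_)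
        simp only [hΓ, hκ_def]
        ring
      rw [this]; linarith
    have i4 : Integrable fun τ : V × E => θ τ.2 * Γ τ.1 τ.2 := by
      refine ((i1.add i2).sub i3).congr (Eventually.of_forall fun τ => ?_)
      simp only [hΓ, hκ_def, Pi.add_apply, Pi.sub_apply]
      ring
    rw [Measure.volume_eq_prod, integral_prod_symm _ i4] at e1
    rw [← e1]
    refine integral_congr_ae (Eventually.of_forall fun z => ?_)
    simp only
    rw [integral_const_mul]
  have hGc : Continuous fun z => ∫ q, Γ q z := by
    have h1 : Continuous (Function.uncurry fun (z : E) (q : V) => Γ q z) :=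
      hΓc.comp continuous_swap
    have h2 := continuous_parametric_integral_of_continuous (μ := volume) h1 hρc.isCompact
    refine h2.congr fun z => ?_
    exact setIntegral_eq_integral_of_forall_compl_eq_zero fun q hq => hΓ0 q hq z
  -- This removes the velocity mollification exactly, with no limit in the test functions.
  have h0 := eq_zero_of_integral_bump_eq_zero hGc hr key
  have cs : ∀ f : V → ℝ, (∀ q ∉ tsupport ρ, f q = 0) → HasCompactSupport f := fun f hf =>
    HasCompactSupport.intro hρc.isCompact hf
  have c0 : Continuous fun q : V => (q, (0 : E)) := by fun_prop
  have j1 : Integrable fun q : V => fderiv ℝ ρ q (C (q, 0)) := by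
    refine Continuous.integrable_of_hasCompactSupport (hρ1.clm_apply (hcC.comp c0)) (cs _ ?_)
    intro q hq
    simp [fderiv_of_notMem_tsupport ℝ hq]
  have j2 : Integrable fun q : V => ρ q * cB (q, 0) := by
    refine Continuous.integrable_of_hasCompactSupport (hρ.continuous.mul (hcB.comp c0)) (cs _ ?_)
    intro q hq
    simp [image_eq_zero_of_notMem_tsupport hq]
  have j3 : Integrable fun q : V => ρ q * cA (q, 0) := by
    refine Continuous.integrable_of_hasCompactSupport (hρ.continuous.mul (hcA.comp c0)) (cs _ ?_)
    intro q hq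
    simp [image_eq_zero_of_notMem_tsupport hq]
  have h3 : (∫ q, fderiv ℝ ρ q (C (q, 0))) + (∫ q, ρ q * cB (q, 0)) - ∫ q, ρ q * cA (q, 0) = 0 := by
    rw [← integral_add j1 j2, ← integral_sub (by exact j1.add j2) j3]
    exact h0
  have h4 : ∀ q, cB (q, 0) = ∫ P, W (P - (q, 0)) * wdiff k g P := fun q => rfl
  simp_rw [h4] at h3
  linarith

end MollifiedTest

/-! ### Averages in the base variable only -/

section PartialAverage

variable {V Y : Type*} [NormedAddCommGroup V] [NormedSpace ℝ V] [FiniteDimensional ℝ V]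
  [MeasureSpace V] [BorelSpace V] [(volume : Measure V).IsAddHaarMeasure]
  [NormedAddCommGroup Y] [NormedSpace ℝ Y] [FiniteDimensional ℝ Y]
  [MeasureSpace Y] [BorelSpace Y] [(volume : Measure Y).IsAddHaarMeasure]

/-- The average of `h` against `ρ` in the first variable. -/
noncomputable def avg (ρ : V → ℝ) (h : V × Y → ℝ) (x : V × Y) : ℝ := ∫ q, ρ q * h (x.1 - q, x.2)

theorem measurable_avg {ρ : V → ℝ} (hρ : Measurable ρ) {h : V × Y → ℝ} (hh : Measurable h) :
    Measurable (avg ρ h) := by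
  have : Measurable fun z : (V × Y) × V => ρ z.2 * h (z.1.1 - z.2, z.1.2) := by fun_prop
  exact (this.stronglyMeasurable.integral_prod_right (ν := volume)).measurable

theorem ae_memLp_slice {h : V × Y → ℝ} (hh : MemLp h 2) :
    ∀ᵐ y : Y, MemLp (fun p : V => h (p, y)) 2 := by
  have h1 : Integrable (fun x => h x ^ 2) ((volume : Measure V).prod (volume : Measure Y)) :=
    (memLp_two_iff_integrable_sq hh.1).1 hh
  have h2 : AEStronglyMeasurable h ((volume : Measure V).prod (volume : Measure Y)) := hh.1
  filter_upwards [h1.prod_left_ae, h2.prod_swap.prodMk_left] with y hy hy'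
  exact (memLp_two_iff_integrable_sq hy').2 hy

theorem ae_locallyIntegrable_slice {h : V × Y → ℝ} (hh : MemLp h 2) :
    ∀ᵐ y : Y, LocallyIntegrable (fun p : V => h (p, y)) := by
  filter_upwards [ae_memLp_slice hh] with y hy using hy.locallyIntegrable (by norm_num)

theorem integrable_mul_translate {ρ : V → ℝ} (hρ : Continuous ρ) (hρc : HasCompactSupport ρ)
    {u : V → ℝ} (hu : LocallyIntegrable u) (p : V) : Integrable fun q => ρ q * u (p - q) :=
  hρc.convolutionExists_left (ContinuousLinearMap.lsmul ℝ ℝ) hρ hu p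

theorem hasFDerivAt_avg {ρ : V → ℝ} (hρ : ContDiff ℝ ∞ ρ) (hρc : HasCompactSupport ρ)
    {h : V × Y → ℝ} {y : Y} (hy : LocallyIntegrable fun p : V => h (p, y)) :
    ContDiff ℝ ∞ (fun p => avg ρ h (p, y)) ∧ ∀ p z,
      fderiv ℝ (fun p => avg ρ h (p, y)) p z = ∫ q, fderiv ℝ ρ q z * h (p - q, y) := by
  have e : (fun p => avg ρ h (p, y)) =
      convolution ρ (fun p => h (p, y)) (ContinuousLinearMap.lsmul ℝ ℝ) volume := rfl
  have hρ1 : ContDiff ℝ 1 ρ := hρ.of_le (by exact_mod_cast le_top)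
  rw [e]
  refine ⟨hρc.contDiff_convolution_left _ hρ hy, fun p z => ?_⟩
  rw [(hρc.hasFDerivAt_convolution_left _ hρ1 hy p).fderiv, convolution_def,
    ContinuousLinearMap.integral_apply]
  · rfl
  · exact (hρc.fderiv ℝ).convolutionExists_left _ (hρ1.continuous_fderiv (by simp)) hy p

/-- The probability measure whose density is a normed bump. -/
noncomputable def bumpMeasure (φ : ContDiffBump (0 : V)) : Measure V :=
  volume.withDensity fun q => ENNReal.ofReal (φ.normed volume q)

instance isProbabilityMeasure_bumpMeasure (φ : ContDiffBump (0 : V)) :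
    IsProbabilityMeasure (bumpMeasure φ) := by
  constructor
  rw [bumpMeasure, withDensity_apply _ MeasurableSet.univ, Measure.restrict_univ,
    ← ofReal_integral_eq_lintegral_ofReal φ.integrable_normed
      (Eventually.of_forall fun q => φ.nonneg_normed q), φ.integral_normed, ENNReal.ofReal_one]

theorem integral_bumpMeasure (φ : ContDiffBump (0 : V)) (u : V → ℝ) :
    ∫ q, u q ∂(bumpMeasure φ) = ∫ q, φ.normed volume q * u q := by
  rw [bumpMeasure, integral_withDensity_eq_integral_toReal_smul₀
    φ.continuous_normed.measurable.ennreal_ofReal.aemeasurable (by simp)]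
  refine integral_congr_ae (Eventually.of_forall fun q => ?_)
  simp [ENNReal.toReal_ofReal (φ.nonneg_normed q)]

theorem integrable_bumpMeasure (φ : ContDiffBump (0 : V)) (u : V → ℝ) :
    Integrable u (bumpMeasure φ) ↔ Integrable fun q => φ.normed volume q * u q := by
  rw [bumpMeasure, integrable_withDensity_iff_integrable_smul₀'
    φ.continuous_normed.measurable.ennreal_ofReal.aemeasurable (by simp)]
  refine integrable_congr (Eventually.of_forall fun q => ?_)
  simp [ENNReal.toReal_ofReal (φ.nonneg_normed q)]

theorem ae_bumpMeasure (φ : ContDiffBump (0 : V)) : ∀ᵐ q ∂(bumpMeasure φ), ‖q‖ < φ.rOut := by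
  rw [bumpMeasure, ae_withDensity_iff φ.continuous_normed.measurable.ennreal_ofReal]
  refine Eventually.of_forall fun q hq => ?_
  have : q ∈ Function.support (φ.normed volume) := fun h => hq (by simp [h])
  rw [φ.support_normed_eq] at this
  simpa using this

/-- An average of translates under a probability measure, each of the same norm. -/
theorem eLpNorm_avg_le (φ : ContDiffBump (0 : V)) {h : V × Y → ℝ} (hh : Measurable h) :
    eLpNorm (avg (φ.normed volume) h) 2 ≤ eLpNorm h 2 volume := by
  have e : avg (φ.normed volume) h = fun x => ∫ q, h (x.1 - q, x.2) ∂(bumpMeasure φ) := by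
    ext x; rw [integral_bumpMeasure]; rfl
  rw [e]
  refine eLpNorm_two_integral_le (G := fun (q : V) (x : V × Y) => h (x.1 - q, x.2)) ?_
    (Eventually.of_forall fun q => ?_)
  · have : Measurable fun z : V × (V × Y) => h (z.2.1 - z.1, z.2.2) := by fun_prop
    exact this.aestronglyMeasurable
  · have := eLpNorm_translate (μ := (volume : Measure (V × Y))) (p := 2)
      hh.aestronglyMeasurable (q, 0)
    refine le_of_eq ?_
    rw [← this]
    congr 1; ext x
    rw [show x - (q, (0 : Y)) = (x.1 - q, x.2) by ext <;> simp]

theorem tendsto_eLpNorm_avg_sub {φ : ℕ → ContDiffBump (0 : V)}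
    (hφ : Tendsto (fun j => (φ j).rOut) atTop (𝓝 0)) {h : V × Y → ℝ} (hh : Measurable h)
    (hh2 : MemLp h 2) :
    Tendsto (fun j => eLpNorm (fun x => avg ((φ j).normed volume) h x - h x) 2) atTop (𝓝 0) := by
  have key := (tendsto_eLpNorm_translate_sub (p := 2) (by norm_num) (by simp) hh2).comp
    ((show Continuous fun q : V => (q, (0 : Y)) by fun_prop).tendsto 0)
  rw [ENNReal.tendsto_nhds_zero] at key ⊢
  intro ε hε
  obtain ⟨r, hr, hrε⟩ := Metric.eventually_nhds_iff.1 (key ε hε)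
  filter_upwards [hφ.eventually (gt_mem_nhds hr)] with j hj
  have hae : ∀ᵐ x : V × Y, avg ((φ j).normed volume) h x - h x =
      ∫ q, (h (x.1 - q, x.2) - h x) ∂(bumpMeasure (φ j)) := by
    have := Measure.quasiMeasurePreserving_snd (μ := (volume : Measure V))
      (ν := (volume : Measure Y)) |>.ae (ae_locallyIntegrable_slice hh2)
    filter_upwards [this] with x hx
    have hi : Integrable (fun q => h (x.1 - q, x.2)) (bumpMeasure (φ j)) := by
      rw [integrable_bumpMeasure]
      exact integrable_mul_translate (φ j).continuous_normed (φ j).hasCompactSupport_normed hx x.1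
    rw [integral_sub hi (integrable_const _), integral_bumpMeasure]
    simp [avg]
  rw [eLpNorm_congr_ae hae]
  refine eLpNorm_two_integral_le (G := fun (q : V) (x : V × Y) => h (x.1 - q, x.2) - h x) ?_ ?_
  · have : Measurable fun z : V × (V × Y) => h (z.2.1 - z.1, z.2.2) - h z.2 := by fun_prop
    exact this.aestronglyMeasurable
  · filter_upwards [ae_bumpMeasure (φ j)] with q hq
    have := hrε (y := q) (by rw [dist_zero_right]; exact hq.trans hj)
    refine le_trans (le_of_eq ?_) this
    simp only [Function.comp]
    congr 1; ext x
    rw [show x - (q, (0 : Y)) = (x.1 - q, x.2) by ext <;> simp]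

/-- Mollifiers along which the averages of a given function converge almost everywhere. -/
theorem exists_bump_tendsto_avg {h : V × Y → ℝ} (hh : Measurable h) (hh2 : MemLp h 2) :
    ∃ φ : ℕ → ContDiffBump (0 : V), Tendsto (fun j => (φ j).rOut) atTop (𝓝 0) ∧
      ∀ᵐ x : V × Y, Tendsto (fun j => avg ((φ j).normed volume) h x) atTop (𝓝 (h x)) := by
  let φ : ℕ → ContDiffBump (0 : V) := fun k =>
    ⟨1 / (2 * (k + 1)), 1 / (k + 1), by positivity, by
      apply div_lt_div_of_pos_left one_pos (by positivity)
      have : (0:ℝ) < k + 1 := by positivity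
      linarith⟩
  have hφ : Tendsto (fun k => (φ k).rOut) atTop (𝓝 0) := by
    have := (tendsto_const_div_atTop_nhds_zero_nat (1:ℝ)).comp (tendsto_add_atTop_nat 1)
    refine this.congr fun k => ?_
    simp [φ]
  have h1 := tendsto_eLpNorm_avg_sub hφ hh hh2
  have h2 : TendstoInMeasure volume (fun j => avg ((φ j).normed volume) h) atTop h :=
    tendstoInMeasure_of_tendsto_eLpNorm (p := 2) (by norm_num)
      (fun j => (measurable_avg (φ j).continuous_normed.measurable hh).aestronglyMeasurable)
      hh.aestronglyMeasurable h1
  -- `L²` convergence gives convergence in measure, hence almost everywhere along a subsequence of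
  -- the bumps.
  obtain ⟨ns, hns, hns'⟩ := h2.exists_seq_tendsto_ae
  exact ⟨fun j => φ (ns j), hφ.comp hns.tendsto_atTop, hns'⟩

/-- Averages against shrinking bumps converge when the integrands are equicontinuous at `0`. -/
theorem tendsto_integral_bump_mul {φ : ℕ → ContDiffBump (0 : V)}
    (hφ : Tendsto (fun j => (φ j).rOut) atTop (𝓝 0)) {c : ℕ → V → ℝ} (hc : ∀ j, Continuous (c j))
    {d : V → ℝ≥0∞} (hd : Tendsto d (𝓝 0) (𝓝 0)) (hcd : ∀ j q, ‖c j q - c j 0‖ₑ ≤ d q) {l : ℝ}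
    (hl : Tendsto (fun j => c j 0) atTop (𝓝 l)) :
    Tendsto (fun j => ∫ q, (φ j).normed volume q * c j q) atTop (𝓝 l) := by
  have h1 : Tendsto (fun z : ℕ × V => c z.1 z.2) (atTop ×ˢ 𝓝 0) (𝓝 l) := by
    have h2 : Tendsto (fun z : ℕ × V => c z.1 z.2 - c z.1 0) (atTop ×ˢ 𝓝 0) (𝓝 0) := by
      rw [tendsto_zero_iff_enorm_tendsto_zero]
      exact tendsto_of_tendsto_of_tendsto_of_le_of_le tendsto_const_nhds (hd.comp tendsto_snd)
        (fun _ => zero_le) fun z => hcd z.1 z.2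
    simpa using h2.add (hl.comp tendsto_fst)
  have h3 := ContDiffBump.convolution_tendsto_right (μ := (volume : Measure V)) (φ := φ)
    (g := fun j q => c j (-q)) (k := fun _ => 0) (x₀ := 0) (z₀ := l) hφ
    (Eventually.of_forall fun j => ((hc j).comp continuous_neg).aestronglyMeasurable)
    (by
      have : Tendsto (fun q : V => -q) (𝓝 0) (𝓝 0) := by
        simpa using (continuous_neg (G := V)).tendsto 0
      exact h1.comp (tendsto_fst.prodMk (this.comp tendsto_snd))) tendsto_const_nhds
  refine h3.congr fun j => ?_
  rw [convolution_def]
  simp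

end PartialAverage

/-! ### Truncation of real numbers and its primitive -/

section Clip

/-- Truncation of a real number to the interval `[0, N]`. -/
def clip (N r : ℝ) : ℝ := max 0 (min r N)

/-- The primitive of `clip N` that vanishes at the origin. -/
noncomputable def clipPrim (N r : ℝ) : ℝ := ∫ t in (0:ℝ)..r, clip N t

variable {N : ℝ}

theorem continuous_clip : Continuous (clip N) := by unfold clip; fun_prop

theorem clip_nonneg (r : ℝ) : 0 ≤ clip N r := le_max_left _ _

theorem clip_le (hN : 0 ≤ N) (r : ℝ) : clip N r ≤ N := max_le hN (min_le_right _ _)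

theorem clip_of_nonpos {r : ℝ} (hr : r ≤ 0) : clip N r = 0 :=
  max_eq_left ((min_le_left _ _).trans hr)

theorem clip_le_max (r : ℝ) : clip N r ≤ max r 0 :=
  max_le (le_max_right _ _) ((min_le_left _ _).trans (le_max_left _ _))

theorem abs_clip_sub_le (r r' : ℝ) : |clip N r - clip N r'| ≤ |r - r'| := by
  unfold clip
  rw [max_comm 0, max_comm 0]
  exact (abs_max_sub_max_le_abs _ _ _).trans (by
    simpa using abs_min_sub_min_le_max r N r' N)

theorem hasDerivAt_clipPrim (r : ℝ) : HasDerivAt (clipPrim N) (clip N r) r :=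
  (continuous_clip.integral_hasStrictDerivAt 0 r).hasDerivAt

theorem continuous_clipPrim : Continuous (clipPrim N) :=
  continuous_iff_continuousAt.2 fun r => (hasDerivAt_clipPrim r).continuousAt

theorem clipPrim_of_nonpos {r : ℝ} (hr : r ≤ 0) : clipPrim N r = 0 := by
  rw [clipPrim, intervalIntegral.integral_symm, neg_eq_zero]
  refine intervalIntegral.integral_zero_ae (Eventually.of_forall fun t ht => ?_)
  rw [uIoc_of_le hr] at ht
  exact clip_of_nonpos ht.2

theorem abs_clipPrim_sub_le (hN : 0 ≤ N) (r r' : ℝ) :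
    |clipPrim N r - clipPrim N r'| ≤ N * |r - r'| := by
  have h : clipPrim N r - clipPrim N r' = ∫ t in r'..r, clip N t :=
    intervalIntegral.integral_interval_sub_left (continuous_clip.intervalIntegrable _ _)
      (continuous_clip.intervalIntegrable _ _)
  rw [h]
  refine intervalIntegral.norm_integral_le_of_norm_le_const (f := clip N) fun t _ => ?_
  rw [Real.norm_eq_abs, abs_of_nonneg (clip_nonneg t)]
  exact clip_le hN t

theorem clipPrim_nonneg (r : ℝ) : 0 ≤ clipPrim N r := by
  rcases le_total r 0 with h | h
  · rw [clipPrim_of_nonpos h]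
  · exact intervalIntegral.integral_nonneg h fun t _ => clip_nonneg t

theorem clipPrim_le (r : ℝ) : clipPrim N r ≤ max r 0 ^ 2 / 2 := by
  rcases le_total r 0 with h | h
  · rw [clipPrim_of_nonpos h]; positivity
  · rw [max_eq_left h]
    have : ∫ t in (0:ℝ)..r, t = r ^ 2 / 2 := by rw [integral_id]; ring
    rw [← this]
    refine intervalIntegral.integral_mono_on h (continuous_clip.intervalIntegrable _ _)
      (continuous_id.intervalIntegrable _ _) fun t ht => ?_
    exact (clip_le_max t).trans (max_le le_rfl ht.1)

end Clip

/-! ### Averages, barriers and the chain rule on slices -/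

section Slices

variable {V E : Type*} [NormedAddCommGroup V] [NormedSpace ℝ V] [FiniteDimensional ℝ V]
  [MeasureSpace V] [BorelSpace V] [(volume : Measure V).IsAddHaarMeasure]
  [NormedAddCommGroup E] [NormedSpace ℝ E] [FiniteDimensional ℝ E]
  [MeasureSpace E] [BorelSpace E] [(volume : Measure E).IsAddHaarMeasure]

/-- The bound does not depend on the base variable, so it survives averaging; this is how the
barrier condition passes from the solution to its mollifications. -/
theorem avg_le_of_le (φ : ContDiffBump (0 : V)) {F : V × E → ℝ} {v : E}
    (hv : LocallyIntegrable fun p : V => F (p, v)) {p : V} {c : ℝ}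
    (h : ∀ q, ‖q‖ ≤ φ.rOut → F (p - q, v) ≤ c) : avg (φ.normed volume) F (p, v) ≤ c := by
  have h1 : ∫ q, φ.normed volume q * c = c := by
    rw [integral_mul_const, φ.integral_normed, one_mul]
  rw [← h1]
  refine integral_mono
    (integrable_mul_translate φ.continuous_normed φ.hasCompactSupport_normed hv p)
    (φ.integrable_normed.mul_const c) fun q => ?_
  by_cases hq : ‖q‖ ≤ φ.rOut
  · exact mul_le_mul_of_nonneg_left (h q hq) (φ.nonneg_normed q)
  · have : q ∉ Function.support (φ.normed volume) := by
      rw [φ.support_normed_eq, Metric.mem_ball, dist_zero_right]; exact fun h' => hq h'.le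
    rw [Function.notMem_support] at this
    simp [this]

/-- The average acts only on the base variable, so it commutes with velocity differences.
Consequently averaging does not increase the nonlocal energy. -/
theorem wdiff_avg {k : E → ℝ} {ρ : V → ℝ} (hρ : Continuous ρ) (hρc : HasCompactSupport ρ)
    {F : V × E → ℝ} {P : V × (E × E)} (hv : LocallyIntegrable fun p : V => F (p, P.2.1))
    (hw : LocallyIntegrable fun p : V => F (p, P.2.2)) :
    wdiff k (avg ρ F) P = avg ρ (wdiff k F) P := by
  rw [wdiff, avg, avg, ← integral_sub (integrable_mul_translate hρ hρc hw _)
    (integrable_mul_translate hρ hρc hv _), ← integral_mul_const, avg]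
  congr 1; ext q
  simp only [wdiff]; ring

/-- By the chain rule the left-hand side contains the derivative of `clipPrim N (u - c)`, and
integration by parts puts it on `η`. -/
theorem integral_clip_mul_fderiv {N : ℝ} {u η : V → ℝ} (hu : ContDiff ℝ 1 u)
    (hη : ContDiff ℝ 1 η) (hηc : HasCompactSupport η) (c : ℝ) (y : V) :
    ∫ p, η p * clip N (u p - c) * fderiv ℝ u p y =
      -∫ p, clipPrim N (u p - c) * fderiv ℝ η p y := by
  set G : V → ℝ := fun p => clipPrim N (u p - c) with hG
  have hGd : ∀ p, HasFDerivAt G (clip N (u p - c) • fderiv ℝ u p) p := fun p =>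
    HasDerivAt.comp_hasFDerivAt (f := fun p => u p - c) (h₂ := clipPrim N) p
      (hasDerivAt_clipPrim (u p - c)) ((hu.differentiable (by simp) p).hasFDerivAt.sub_const c)
  have hGc : Continuous G := continuous_iff_continuousAt.2 fun p => (hGd p).continuousAt
  have hη' : Continuous (fderiv ℝ η) := hη.continuous_fderiv (by simp)
  have hu' : Continuous (fderiv ℝ u) := hu.continuous_fderiv (by simp)
  have hcl : Continuous fun p => clip N (u p - c) :=
    continuous_clip.comp (hu.continuous.sub continuous_const)
  have hGf : ∀ p, fderiv ℝ G p y = clip N (u p - c) * fderiv ℝ u p y := fun p => by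
    rw [(hGd p).fderiv]; simp
  have h := integral_mul_fderiv_eq_neg_fderiv_mul_of_integrable (μ := (volume : Measure V))
    (f := η) (g := G) (v := y) ?_ ?_ ?_ (fun p _ => hη.differentiable (by simp) p)
    (fun p _ => (hGd p).differentiableAt)
  · calc ∫ p, η p * clip N (u p - c) * fderiv ℝ u p y = ∫ p, η p * fderiv ℝ G p y := by
          congr 1; ext p; rw [hGf]; ring
      _ = _ := by rw [h]; congr 2; ext p; ring
  · refine ((hη'.clm_apply continuous_const).mul hGc).integrable_of_hasCompactSupport ?_
    refine HasCompactSupport.intro hηc.isCompact fun p hp => ?_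
    simp [fderiv_of_notMem_tsupport ℝ hp]
  · simp_rw [hGf]
    refine (hη.continuous.mul (hcl.mul
      (hu'.clm_apply continuous_const))).integrable_of_hasCompactSupport ?_
    refine HasCompactSupport.intro hηc.isCompact fun p hp => ?_
    simp [image_eq_zero_of_notMem_tsupport hp]
  · refine (hη.continuous.mul hGc).integrable_of_hasCompactSupport ?_
    refine HasCompactSupport.intro hηc.isCompact fun p hp => ?_
    simp [image_eq_zero_of_notMem_tsupport hp]

/-- Fubini returns the translations from the pairing to `Fv`. For `ℓ` the derivative of a mollifier,
the inner integral becomes a transport derivative of the averaged solution. -/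
theorem integral_apply_partial_translate {ℓ : V → V →L[ℝ] ℝ} (hℓ : Continuous ℓ)
    (hℓc : HasCompactSupport ℓ) {Fv : V × E → V} (hFv : Integrable Fv) (hFm : Measurable Fv)
    {g : V × E → ℝ} (hg : Measurable g) {N : ℝ} (hN : ∀ x, |g x| ≤ N) :
    Integrable (fun x => g x * ∫ q, ℓ q (Fv (x.1 - q, x.2))) ∧
      ∫ q, ℓ q (∫ x, g x • Fv (x - (q, 0))) = ∫ x, g x * ∫ q, ℓ q (Fv (x.1 - q, x.2)) := by
  have hsub : ∀ (x : V × E) (q : V), x - (q, (0 : E)) = (x.1 - q, x.2) := fun x q => by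
    ext <;> simp
  have hint : Integrable (fun z : (V × E) × V => g z.1 * ℓ z.2 (Fv (z.1.1 - z.2, z.1.2)))
      ((volume : Measure (V × E)).prod (volume : Measure V)) := by
    have hℓi : Integrable ℓ := hℓ.integrable_of_hasCompactSupport hℓc
    have hm : Measurable fun z : (V × E) × V => Fv (z.1.1 - z.2, z.1.2) := by fun_prop
    have hmz : AEStronglyMeasurable (fun z : (V × E) × V => g z.1 * ℓ z.2 (Fv (z.1.1 - z.2, z.1.2)))
        ((volume : Measure (V × E)).prod (volume : Measure V)) := by
      refine (hg.comp measurable_fst).aestronglyMeasurable.mul ?_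
      exact (ContinuousLinearMap.apply ℝ ℝ (E := V)).flip.aestronglyMeasurable_comp₂
        (hℓ.comp continuous_snd).aestronglyMeasurable hm.aestronglyMeasurable
    refine ⟨hmz, ?_⟩
    rw [HasFiniteIntegral, lintegral_prod_symm _ hmz.enorm]
    have hb : ∀ q, ∫⁻ x, ‖g x * ℓ q (Fv (x.1 - q, x.2))‖ₑ ≤
        ‖ℓ q‖ₑ * (ENNReal.ofReal N * ∫⁻ x, ‖Fv x‖ₑ) := fun q => by
      have e : ∫⁻ x, ‖Fv x‖ₑ = ∫⁻ x : V × E, ‖Fv (x.1 - q, x.2)‖ₑ := by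
        rw [← lintegral_sub_right_eq_self (fun x => ‖Fv x‖ₑ) ((q, 0) : V × E)]
        simp_rw [hsub]
      rw [e, ← mul_assoc, ← lintegral_const_mul' _ _ (ENNReal.mul_ne_top enorm_ne_top (by simp))]
      refine lintegral_mono fun x => ?_
      rw [enorm_mul, mul_comm ‖ℓ q‖ₑ, mul_assoc]
      gcongr
      · rw [← ofReal_norm]; exact ENNReal.ofReal_le_ofReal (hN x)
      · exact (ℓ q).le_opENorm _
    refine (lintegral_mono hb).trans_lt ?_
    have hfin : ENNReal.ofReal N * ∫⁻ x, ‖Fv x‖ₑ < ⊤ := ENNReal.mul_lt_top (by simp) hFv.2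
    rw [lintegral_mul_const' _ _ hfin.ne]
    exact ENNReal.mul_lt_top hℓi.2 hfin
  constructor
  · refine hint.integral_prod_left.congr (Eventually.of_forall fun x => ?_)
    simp only
    rw [integral_const_mul]
  · calc ∫ q, ℓ q (∫ x, g x • Fv (x - (q, 0)))
        = ∫ q, ∫ x, g x * ℓ q (Fv (x.1 - q, x.2)) := by
          refine integral_congr_ae (Eventually.of_forall fun q => ?_)
          have hgA : Integrable (fun x => g x • Fv (x - (q, 0))) :=
            (hFv.comp_sub_right (q, 0)).bdd_smul N hg.aestronglyMeasurable (Eventually.of_forall hN)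
          simp only
          rw [← ContinuousLinearMap.integral_comp_comm _ hgA]
          simp [hsub]
      _ = ∫ x, ∫ q, g x * ℓ q (Fv (x.1 - q, x.2)) := (integral_integral_swap hint).symm
      _ = _ := by simp_rw [integral_const_mul]

end Slices

/-! ### Difference estimates at a fixed truncation height -/

section Truncation

variable {E : Type*} [NormedAddCommGroup E]

/-- The truncated positive part of `a - ψ(v)` for velocities in the ball of radius `R`. -/
noncomputable def trunc (N R : ℝ) (ψ : E → ℝ) (a : ℝ) (v : E) : ℝ :=
  if ‖v‖ < R then clip N (a - ψ v) else 0

/-- The primitive of `trunc` in its real argument. -/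
noncomputable def truncPrim (N R : ℝ) (ψ : E → ℝ) (a : ℝ) (v : E) : ℝ :=
  if ‖v‖ < R then clipPrim N (a - ψ v) else 0

/-- The number of velocities among `v`, `w` in the ball of radius `R`, weighted by
`min |v - w| 1`. -/
noncomputable def nearBall (R : ℝ) (z : E × E) : ℝ :=
  min ‖z.1 - z.2‖ 1 * ((if ‖z.1‖ < R then 1 else 0) + (if ‖z.2‖ < R then 1 else 0))

theorem nearBall_nonneg (R : ℝ) (z : E × E) : 0 ≤ nearBall R z := by
  unfold nearBall
  have : (0:ℝ) ≤ (if ‖z.1‖ < R then 1 else 0) + (if ‖z.2‖ < R then 1 else 0) := by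
    split_ifs <;> norm_num
  positivity

variable {N R : ℝ} {ψ : E → ℝ}

theorem trunc_nonneg (a : ℝ) (v : E) : 0 ≤ trunc N R ψ a v := by
  unfold trunc; split_ifs; exacts [clip_nonneg _, le_rfl]

theorem trunc_le (hN : 0 ≤ N) (a : ℝ) (v : E) : trunc N R ψ a v ≤ N := by
  unfold trunc; split_ifs; exacts [clip_le hN _, hN]

theorem abs_trunc_le (hN : 0 ≤ N) (a : ℝ) (v : E) : |trunc N R ψ a v| ≤ N := by
  rw [abs_of_nonneg (trunc_nonneg a v)]; exact trunc_le hN a v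

/-- In the shell `R ≤ |v| < R + r₀` the barrier makes the clip vanish, so the cut at `|v| = R`
creates no jump and the Lipschitz bounds of `clip` and `ψ` apply. If one velocity lies in the ball
and the other beyond the shell, they are at least `r₀` apart and the crude bound `N` costs the
factor `N / r₀`. -/
theorem abs_trunc_sub_le (hN : 0 ≤ N) {M r₀ : ℝ} (hM : 0 ≤ M) (hr₀ : 0 < r₀)
    (hψ : ∀ v w, |ψ v - ψ w| ≤ M * ‖v - w‖) {a b : ℝ} {v w : E}
    (hv : R ≤ ‖v‖ → ‖v‖ < R + r₀ → a ≤ ψ v) (hw : R ≤ ‖w‖ → ‖w‖ < R + r₀ → b ≤ ψ w) :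
    |trunc N R ψ b w - trunc N R ψ a v| ≤ |b - a| + (M + N + N / r₀) * nearBall R (v, w) := by
  have hs : ∀ {a : ℝ} {v : E}, (R ≤ ‖v‖ → ‖v‖ < R + r₀ → a ≤ ψ v) → ‖v‖ < R + r₀ →
      trunc N R ψ a v = clip N (a - ψ v) := fun {a v} h hv => by
    unfold trunc
    split_ifs with h1
    · rfl
    · rw [clip_of_nonpos (by linarith [h (not_lt.1 h1) hv])]
  have hN' : |trunc N R ψ b w - trunc N R ψ a v| ≤ N := by
    rw [abs_le]
    constructor <;> linarith [trunc_nonneg (N := N) (R := R) (ψ := ψ) a v,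
      trunc_nonneg (N := N) (R := R) (ψ := ψ) b w, trunc_le (R := R) (ψ := ψ) hN a v,
      trunc_le (R := R) (ψ := ψ) hN b w]
  have hnb := nearBall_nonneg R (v, w)
  have hNr : 0 ≤ N / r₀ := by positivity
  have hC : 0 ≤ M + N + N / r₀ := by positivity
  by_cases h0 : R ≤ ‖v‖ ∧ R ≤ ‖w‖
  · have e1 : trunc N R ψ b w = 0 := by unfold trunc; rw [if_neg (not_lt.2 h0.2)]
    have e2 : trunc N R ψ a v = 0 := by unfold trunc; rw [if_neg (not_lt.2 h0.1)]
    rw [e1, e2]; simp; positivity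
  have h1 : min ‖v - w‖ 1 ≤ nearBall R (v, w) := by
    unfold nearBall
    refine le_mul_of_one_le_right (by positivity) ?_
    rw [not_and_or, not_le, not_le] at h0
    rcases h0 with h | h
    · simp only [h, if_true]; split_ifs <;> norm_num
    · simp only [h, if_true]; split_ifs <;> norm_num
  refine le_trans ?_ (add_le_add_right (mul_le_mul_of_nonneg_left h1 hC) _)
  have hd : 0 ≤ ‖v - w‖ := norm_nonneg _
  by_cases h2 : ‖v‖ < R + r₀ ∧ ‖w‖ < R + r₀
  · rw [hs hv h2.1, hs hw h2.2] at hN' ⊢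
    rcases le_total ‖v - w‖ 1 with h3 | h3
    · rw [min_eq_left h3]
      have h4 := abs_clip_sub_le (N := N) (b - ψ w) (a - ψ v)
      have h5 := abs_add_le (b - a) (ψ v - ψ w)
      rw [show b - ψ w - (a - ψ v) = b - a + (ψ v - ψ w) by ring] at h4
      have h6 : 0 ≤ (N + N / r₀) * ‖v - w‖ := by positivity
      linarith [hψ v w]
    · rw [min_eq_right h3]
      linarith [abs_nonneg (b - a)]
  · have h3 : r₀ ≤ ‖v - w‖ := by
      have h4 := norm_sub_norm_le v w
      have h5 := norm_sub_norm_le w v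
      rw [norm_sub_rev] at h5
      rw [not_and_or, not_le, not_le] at h0
      rw [not_and_or, not_lt, not_lt] at h2
      rcases h2 with h2 | h2 <;> rcases h0 with h0 | h0 <;> linarith
    -- The summand `N` covers distances above `1`, the summand `N / r₀` those between `r₀` and `1`.
    have h4 : N ≤ (N + N / r₀) * min ‖v - w‖ 1 := by
      rcases le_total ‖v - w‖ 1 with h5 | h5
      · rw [min_eq_left h5]
        have : N = N / r₀ * r₀ := by field_simp
        have h6 : N / r₀ * r₀ ≤ N / r₀ * ‖v - w‖ := mul_le_mul_of_nonneg_left h3 hNr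
        have h7 : 0 ≤ N * ‖v - w‖ := by positivity
        linarith
      · rw [min_eq_right h5]; linarith
    have h5 : 0 ≤ M * min ‖v - w‖ 1 := by positivity
    linarith [abs_nonneg (b - a)]

theorem abs_truncPrim_sub_le (hN : 0 ≤ N) (a b : ℝ) (v : E) :
    |truncPrim N R ψ b v - truncPrim N R ψ a v| ≤ N * |b - a| := by
  unfold truncPrim
  split_ifs
  · refine (abs_clipPrim_sub_le hN _ _).trans_eq ?_
    congr 2; ring
  · simp; positivity

end Truncation

/-! ### The renormalized equation at height `N` -/

section Renormalization

variable {V E : Type*} [NormedAddCommGroup V] [NormedSpace ℝ V] [FiniteDimensional ℝ V]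
  [MeasureSpace V] [BorelSpace V] [(volume : Measure V).IsAddHaarMeasure]
  [NormedAddCommGroup E] [NormedSpace ℝ E] [FiniteDimensional ℝ E]
  [MeasureSpace E] [BorelSpace E] [(volume : Measure E).IsAddHaarMeasure]

theorem measurable_trunc {X : Type*} [MeasurableSpace X] {N R : ℝ} {ψ : E → ℝ} (hψ : Continuous ψ)
    {a : X → ℝ} (ha : Measurable a) {v : X → E} (hv : Measurable v) :
    Measurable fun x => trunc N R ψ (a x) (v x) := by
  unfold trunc
  refine Measurable.ite (measurableSet_lt hv.norm measurable_const) ?_ measurable_const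
  exact continuous_clip.measurable.comp (ha.sub (hψ.measurable.comp hv))

theorem measurable_truncPrim {X : Type*} [MeasurableSpace X] {N R : ℝ} {ψ : E → ℝ}
    (hψ : Continuous ψ) {a : X → ℝ} (ha : Measurable a) {v : X → E} (hv : Measurable v) :
    Measurable fun x => truncPrim N R ψ (a x) (v x) := by
  unfold truncPrim
  refine Measurable.ite (measurableSet_lt hv.norm measurable_const) ?_ measurable_const
  exact continuous_clipPrim.measurable.comp (ha.sub (hψ.measurable.comp hv))

theorem memLp_two_mul_prod {X Y : Type*} [MeasurableSpace X] [MeasurableSpace Y] {μ : Measure X}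
    {ν : Measure Y} [SFinite μ] [SFinite ν] {f : X → ℝ} {g : Y → ℝ} (hf : MemLp f 2 μ)
    (hg : MemLp g 2 ν) : MemLp (fun z : X × Y => f z.1 * g z.2) 2 (μ.prod ν) := by
  have hm : AEStronglyMeasurable (fun z : X × Y => f z.1 * g z.2) (μ.prod ν) :=
    hf.1.comp_fst.mul hg.1.comp_snd
  rw [memLp_two_iff_integrable_sq hm]
  simp_rw [mul_pow]
  exact hf.integrable_sq.mul_prod hg.integrable_sq

theorem memLp_two_indicator_mul {X Y : Type*} [MeasurableSpace X] [MeasurableSpace Y]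
    {μ : Measure X} {ν : Measure Y} [SFinite μ] [SFinite ν] {S : Set X} (hS : MeasurableSet S)
    (hμS : μ S ≠ ⊤) {g : Y → ℝ} (hg : MemLp g 2 ν) :
    MemLp (fun z : X × Y => S.indicator 1 z.1 * g z.2) 2 (μ.prod ν) :=
  memLp_two_mul_prod (memLp_indicator_const 2 hS (1:ℝ) (Or.inr hμS)) hg

/-- The error with which truncation at `ψ` fails to be a contraction for differences. -/
noncomputable def wnear (k : E → ℝ) (R : ℝ) (S : Set V) (P : V × (E × E)) : ℝ :=
  S.indicator 1 P.1 * (nearBall R P.2 * k (P.2.1 - P.2.2))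

theorem abs_wdiff_trunc_le {k : E → ℝ} (hk0 : ∀ v, 0 ≤ k v) {N R M r₀ : ℝ} (hN : 0 ≤ N)
    (hM : 0 ≤ M) (hr₀ : 0 < r₀) {ψ : E → ℝ} (hψ : ∀ v w, |ψ v - ψ w| ≤ M * ‖v - w‖)
    {η : V → ℝ} {c : ℝ} (hc : ∀ p, |η p| ≤ c) {G : V × E → ℝ} {P : V × (E × E)}
    (hv : P.1 ∈ tsupport η → R ≤ ‖P.2.1‖ → ‖P.2.1‖ < R + r₀ → G (P.1, P.2.1) ≤ ψ P.2.1)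
    (hw : P.1 ∈ tsupport η → R ≤ ‖P.2.2‖ → ‖P.2.2‖ < R + r₀ → G (P.1, P.2.2) ≤ ψ P.2.2) :
    |wdiff k (fun x => η x.1 * trunc N R ψ (G x) x.2) P| ≤
      c * (|wdiff k G P| + (M + N + N / r₀) * wnear k R (tsupport η) P) := by
  have hc0 : 0 ≤ c := (abs_nonneg _).trans (hc P.1)
  by_cases hp : P.1 ∈ tsupport η
  · have h1 := abs_trunc_sub_le hN hM hr₀ hψ (hv hp) (hw hp)
    simp only [wdiff, wnear, indicator_of_mem hp, Pi.one_apply, one_mul]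
    rw [← mul_sub, mul_assoc, abs_mul, abs_mul, abs_mul, abs_of_nonneg (hk0 (P.2.1 - P.2.2))]
    have hk := hk0 (P.2.1 - P.2.2)
    calc |η P.1| * (|trunc N R ψ (G (P.1, P.2.2)) P.2.2 - trunc N R ψ (G (P.1, P.2.1)) P.2.1| *
          k (P.2.1 - P.2.2))
        ≤ c * ((|G (P.1, P.2.2) - G (P.1, P.2.1)| + (M + N + N / r₀) * nearBall R P.2) *
          k (P.2.1 - P.2.2)) := by
          gcongr
          · exact hc P.1
      _ = _ := by ring
  · simp only [wdiff, wnear, indicator_of_notMem hp, image_eq_zero_of_notMem_tsupport hp]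
    simp
    positivity

theorem abs_sub_le_eLpNorm_mul {X : Type*} [MeasurableSpace X] {μ : Measure X} {W W' Ψ : X → ℝ}
    (hW : MemLp W 2 μ) (hW' : MemLp W' 2 μ) (hΨ : MemLp Ψ 2 μ) :
    ‖∫ x, W x * Ψ x ∂μ - ∫ x, W' x * Ψ x ∂μ‖ₑ ≤
      eLpNorm (fun x => W x - W' x) 2 μ * eLpNorm Ψ 2 μ := by
  rw [← integral_sub (by exact hW.integrable_mul hΨ) (by exact hW'.integrable_mul hΨ)]
  simp_rw [← sub_mul]
  exact (enorm_integral_le_lintegral_enorm _).trans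
    (lintegral_enorm_mul_le_eLpNorm_two (hW.sub hW').1 hΨ.1)

theorem abs_sub_le_eLpNorm_one_mul {X : Type*} [MeasurableSpace X] {μ : Measure X} {A A' g : X → ℝ}
    (hA : Integrable A μ) (hA' : Integrable A' μ) (hg : AEStronglyMeasurable g μ) {c : ℝ}
    (hc : ∀ x, |g x| ≤ c) :
    ‖∫ x, g x * A x ∂μ - ∫ x, g x * A' x ∂μ‖ₑ ≤
      ENNReal.ofReal c * eLpNorm (fun x => A x - A' x) 1 μ := by
  rw [← integral_sub (hA.bdd_mul (c := c) hg (Eventually.of_forall hc))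
    (hA'.bdd_mul (c := c) hg (Eventually.of_forall hc)), eLpNorm_one_eq_lintegral_enorm,
    ← lintegral_const_mul' _ _ ENNReal.ofReal_ne_top]
  simp_rw [← mul_sub]
  refine (enorm_integral_le_lintegral_enorm _).trans (lintegral_mono fun x => ?_)
  rw [enorm_mul]
  gcongr
  rw [← ofReal_norm]
  exact ENNReal.ofReal_le_ofReal (hc x)

/-- Both projections that forget one velocity are quasi measure preserving, so null sets pull back
to null sets. -/
theorem ae_both_velocities {p : V × E → Prop} (hp : ∀ᵐ x, p x) :
    ∀ᵐ P : V × (E × E), p (P.1, P.2.1) ∧ p (P.1, P.2.2) := by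
  have q1 : Measure.QuasiMeasurePreserving (fun P : V × (E × E) => (P.1, P.2.1)) :=
    MeasureTheory.QuasiMeasurePreserving.prodMap
      (Measure.QuasiMeasurePreserving.id (volume : Measure V))
      (Measure.quasiMeasurePreserving_fst (μ := (volume : Measure E)) (ν := (volume : Measure E)))
  have q2 : Measure.QuasiMeasurePreserving (fun P : V × (E × E) => (P.1, P.2.2)) :=
    MeasureTheory.QuasiMeasurePreserving.prodMap
      (Measure.QuasiMeasurePreserving.id (volume : Measure V))
      (Measure.quasiMeasurePreserving_snd (μ := (volume : Measure E)) (ν := (volume : Measure E)))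
  exact (q1.ae hp).and (q2.ae hp)

theorem integrable_indicator_prod_ball {S : Set V} (hS : IsCompact S) (R : ℝ) {u : V × E → ℝ}
    (hu : Continuous u) : Integrable ((S ×ˢ Metric.ball (0 : E) R).indicator u) := by
  have hm : MeasurableSet (S ×ˢ Metric.ball (0 : E) R) :=
    hS.isClosed.measurableSet.prod Metric.isOpen_ball.measurableSet
  rw [integrable_indicator_iff hm]
  exact (hu.continuousOn.integrableOn_compact (hS.prod (isCompact_closedBall (0 : E) R))).mono_set
    (prod_mono_right Metric.ball_subset_closedBall)

/-- The weak equation tested against `η (f - ψ)₊`, truncated at height `N`: the transport term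
becomes the derivative of a convex function of `f`. -/
theorem renormalized_equation {O : Set V} (hO : IsOpen O) {B : Set E} {k : E → ℝ}
    (hk : Measurable k) (hk0 : ∀ v, 0 ≤ k v) {dir : E → V} (hdir : Continuous dir)
    {F : V × E → ℝ} (hF : Measurable F) (hF2 : MemLp F 2) (hU : MemLp (wdiff k F) 2)
    {R M r₀ N : ℝ} (hM : 0 ≤ M) (hr₀ : 0 < r₀) (hN : 0 ≤ N)
    {Fv : V × E → V} (hFv : Integrable Fv) (hFm : Measurable Fv)
    (hFvF : ∀ p v, ‖v‖ < R → Fv (p, v) = F (p, v) • dir v)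
    {A : V × E → ℝ} (hA : Integrable A) {W : V × (E × E) → ℝ} (hW : MemLp W 2)
    (HW : ∀ φ : V × E → ℝ, ContDiff ℝ ∞ φ → HasCompactSupport φ → tsupport φ ⊆ O ×ˢ B →
      -∫ x, fderiv ℝ φ x (Fv x, 0) = -(∫ P, W P * wdiff k φ P) + ∫ x, A x * φ x)
    {ψ : E → ℝ} (hψc : Continuous ψ) (hψ : ∀ v w, |ψ v - ψ w| ≤ M * ‖v - w‖)
    (hFψ : ∀ p ∈ O, ∀ v, R ≤ ‖v‖ → ‖v‖ < R + r₀ → F (p, v) ≤ ψ v)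
    (hb : MemLp (fun z : E × E => nearBall R z * k (z.1 - z.2)) 2)
    (hB : Metric.closedBall 0 (R + 1) ⊆ B)
    {η : V → ℝ} (hη : ContDiff ℝ 1 η) (hηc : HasCompactSupport η) (hηO : tsupport η ⊆ O) :
    MemLp (wdiff k fun x => η x.1 * trunc N R ψ (F x) x.2) 2 ∧
    ∫ x : V × E, truncPrim N R ψ (F x) x.2 * fderiv ℝ η x.1 (dir x.2) =
      (∫ P, W P * wdiff k (fun x => η x.1 * trunc N R ψ (F x) x.2) P) -
        ∫ x : V × E, A x * (η x.1 * trunc N R ψ (F x) x.2) := by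
  obtain ⟨φ₀, hφ₀, hae₀⟩ := exists_bump_tendsto_avg hF hF2
  obtain ⟨ε, hε, hεO⟩ := hηc.isCompact.exists_cthickening_subset_open hO hηO
  -- Discarding the first bumps keeps every translate of `tsupport η` inside `O`, where the barrier
  -- condition and the equation hold.
  obtain ⟨j₀, hj₀⟩ := eventually_atTop.1 (hφ₀.eventually (gt_mem_nhds hε))
  set φ : ℕ → ContDiffBump (0 : V) := fun j => φ₀ (j + j₀) with hφ_def
  have hφ : Tendsto (fun j => (φ j).rOut) atTop (𝓝 0) := hφ₀.comp (tendsto_add_atTop_nat j₀)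
  have hφε : ∀ j, (φ j).rOut < ε := fun j => hj₀ _ (by omega)
  have hae : ∀ᵐ x : V × E, Tendsto (fun j => avg ((φ j).normed volume) F x) atTop (𝓝 (F x)) := by
    filter_upwards [hae₀] with x hx using hx.comp (tendsto_add_atTop_nat j₀)
  have hshift : ∀ j, ∀ p ∈ tsupport η, ∀ q : V, ‖q‖ ≤ (φ j).rOut → p - q ∈ O := by
    intro j p hp q hq
    refine hεO (Metric.mem_cthickening_of_dist_le _ p _ _ hp ?_)
    simpa using hq.trans (hφε j).le
  set Fj : ℕ → V × E → ℝ := fun j => avg ((φ j).normed volume) F with hFj_def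
  have hFjm : ∀ j, Measurable (Fj j) := fun j =>
    measurable_avg (φ j).continuous_normed.measurable hF
  set g : (V × E → ℝ) → V × E → ℝ := fun G x => η x.1 * trunc N R ψ (G x) x.2 with hg_def
  have hgm : ∀ G, Measurable G → Measurable (g G) := fun G hG =>
    (hη.continuous.measurable.comp measurable_fst).mul (measurable_trunc hψc hG measurable_snd)
  obtain ⟨c, hc⟩ := hηc.exists_bound_of_continuous hη.continuous
  have hc0 : 0 ≤ c := (norm_nonneg _).trans (hc 0)
  have hgb : ∀ G x, |g G x| ≤ c * N := fun G x => by
    rw [hg_def, abs_mul]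
    exact mul_le_mul (hc _) (abs_trunc_le hN _ _) (abs_nonneg _) hc0
  have hgS : ∀ G x, g G x ≠ 0 → x ∈ tsupport η ×ˢ Metric.closedBall (0 : E) R := by
    intro G x hx
    refine ⟨subset_tsupport _ (left_ne_zero_of_mul hx), ?_⟩
    have h := right_ne_zero_of_mul hx
    unfold trunc at h
    rw [mem_closedBall_zero_iff]
    by_contra h'
    exact h (if_neg fun h2 => h' h2.le)
  have hSm : MeasurableSet (tsupport η) := (isClosed_tsupport η).measurableSet
  have hSf : (volume : Measure V) (tsupport η) ≠ ⊤ := hηc.isCompact.measure_lt_top.ne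
  have hwn : MemLp (wnear k R (tsupport η)) 2 (volume : Measure (V × (E × E))) :=
    memLp_two_indicator_mul hSm hSf hb
  set K := M + N + N / r₀ with hK
  have hK0 : 0 ≤ K := by positivity
  -- the energy bound on the test functions
  have hΨF : ∀ P, |wdiff k (g F) P| ≤ c * (|wdiff k F P| + K * wnear k R (tsupport η) P) :=
    fun P => abs_wdiff_trunc_le hk0 hN hM hr₀ hψ hc (fun hp => hFψ _ (hηO hp) _)
      (fun hp => hFψ _ (hηO hp) _)
  have hgood := ae_locallyIntegrable_slice hF2
  have hgood2 : ∀ᵐ P : V × (E × E), LocallyIntegrable (fun p : V => F (p, P.2.1)) ∧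
      LocallyIntegrable (fun p : V => F (p, P.2.2)) := by
    have q1 := (Measure.quasiMeasurePreserving_fst (μ := (volume : Measure E))
      (ν := (volume : Measure E))).comp (Measure.quasiMeasurePreserving_snd
        (μ := (volume : Measure V)) (ν := (volume : Measure (E × E))))
    have q2 := (Measure.quasiMeasurePreserving_snd (μ := (volume : Measure E))
      (ν := (volume : Measure E))).comp (Measure.quasiMeasurePreserving_snd
        (μ := (volume : Measure V)) (ν := (volume : Measure (E × E))))
    filter_upwards [q1.ae hgood, q2.ae hgood] with P h1 h2 using ⟨h1, h2⟩
  have hFjψ : ∀ j v, LocallyIntegrable (fun p : V => F (p, v)) → ∀ p ∈ tsupport η,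
      R ≤ ‖v‖ → ‖v‖ < R + r₀ → Fj j (p, v) ≤ ψ v := fun j v hv p hp h1 h2 =>
    avg_le_of_le (φ j) hv fun q hq => hFψ _ (hshift j p hp q hq) v h1 h2
  have hΨj : ∀ j, ∀ᵐ P, |wdiff k (g (Fj j)) P| ≤
      c * (|wdiff k (Fj j) P| + K * wnear k R (tsupport η) P) := fun j => by
    filter_upwards [hgood2] with P hP
    exact abs_wdiff_trunc_le hk0 hN hM hr₀ hψ hc (fun hp => hFjψ j _ hP.1 _ hp)
      (fun hp => hFjψ j _ hP.2 _ hp)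
  have hUm : Measurable (wdiff k F) := measurable_wdiff hk hF
  have hUj : ∀ j, wdiff k (Fj j) =ᵐ[volume] avg ((φ j).normed volume) (wdiff k F) := fun j => by
    filter_upwards [hgood2] with P hP
    exact wdiff_avg (φ j).continuous_normed (φ j).hasCompactSupport_normed hP.1 hP.2
  have hUj2 : ∀ j, eLpNorm (wdiff k (Fj j)) 2 ≤ eLpNorm (wdiff k F) 2 volume := fun j => by
    rw [eLpNorm_congr_ae (hUj j)]
    exact eLpNorm_avg_le (φ j) hUm
  have hUjm : ∀ j, MemLp (wdiff k (Fj j)) 2 := fun j =>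
    ⟨(measurable_wdiff hk (hFjm j)).aestronglyMeasurable, (hUj2 j).trans_lt hU.2⟩
  have hbd : ∀ G : V × E → ℝ, MemLp (wdiff k G) 2 →
      MemLp (fun P => c * (|wdiff k G P| + K * wnear k R (tsupport η) P)) 2 := fun G hG =>
    (hG.norm.add (hwn.const_mul K)).const_mul c
  have hΨjm : ∀ j, MemLp (wdiff k (g (Fj j))) 2 := fun j =>
    (hbd _ (hUjm j)).mono' (measurable_wdiff hk (hgm _ (hFjm j))).aestronglyMeasurable (hΨj j)
  have hΨm : MemLp (wdiff k (g F)) 2 :=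
    (hbd _ hU).mono' (measurable_wdiff hk (hgm _ hF)).aestronglyMeasurable
      (Eventually.of_forall hΨF)
  refine ⟨hΨm, ?_⟩
  -- An energy bound for the test functions that is uniform in `j`: averaging contracts the energy
  -- of `F`, and the truncation error does not depend on `j`.
  set L : ℝ≥0∞ := ENNReal.ofReal c * (eLpNorm (wdiff k F) 2 volume +
    eLpNorm (fun P => K * wnear k R (tsupport η) P) 2 (volume : Measure (V × (E × E)))) with hL
  have hL_top : L ≠ ⊤ := ENNReal.mul_ne_top (by simp)
    (ENNReal.add_ne_top.2 ⟨hU.2.ne, (hwn.const_mul K).2.ne⟩)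
  have hΨjL : ∀ j, eLpNorm (wdiff k (g (Fj j))) 2 ≤ L := fun j => by
    have h1 : eLpNorm (wdiff k (g (Fj j))) 2 volume ≤
        eLpNorm (fun P => c * (|wdiff k (Fj j) P| + K * wnear k R (tsupport η) P)) 2 volume :=
      eLpNorm_mono_ae (by
        filter_upwards [hΨj j] with P hP
        rw [Real.norm_eq_abs, Real.norm_eq_abs]
        exact hP.trans (le_abs_self _))
    refine h1.trans ((eLpNorm_const_smul_le (c := c)).trans ?_)
    rw [hL, Real.enorm_eq_ofReal hc0]
    gcongr
    refine (eLpNorm_add_le (hUjm j).1.norm (hwn.const_mul K).1 (by norm_num)).trans ?_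
    gcongr
    exact (eLpNorm_norm (wdiff k (Fj j))).le.trans (hUj2 j)
  have hFj2 : ∀ j, MemLp (Fj j) 2 := fun j =>
    ⟨(hFjm j).aestronglyMeasurable, (eLpNorm_avg_le (φ j) hF).trans_lt hF2.2⟩
  have hη' : Continuous fun x : V × E => fderiv ℝ η x.1 (dir x.2) :=
    ((hη.continuous_fderiv (by simp)).comp continuous_fst).clm_apply (hdir.comp continuous_snd)
  -- The transport derivative of `η` need not be square integrable over all velocities; `truncPrim`
  -- lives in the ball, so nothing is lost by restricting to it.
  set D1 : V × E → ℝ := (tsupport η ×ˢ Metric.ball (0 : E) R).indicator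
    (fun x => fderiv ℝ η x.1 (dir x.2)) with hD1_def
  have hD1 : MemLp D1 2 := by
    have h1 := integrable_indicator_prod_ball hηc.isCompact R hη'
    have h2 := integrable_indicator_prod_ball hηc.isCompact R (hη'.pow 2)
    refine (memLp_two_iff_integrable_sq h1.1).2 (h2.congr (Eventually.of_forall fun x => ?_))
    by_cases hx : x ∈ tsupport η ×ˢ Metric.ball (0 : E) R
    · simp [hx]
    · simp [hx]
  have hDD : ∀ a (x : V × E), truncPrim N R ψ a x.2 * fderiv ℝ η x.1 (dir x.2) =
      truncPrim N R ψ a x.2 * D1 x := fun a x => by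
    by_cases hx : x ∈ tsupport η ×ˢ Metric.ball (0 : E) R
    · rw [hD1_def, indicator_of_mem hx]
    · rw [hD1_def, indicator_of_notMem hx, mul_zero]
      rw [mem_prod, not_and_or, mem_ball_zero_iff] at hx
      rcases hx with h | h
      · simp [fderiv_of_notMem_tsupport ℝ h]
      · simp [truncPrim, if_neg h]
  have hHm : ∀ G : V × E → ℝ, Measurable G → AEStronglyMeasurable (fun x : V × E =>
      truncPrim N R ψ (G x) x.2 * fderiv ℝ η x.1 (dir x.2)) := fun G hG =>
    ((measurable_truncPrim hψc hG measurable_snd).mul hη'.measurable).aestronglyMeasurable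
  have hHint : ∀ G : V × E → ℝ, Measurable G → MemLp G 2 → Integrable (fun x : V × E =>
      truncPrim N R ψ (G x) x.2 * fderiv ℝ η x.1 (dir x.2)) := fun G hG hG2 => by
    have h1 := integrable_indicator_prod_ball (E := E) hηc.isCompact R
      ((continuous_clipPrim (N := N)).comp (hψc.comp continuous_snd).neg |>.mul hη')
    have h2 : Integrable fun x => G x * D1 x := hG2.integrable_mul hD1
    refine ((h2.norm.const_mul N).add h1.norm).mono' (hHm G hG) (Eventually.of_forall fun x => ?_)
    rw [hDD, norm_mul]
    have h3 := abs_truncPrim_sub_le (R := R) (ψ := ψ) hN 0 (G x) x.2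
    have h4 := abs_sub_abs_le_abs_sub (truncPrim N R ψ (G x) x.2) (truncPrim N R ψ 0 x.2)
    rw [sub_zero] at h3
    have h5 : |truncPrim N R ψ 0 x.2| * |D1 x| ≤
        ‖(tsupport η ×ˢ Metric.ball (0 : E) R).indicator (fun x =>
          (clipPrim N ∘ fun x : V × E => -ψ x.2) x * fderiv ℝ η x.1 (dir x.2)) x‖ := by
      by_cases hx : x ∈ tsupport η ×ˢ Metric.ball (0 : E) R
      · rw [hD1_def, indicator_of_mem hx, indicator_of_mem hx, norm_mul]
        have : ‖x.2‖ < R := by simpa using hx.2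
        simp [truncPrim, this]
      · rw [hD1_def, indicator_of_notMem hx, indicator_of_notMem hx]; simp
    calc |truncPrim N R ψ (G x) x.2| * |D1 x|
        ≤ (N * |G x| + |truncPrim N R ψ 0 x.2|) * |D1 x| := by gcongr; linarith
      _ = N * ‖G x * D1 x‖ + |truncPrim N R ψ 0 x.2| * |D1 x| := by
          rw [norm_mul, Real.norm_eq_abs, Real.norm_eq_abs]; ring
      _ ≤ _ := by
          simp only [Pi.add_apply]
          exact add_le_add_right h5 _
  -- the identity for the mollified functions
  have hid : ∀ j, -∫ x : V × E, truncPrim N R ψ (Fj j x) x.2 * fderiv ℝ η x.1 (dir x.2) =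
      -(∫ q, (φ j).normed volume q * ∫ P, W (P - (q, 0)) * wdiff k (g (Fj j)) P) +
        ∫ q, (φ j).normed volume q * ∫ x, g (Fj j) x * A (x - (q, 0)) := fun j => by
    have hρ : ContDiff ℝ ∞ ((φ j).normed volume) := (φ j).contDiff_normed
    have hρc : HasCompactSupport ((φ j).normed volume) := (φ j).hasCompactSupport_normed
    rw [← weak_equation_mollified hk hFv hA hW HW (hgm (Fj j) (hFjm j)) (hgb _) hηc.isCompact
      (isCompact_closedBall 0 R) (hgS _) (hΨjm j) hρ hρc
      (fun p hp q hq => by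
        rw [ContDiffBump.tsupport_normed_eq, mem_closedBall_zero_iff] at hq
        exact hshift j p hp q hq) one_pos
      (fun v hv z hz => hB (by
        rw [mem_closedBall_zero_iff] at hv ⊢
        exact (norm_sub_le v z).trans (by linarith)))]
    obtain ⟨i1, i2⟩ := integral_apply_partial_translate (hρ.continuous_fderiv (by simp))
      (hρc.fderiv ℝ) hFv hFm (hgm (Fj j) (hFjm j)) (hgb _)
    rw [i2]
    -- The direction depends on the velocity alone and is fixed on each slice, hence the mollified
    -- transport term is the derivative of the averaged solution itself.
    have e1 : (fun x : V × E => g (Fj j) x *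
        ∫ q, fderiv ℝ ((φ j).normed volume) q (Fv (x.1 - q, x.2))) =ᵐ[volume]
        fun x => g (Fj j) x * fderiv ℝ (fun p => Fj j (p, x.2)) x.1 (dir x.2) := by
      filter_upwards [(Measure.quasiMeasurePreserving_snd (μ := (volume : Measure V))
        (ν := (volume : Measure E))).ae hgood] with x hx
      by_cases hxR : ‖x.2‖ < R
      · rw [(hasFDerivAt_avg hρ hρc hx).2]
        congr 2; ext q
        rw [hFvF _ _ hxR, map_smul, smul_eq_mul, mul_comm]
      · have : g (Fj j) x = 0 := by
          simp only [hg_def, trunc, if_neg hxR, mul_zero]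
        rw [this, zero_mul, zero_mul]
    rw [integral_congr_ae e1]
    have i1' := i1.congr e1
    rw [Measure.volume_eq_prod] at i1' ⊢
    have i3 := hHint (Fj j) (hFjm j) (hFj2 j)
    rw [Measure.volume_eq_prod] at i3
    rw [integral_prod_symm _ i1', integral_prod_symm _ i3, ← integral_neg]
    refine integral_congr_ae ?_
    filter_upwards [hgood] with v hv
    by_cases hvR : ‖v‖ < R
    · have h := integral_clip_mul_fderiv (N := N)
        ((hasFDerivAt_avg hρ hρc hv).1.of_le (by exact_mod_cast le_top)) hη hηc (ψ v) (dir v)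
      simp only [hg_def, trunc, truncPrim, if_pos hvR]
      exact h.symm
    · simp [hg_def, trunc, truncPrim, if_neg hvR]
  -- passage to the limit
  have hglim : ∀ x, Tendsto (fun j => Fj j x) atTop (𝓝 (F x)) →
      Tendsto (fun j => g (Fj j) x) atTop (𝓝 (g F x)) := fun x hx => by
    refine Tendsto.const_mul _ ?_
    unfold trunc
    split_ifs
    · exact (continuous_clip.tendsto _).comp (hx.sub_const _)
    · exact tendsto_const_nhds
  have lim_A : Tendsto (fun j => ∫ q, (φ j).normed volume q *
      ∫ x, g (Fj j) x * A (x - (q, 0))) atTop (𝓝 (∫ x, g F x * A x)) := by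
    -- The remaining mollification translates the data; this changes the pairing by at most `d q`,
    -- uniformly in `j`, because the test functions are uniformly bounded.
    refine tendsto_integral_bump_mul hφ
      (d := fun q => ENNReal.ofReal (c * N) * eLpNorm (fun x => A (x - (q, 0)) - A x) 1)
      (fun j => ?_) ?_ (fun j q => ?_) ?_
    · exact (continuous_integral_smul_translate hA (hgm _ (hFjm j)).aestronglyMeasurable
        (hgb _)).comp (show Continuous fun q : V => (q, (0 : E)) by fun_prop)
    · have h1 := (tendsto_eLpNorm_translate_sub le_rfl (by simp)
        (memLp_one_iff_integrable.2 hA)).comp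
        ((show Continuous fun q : V => (q, (0 : E)) by fun_prop).tendsto 0)
      simpa using ENNReal.Tendsto.const_mul h1 (Or.inr ENNReal.ofReal_ne_top)
    · have h1 := abs_sub_le_eLpNorm_one_mul (hA.comp_sub_right (q, 0)) hA
        (hgm _ (hFjm j)).aestronglyMeasurable (hgb _)
      simpa [← Prod.zero_eq_mk] using h1
    · have h0 : ∀ x : V × E, x - ((0 : V), (0 : E)) = x := fun x => by simp [← Prod.zero_eq_mk]
      simp_rw [h0]
      refine tendsto_integral_of_dominated_convergence (fun x => c * N * |A x|)
        (fun j => (hgm _ (hFjm j)).aestronglyMeasurable.mul hA.1) (hA.abs.const_mul _)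
        (fun j => Eventually.of_forall fun x => ?_) ?_
      · rw [norm_mul]
        exact mul_le_mul_of_nonneg_right (hgb _ x) (norm_nonneg _)
      · filter_upwards [hae] with x hx
        exact (hglim x hx).mul_const _
  have lim_W : Tendsto (fun j => ∫ q, (φ j).normed volume q *
      ∫ P, W (P - (q, 0)) * wdiff k (g (Fj j)) P) atTop (𝓝 (∫ P, W P * wdiff k (g F) P)) := by
    refine tendsto_integral_bump_mul hφ
      (d := fun q => eLpNorm (fun P => W (P - (q, 0)) - W P) 2 * L)
      (fun j => ?_) ?_ (fun j q => ?_) ?_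
    · exact (continuous_integral_translate_mul hW (hΨjm j)).comp
        (show Continuous fun q : V => (q, (0 : E × E)) by fun_prop)
    · have h1 := (tendsto_eLpNorm_translate_sub (p := 2) (by norm_num) (by simp) hW).comp
        ((show Continuous fun q : V => (q, (0 : E × E)) by fun_prop).tendsto 0)
      simpa using ENNReal.Tendsto.mul_const h1 (Or.inr hL_top)
    · have h1 := (abs_sub_le_eLpNorm_mul (hW.comp_measurePreserving
        (measurePreserving_sub_right volume (q, 0))) hW (hΨjm j)).trans
        (mul_le_mul_right (hΨjL j) _)
      simpa [← Prod.zero_eq_mk] using h1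
    · have h0 : ∀ x : V × (E × E), x - ((0 : V), (0 : E × E)) = x := fun x => by
        simp [← Prod.zero_eq_mk]
      simp_rw [h0]
      have hdj : ∀ j, MemLp (fun P => wdiff k (Fj j) P - wdiff k F P) 2 := fun j =>
        (hUjm j).sub hU
      -- The bounds on the differences of the test functions vary with `j`. They are split into the
      -- bound for the limit and an error controlled by `wdiff k (Fj j) - wdiff k F`, which tends to
      -- zero in `L²`.
      refine tendsto_integral_of_le_add
        (b := fun P => |W P| * (c * (|wdiff k F P| + K * wnear k R (tsupport η) P)))
        (e := fun j P => |W P| * (c * |wdiff k (Fj j) P - wdiff k F P|))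
        (fun j => hW.1.mul (hΨjm j).1) (hW.abs.integrable_mul (hbd _ hU))
        (Eventually.of_forall fun P => ?_) (fun j => ?_) (fun j P => by positivity) ?_ ?_
      · rw [abs_mul]
        exact mul_le_mul_of_nonneg_left (hΨF P) (abs_nonneg _)
      · filter_upwards [hΨj j] with P hP
        rw [abs_mul, ← mul_add]
        refine mul_le_mul_of_nonneg_left (hP.trans ?_) (abs_nonneg _)
        rw [← mul_add]
        refine mul_le_mul_of_nonneg_left ?_ hc0
        have := abs_sub_abs_le_abs_sub (wdiff k (Fj j) P) (wdiff k F P)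
        linarith
      · have h1 : ∀ j, ∫⁻ P, ‖|W P| * (c * |wdiff k (Fj j) P - wdiff k F P|)‖ₑ ≤
            eLpNorm W 2 volume * (ENNReal.ofReal c *
              eLpNorm (fun P => avg ((φ j).normed volume) (wdiff k F) P - wdiff k F P) 2) :=
          fun j => by
            refine (lintegral_enorm_mul_le_eLpNorm_two hW.abs.1
              ((hdj j).abs.const_mul c).1).trans ?_
            refine mul_le_mul' (eLpNorm_norm W).le
              ((eLpNorm_const_smul_le (c := c)).trans ?_)
            rw [Real.enorm_eq_ofReal hc0]
            gcongr
            refine (eLpNorm_norm (fun P => wdiff k (Fj j) P - wdiff k F P)).le.trans (le_of_eq ?_)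
            refine eLpNorm_congr_ae ?_
            filter_upwards [hUj j] with P hP
            rw [hP]
        have h2 := ENNReal.Tendsto.const_mul (ENNReal.Tendsto.const_mul
          (tendsto_eLpNorm_avg_sub hφ hUm hU) (Or.inr (ENNReal.ofReal_ne_top (r := c))))
          (Or.inr hW.2.ne)
        rw [mul_zero, mul_zero] at h2
        exact tendsto_of_tendsto_of_tendsto_of_le_of_le tendsto_const_nhds h2
          (fun _ => zero_le) h1
      · filter_upwards [ae_both_velocities hae] with P hP
        exact ((((hglim _ hP.2).sub (hglim _ hP.1)).mul_const _)).const_mul _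
  have lim_H : Tendsto (fun j => ∫ x : V × E,
      truncPrim N R ψ (Fj j x) x.2 * fderiv ℝ η x.1 (dir x.2)) atTop
      (𝓝 (∫ x : V × E, truncPrim N R ψ (F x) x.2 * fderiv ℝ η x.1 (dir x.2))) := by
    refine tendsto_integral_of_le_add
      (b := fun x => |truncPrim N R ψ (F x) x.2 * fderiv ℝ η x.1 (dir x.2)|)
      (e := fun j x => |N * (Fj j x - F x)| * |D1 x|)
      (fun j => hHm _ (hFjm j)) (hHint F hF hF2).abs (Eventually.of_forall fun x => le_rfl)
      (fun j => Eventually.of_forall fun x => ?_) (fun j x => by positivity) ?_ ?_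
    · rw [hDD, hDD, abs_mul, abs_mul, ← add_mul, abs_mul, abs_of_nonneg hN]
      refine mul_le_mul_of_nonneg_right ?_ (abs_nonneg _)
      have h3 := abs_truncPrim_sub_le (R := R) (ψ := ψ) hN (F x) (Fj j x) x.2
      have h4 := abs_sub_abs_le_abs_sub (truncPrim N R ψ (Fj j x) x.2) (truncPrim N R ψ (F x) x.2)
      linarith
    · have h1 : ∀ j, ∫⁻ x, ‖|N * (Fj j x - F x)| * |D1 x|‖ₑ ≤
          ENNReal.ofReal N * eLpNorm (fun x => Fj j x - F x) 2 * eLpNorm D1 2 volume := fun j => by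
        have h0 := (((hFj2 j).sub hF2).const_mul N)
        refine (lintegral_enorm_mul_le_eLpNorm_two h0.abs.1 hD1.abs.1).trans ?_
        refine mul_le_mul' ?_ (eLpNorm_norm D1).le
        refine (eLpNorm_norm (fun x => N * (Fj j x - F x))).le.trans
          ((eLpNorm_const_smul_le (c := N)).trans ?_)
        rw [Real.enorm_eq_ofReal hN]
      have h2 := ENNReal.Tendsto.mul_const (ENNReal.Tendsto.const_mul
          (tendsto_eLpNorm_avg_sub hφ hF hF2) (Or.inr (ENNReal.ofReal_ne_top (r := N))))
          (Or.inr hD1.2.ne)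
      rw [mul_zero, zero_mul] at h2
      exact tendsto_of_tendsto_of_tendsto_of_le_of_le tendsto_const_nhds h2
        (fun _ => zero_le) h1
    · filter_upwards [hae] with x hx
      refine Tendsto.mul_const _ ?_
      unfold truncPrim
      split_ifs
      · exact (continuous_clipPrim.tendsto _).comp (hx.sub_const _)
      · exact tendsto_const_nhds
  -- Both sides of the mollified identity converge, and the limits must agree.
  have hfin := tendsto_nhds_unique lim_H.neg
    ((lim_W.neg.add lim_A).congr fun j => (hid j).symm)
  have hcomm : ∫ x, g F x * A x = ∫ x, A x * g F x := by simp_rw [mul_comm]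
  rw [hcomm] at hfin
  linarith

end Renormalization

/-! ### Difference estimates without truncation height -/

section PositivePart

variable {E : Type*} [NormedAddCommGroup E] {N R : ℝ} {ψ : E → ℝ}

/-- The positive part of `a - ψ(v)` for velocities in the ball of radius `R`. -/
noncomputable def posTrunc (R : ℝ) (ψ : E → ℝ) (a : ℝ) (v : E) : ℝ :=
  if ‖v‖ < R then max (a - ψ v) 0 else 0

theorem posTrunc_nonneg (a : ℝ) (v : E) : 0 ≤ posTrunc R ψ a v := by
  unfold posTrunc; split_ifs; exacts [le_max_right _ _, le_rfl]

theorem trunc_eq_clip_posTrunc (a : ℝ) (v : E) :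
    trunc N R ψ a v = clip N (posTrunc R ψ a v) := by
  unfold trunc posTrunc
  split_ifs
  · rcases le_total (a - ψ v) 0 with h | h
    · rw [max_eq_right h, clip_of_nonpos h, clip_of_nonpos le_rfl]
    · rw [max_eq_left h]
  · rw [clip_of_nonpos le_rfl]

theorem trunc_le_posTrunc (a : ℝ) (v : E) : trunc N R ψ a v ≤ posTrunc R ψ a v := by
  rw [trunc_eq_clip_posTrunc]
  exact (clip_le_max _).trans (max_le le_rfl (posTrunc_nonneg a v))

theorem truncPrim_nonneg (a : ℝ) (v : E) : 0 ≤ truncPrim N R ψ a v := by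
  unfold truncPrim; split_ifs; exacts [clipPrim_nonneg _, le_rfl]

theorem truncPrim_le (a : ℝ) (v : E) : truncPrim N R ψ a v ≤ posTrunc R ψ a v ^ 2 / 2 := by
  unfold truncPrim posTrunc; split_ifs; exacts [clipPrim_le _, by positivity]

/-- The size of the error with which the positive part fails to be a contraction. -/
noncomputable def posError (R M r₀ : ℝ) (ψ : E → ℝ) (a : ℝ) (v : E) : ℝ :=
  if ‖v‖ < R then M + (1 + 1 / r₀) * posTrunc R ψ a v else 0

/-- The same case distinction as for `trunc`, but with the height replaced by the values of the
positive part. No constant depends on `N`, so this gives the energy bound that dominates the limit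
`N → ∞`. -/
theorem abs_posTrunc_sub_le {M r₀ : ℝ} (hM : 0 ≤ M) (hr₀ : 0 < r₀)
    (hψ : ∀ v w, |ψ v - ψ w| ≤ M * ‖v - w‖) {a b : ℝ} {v w : E}
    (hv : R ≤ ‖v‖ → ‖v‖ < R + r₀ → a ≤ ψ v) (hw : R ≤ ‖w‖ → ‖w‖ < R + r₀ → b ≤ ψ w) :
    |posTrunc R ψ b w - posTrunc R ψ a v| ≤ |b - a| +
      min ‖v - w‖ 1 * (posError R M r₀ ψ a v + posError R M r₀ ψ b w) := by
  have hs : ∀ {a : ℝ} {v : E}, (R ≤ ‖v‖ → ‖v‖ < R + r₀ → a ≤ ψ v) → ‖v‖ < R + r₀ →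
      posTrunc R ψ a v = max (a - ψ v) 0 := fun {a v} h hv => by
    unfold posTrunc
    split_ifs with h1
    · rfl
    · rw [max_eq_right (by linarith [h (not_lt.1 h1) hv])]
  set pa := posTrunc R ψ a v with hpa
  set pb := posTrunc R ψ b w with hpb
  have ha0 : 0 ≤ pa := posTrunc_nonneg a v
  have hb0 : 0 ≤ pb := posTrunc_nonneg b w
  have hN' : |pb - pa| ≤ pa + pb := by rw [abs_le]; constructor <;> linarith
  by_cases h0 : R ≤ ‖v‖ ∧ R ≤ ‖w‖
  · have e1 : pb = 0 := by rw [hpb, posTrunc, if_neg (not_lt.2 h0.2)]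
    have e2 : pa = 0 := by rw [hpa, posTrunc, if_neg (not_lt.2 h0.1)]
    rw [e1, e2, posError, posError, if_neg (not_lt.2 h0.2), if_neg (not_lt.2 h0.1)]
    simp
  have hc : 0 ≤ 1 / r₀ := by positivity
  have hea : (1 + 1 / r₀) * pa ≤ posError R M r₀ ψ a v := by
    unfold posError
    split_ifs with h
    · rw [← hpa]; linarith
    · rw [hpa, posTrunc, if_neg h]; simp
  have heb : (1 + 1 / r₀) * pb ≤ posError R M r₀ ψ b w := by
    unfold posError
    split_ifs with h
    · rw [← hpb]; linarith
    · rw [hpb, posTrunc, if_neg h]; simp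
  have he : M + (1 + 1 / r₀) * (pa + pb) ≤ posError R M r₀ ψ a v + posError R M r₀ ψ b w := by
    rw [not_and_or, not_le, not_le] at h0
    rcases h0 with h | h
    · have : posError R M r₀ ψ a v = M + (1 + 1 / r₀) * pa := by rw [posError, if_pos h]
      rw [this]; linarith
    · have : posError R M r₀ ψ b w = M + (1 + 1 / r₀) * pb := by rw [posError, if_pos h]
      rw [this]; linarith
  have hd : 0 ≤ ‖v - w‖ := norm_nonneg _
  refine le_trans ?_ (add_le_add_right (mul_le_mul_of_nonneg_left he (by positivity)) _)
  have hx : 0 ≤ (1 / r₀) * (pa + pb) := by positivity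
  by_cases h2 : ‖v‖ < R + r₀ ∧ ‖w‖ < R + r₀
  · rcases le_total ‖v - w‖ 1 with h3 | h3
    · rw [min_eq_left h3]
      have h4 : |pb - pa| ≤ |b - ψ w - (a - ψ v)| := by
        rw [hpb, hpa, hs hv h2.1, hs hw h2.2]
        exact abs_max_sub_max_le_abs _ _ _
      have h5 := abs_add_le (b - a) (ψ v - ψ w)
      rw [show b - ψ w - (a - ψ v) = b - a + (ψ v - ψ w) by ring] at h4
      have h6 : 0 ≤ ‖v - w‖ * ((1 + 1 / r₀) * (pa + pb)) := by positivity
      linarith [hψ v w]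
    · rw [min_eq_right h3]
      linarith [abs_nonneg (b - a)]
  · have h3 : r₀ ≤ ‖v - w‖ := by
      have h4 := norm_sub_norm_le v w
      have h5 := norm_sub_norm_le w v
      rw [norm_sub_rev] at h5
      rw [not_and_or, not_le, not_le] at h0
      rw [not_and_or, not_lt, not_lt] at h2
      rcases h2 with h2 | h2 <;> rcases h0 with h0 | h0 <;> linarith
    have h4 : pa + pb ≤ min ‖v - w‖ 1 * ((1 + 1 / r₀) * (pa + pb)) := by
      have h5 : 1 ≤ min ‖v - w‖ 1 * (1 + 1 / r₀) := by
        rcases le_total ‖v - w‖ 1 with h5 | h5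
        · rw [min_eq_left h5]
          have : 1 = r₀ * (1 / r₀) := by field_simp
          have h6 : r₀ * (1 / r₀) ≤ ‖v - w‖ * (1 / r₀) := mul_le_mul_of_nonneg_right h3 hc
          linarith
        · rw [min_eq_right h5]; linarith
      rw [← mul_assoc]
      exact le_mul_of_one_le_left (by positivity) h5
    have h5 : 0 ≤ min ‖v - w‖ 1 * M := by positivity
    linarith [abs_nonneg (b - a)]

end PositivePart

/-! ### Square integrability of products with a difference weight -/

section ConvolutionWeights

variable {V E X : Type*} [NormedAddCommGroup V] [NormedSpace ℝ V] [FiniteDimensional ℝ V]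
  [MeasureSpace V] [BorelSpace V] [(volume : Measure V).IsAddHaarMeasure]
  [NormedAddCommGroup E] [NormedSpace ℝ E] [FiniteDimensional ℝ E]
  [MeasureSpace E] [BorelSpace E] [(volume : Measure E).IsAddHaarMeasure]

/-- Integrating first in the last variable, translation and reflection invariance turn the square
integral into a product of two. -/
theorem memLp_two_mul_comp_sub [MeasureSpace X] [SFinite (volume : Measure X)] {π : X → E}
    (hπ : Measurable π) {G : X → ℝ} (hG : MemLp G 2) {κ : E → ℝ} (hκm : Measurable κ)
    (hκ : MemLp κ 2) :
    MemLp (fun z : X × E => G z.1 * κ (π z.1 - z.2)) 2 := by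
  have hm : AEStronglyMeasurable (fun z : X × E => G z.1 * κ (π z.1 - z.2)) := by
    have h1 : AEStronglyMeasurable (fun z : X × E => G z.1)
      ((volume : Measure X).prod (volume : Measure E)) := hG.1.comp_fst
    have h2 : Measurable fun z : X × E => κ (π z.1 - z.2) := by fun_prop
    exact h1.mul h2.aestronglyMeasurable
  refine (memLp_two_iff_integrable_sq hm).2 ⟨hm.pow 2, ?_⟩
  have hG2 := hG.integrable_sq.2
  have hκ2 := hκ.integrable_sq.2
  rw [HasFiniteIntegral] at hG2 hκ2 ⊢
  have hm2 : AEStronglyMeasurable (fun z : X × E => (G z.1 * κ (π z.1 - z.2)) ^ 2)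
      ((volume : Measure X).prod (volume : Measure E)) := hm.pow 2
  rw [Measure.volume_eq_prod, lintegral_prod _ hm2.enorm]
  have : ∀ x, ∫⁻ w, ‖(G x * κ (π x - w)) ^ 2‖ₑ = ‖G x ^ 2‖ₑ * ∫⁻ w, ‖κ w ^ 2‖ₑ := fun x => by
    simp_rw [mul_pow, enorm_mul]
    rw [lintegral_const_mul' _ _ enorm_ne_top,
      lintegral_sub_left_eq_self (fun w => ‖κ w ^ 2‖ₑ) (π x)]
  simp_rw [this]
  rw [lintegral_mul_const' _ _ hκ2.ne]
  exact ENNReal.mul_lt_top hG2 hκ2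

theorem measurePreserving_swap_velocities :
    MeasurePreserving (fun P : V × (E × E) => (P.1, (P.2.2, P.2.1))) :=
  (MeasurePreserving.id (volume : Measure V)).prod
    (Measure.measurePreserving_swap (μ := (volume : Measure E)) (ν := (volume : Measure E)))

theorem memLp_two_mul_comp_sub_left {G : V × E → ℝ} (hG : MemLp G 2) {κ : E → ℝ}
    (hκm : Measurable κ) (hκ : MemLp κ 2) :
    MemLp (fun P : V × (E × E) => G (P.1, P.2.1) * κ (P.2.1 - P.2.2)) 2 := by
  have h := memLp_two_mul_comp_sub (X := V × E) measurable_snd hG hκm hκ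
  exact h.comp_measurePreserving
    (MeasurePreserving.symm MeasurableEquiv.prodAssoc volume_preserving_prodAssoc)

theorem memLp_two_mul_comp_sub_right {G : V × E → ℝ} (hG : MemLp G 2) {κ : E → ℝ}
    (hκm : Measurable κ) (hκ : MemLp κ 2) (hκs : ∀ z, κ (-z) = κ z) :
    MemLp (fun P : V × (E × E) => G (P.1, P.2.2) * κ (P.2.1 - P.2.2)) 2 := by
  have h := (memLp_two_mul_comp_sub_left hG hκm hκ).comp_measurePreserving
    measurePreserving_swap_velocities
  refine h.ae_eq (Eventually.of_forall fun P => ?_)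
  change G (P.1, P.2.2) * κ (P.2.2 - P.2.1) = _
  rw [← hκs, neg_sub]

/-- A sum of two products of an indicator of the ball with a weight in `v - w`, exchanged by
swapping the velocities. -/
theorem memLp_two_nearBall {k : E → ℝ} (hk : Measurable k) (hks : ∀ z, k (-z) = k z)
    (hκ : MemLp (fun z => min ‖z‖ 1 * k z) 2) (R : ℝ) :
    MemLp (fun z : E × E => nearBall R z * k (z.1 - z.2)) 2 := by
  have hκm : Measurable fun z : E => min ‖z‖ 1 * k z := by fun_prop
  have hG : MemLp ((Metric.ball (0 : E) R).indicator fun _ => (1:ℝ)) 2 :=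
    memLp_indicator_const 2 Metric.isOpen_ball.measurableSet (1:ℝ)
      (Or.inr Metric.isBounded_ball.measure_lt_top.ne)
  have h1 := memLp_two_mul_comp_sub (X := E) measurable_id hG hκm hκ
  have h2 := h1.comp_measurePreserving
    (Measure.measurePreserving_swap (μ := (volume : Measure E)) (ν := (volume : Measure E)))
  refine (h1.add h2).ae_eq (Eventually.of_forall fun z => ?_)
  have e : ∀ v : E, (Metric.ball (0 : E) R).indicator (fun _ => (1:ℝ)) v =
      if ‖v‖ < R then 1 else 0 := fun v => by
    by_cases hv : ‖v‖ < R
    · rw [indicator_of_mem (mem_ball_zero_iff.2 hv), if_pos hv]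
    · rw [indicator_of_notMem (fun h => hv (mem_ball_zero_iff.1 h)), if_neg hv]
  have e2 : k (z.2 - z.1) = k (z.1 - z.2) := by rw [← hks, neg_sub]
  simp only [Pi.add_apply, Function.comp, Prod.swap, id, e, e2, nearBall, norm_sub_rev z.2 z.1]
  ring

end ConvolutionWeights

/-! ### The limit of infinite truncation height -/

section TruncatedEnergy

variable {V E : Type*} [NormedAddCommGroup V] [NormedSpace ℝ V] [FiniteDimensional ℝ V]
  [MeasureSpace V] [BorelSpace V] [(volume : Measure V).IsAddHaarMeasure]
  [NormedAddCommGroup E] [NormedSpace ℝ E] [FiniteDimensional ℝ E]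
  [MeasureSpace E] [BorelSpace E] [(volume : Measure E).IsAddHaarMeasure]

/-- The positive part of `F - ψ` on the base set `D`. -/
noncomputable def posPartOn (D : Set V) (R : ℝ) (ψ : E → ℝ) (F : V × E → ℝ) (x : V × E) : ℝ :=
  D.indicator 1 x.1 * posTrunc R ψ (F x) x.2

variable {D : Set V} {R : ℝ} {ψ : E → ℝ} {F : V × E → ℝ}

theorem posPartOn_nonneg (x : V × E) : 0 ≤ posPartOn D R ψ F x :=
  mul_nonneg (indicator_nonneg (fun _ _ => zero_le_one) _) (posTrunc_nonneg _ _)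

theorem posPartOn_of_mem {x : V × E} (hx : x.1 ∈ D) :
    posPartOn D R ψ F x = posTrunc R ψ (F x) x.2 := by
  rw [posPartOn, indicator_of_mem hx, Pi.one_apply, one_mul]

theorem measurable_posPartOn (hD : MeasurableSet D) (hψ : Continuous ψ) (hF : Measurable F) :
    Measurable (posPartOn D R ψ F) := by
  unfold posPartOn posTrunc
  refine ((measurable_one.indicator hD).comp measurable_fst).mul ?_
  refine Measurable.ite (measurableSet_lt measurable_snd.norm measurable_const) ?_
    measurable_const
  exact (hF.sub (hψ.measurable.comp measurable_snd)).max measurable_const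

theorem memLp_indicator_prod_ball (hD : MeasurableSet D) (hDf : (volume : Measure V) D ≠ ⊤)
    (R c : ℝ) {p : ℝ≥0∞} :
    MemLp ((D ×ˢ Metric.ball (0 : E) R).indicator fun _ => c) p := by
  refine memLp_indicator_const p (hD.prod Metric.isOpen_ball.measurableSet) c (Or.inr ?_)
  rw [Measure.volume_eq_prod, Measure.prod_prod]
  exact ENNReal.mul_ne_top hDf Metric.isBounded_ball.measure_lt_top.ne

theorem memLp_posPartOn (hD : MeasurableSet D) (hDf : (volume : Measure V) D ≠ ⊤)
    (hψ : Continuous ψ) (hF : Measurable F) (hF2 : MemLp F 2) :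
    MemLp (posPartOn D R ψ F) 2 := by
  obtain ⟨c, hc⟩ := (isCompact_closedBall (0 : E) R).exists_bound_of_continuousOn hψ.continuousOn
  refine (hF2.norm.add (memLp_indicator_prod_ball (E := E) hD hDf R c)).mono'
    (measurable_posPartOn hD hψ hF).aestronglyMeasurable (Eventually.of_forall fun x => ?_)
  rw [Real.norm_eq_abs, abs_of_nonneg (posPartOn_nonneg x)]
  simp only [Pi.add_apply]
  by_cases hx : x ∈ D ×ˢ Metric.ball (0 : E) R
  · have h2 := mem_ball_zero_iff.1 hx.2
    have h3 := hc x.2 (mem_closedBall_zero_iff.2 h2.le)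
    rw [posPartOn_of_mem hx.1, posTrunc, if_pos h2, indicator_of_mem hx]
    rw [Real.norm_eq_abs] at h3 ⊢
    refine max_le ?_ (add_nonneg (abs_nonneg _) ((abs_nonneg _).trans h3))
    linarith [le_abs_self (F x), neg_abs_le (ψ x.2)]
  · rw [indicator_of_notMem hx, add_zero]
    rw [mem_prod, not_and_or, mem_ball_zero_iff] at hx
    rcases hx with h | h
    · rw [posPartOn, indicator_of_notMem h, zero_mul]; exact norm_nonneg _
    · rw [posPartOn, posTrunc, if_neg h, mul_zero]; exact norm_nonneg _

/-- The difference is dominated by that of `F` plus errors attached to one velocity each. These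
errors are square integrable functions times the square integrable weight `min |z| 1 * k z`. -/
theorem memLp_wdiff_posPartOn {k : E → ℝ} (hk : Measurable k) (hk0 : ∀ v, 0 ≤ k v)
    (hks : ∀ z, k (-z) = k z) (hκ : MemLp (fun z => min ‖z‖ 1 * k z) 2)
    (hD : MeasurableSet D) (hDf : (volume : Measure V) D ≠ ⊤)
    (hψ : Continuous ψ) (hF : Measurable F) (hF2 : MemLp F 2) (hU : MemLp (wdiff k F) 2)
    {M r₀ : ℝ} (hM : 0 ≤ M) (hr₀ : 0 < r₀) (hψM : ∀ v w, |ψ v - ψ w| ≤ M * ‖v - w‖)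
    (hFψ : ∀ p ∈ D, ∀ v, R ≤ ‖v‖ → ‖v‖ < R + r₀ → F (p, v) ≤ ψ v) :
    MemLp (wdiff k (posPartOn D R ψ F)) 2 := by
  have hκm : Measurable fun z : E => min ‖z‖ 1 * k z := by fun_prop
  have hκs : ∀ z : E, min ‖-z‖ 1 * k (-z) = min ‖z‖ 1 * k z := fun z => by rw [norm_neg, hks]
  have hG := memLp_posPartOn (R := R) hD hDf hψ hF hF2
  set h : V × E → ℝ := fun x => (D ×ˢ Metric.ball (0 : E) R).indicator (fun _ => M) x +
    (1 + 1 / r₀) * posPartOn D R ψ F x with hh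
  have hhL : MemLp h 2 := (memLp_indicator_prod_ball hD hDf R M).add (hG.const_mul _)
  have hhe : ∀ p ∈ D, ∀ v, h (p, v) = posError R M r₀ ψ (F (p, v)) v := fun p hp v => by
    simp only [hh, posError]
    rw [posPartOn_of_mem (x := (p, v)) hp]
    split_ifs with hv
    · rw [indicator_of_mem (show (p, v) ∈ D ×ˢ Metric.ball (0 : E) R from
        ⟨hp, mem_ball_zero_iff.2 hv⟩)]
    · rw [indicator_of_notMem fun h' => hv (mem_ball_zero_iff.1 h'.2), posTrunc, if_neg hv]
      simp
  refine ((hU.norm.add (memLp_two_mul_comp_sub_left hhL hκm hκ)).add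
    (memLp_two_mul_comp_sub_right hhL hκm hκ hκs)).mono'
    (measurable_wdiff hk (measurable_posPartOn hD hψ hF)).aestronglyMeasurable
    (Eventually.of_forall fun P => ?_)
  simp only [Pi.add_apply]
  have hkP := hk0 (P.2.1 - P.2.2)
  by_cases hP : P.1 ∈ D
  · rw [hhe _ hP, hhe _ hP, wdiff, wdiff, posPartOn_of_mem (x := (P.1, P.2.1)) hP,
      posPartOn_of_mem (x := (P.1, P.2.2)) hP]
    simp only [Real.norm_eq_abs, abs_mul, abs_of_nonneg hkP]
    have h1 := abs_posTrunc_sub_le hM hr₀ hψM (hFψ _ hP P.2.1) (hFψ _ hP P.2.2)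
    calc _ ≤ _ := mul_le_mul_of_nonneg_right h1 hkP
      _ = _ := by ring
  · have h0 : ∀ v, h (P.1, v) = 0 := fun v => by
      simp [hh, posPartOn, hP]
    rw [h0, h0, wdiff, posPartOn, posPartOn]
    simp [hP]

/-- The localized energy inequality for the positive part of `F - ψ`. -/
theorem localized_energy_le {O : Set V} (hO : IsOpen O) (hOD : O ⊆ D) {B : Set E} {k : E → ℝ}
    (hk : Measurable k) (hk0 : ∀ v, 0 ≤ k v) (hks : ∀ z, k (-z) = k z)
    (hκ : MemLp (fun z => min ‖z‖ 1 * k z) 2) {dir : E → V} (hdir : Continuous dir)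
    (hD : MeasurableSet D) (hDf : (volume : Measure V) D ≠ ⊤)
    (hF : Measurable F) (hF2 : MemLp F 2) (hU : MemLp (wdiff k F) 2)
    {M r₀ : ℝ} (hM : 0 ≤ M) (hr₀ : 0 < r₀)
    {Fv : V × E → V} (hFv : Integrable Fv) (hFm : Measurable Fv)
    (hFvF : ∀ p v, ‖v‖ < R → Fv (p, v) = F (p, v) • dir v)
    {A : V × E → ℝ} (hA : Integrable A) {W : V × (E × E) → ℝ} (hW : MemLp W 2)
    (HW : ∀ φ : V × E → ℝ, ContDiff ℝ ∞ φ → HasCompactSupport φ → tsupport φ ⊆ O ×ˢ B →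
      -∫ x, fderiv ℝ φ x (Fv x, 0) = -(∫ P, W P * wdiff k φ P) + ∫ x, A x * φ x)
    (hψ : Continuous ψ) (hψM : ∀ v w, |ψ v - ψ w| ≤ M * ‖v - w‖)
    (hFψ : ∀ p ∈ D, ∀ v, R ≤ ‖v‖ → ‖v‖ < R + r₀ → F (p, v) ≤ ψ v)
    (hB : Metric.closedBall 0 (R + 1) ⊆ B)
    {η : V → ℝ} (hη : ContDiff ℝ 1 η) (hηc : HasCompactSupport η) (hηO : tsupport η ⊆ O)
    (hη0 : ∀ p, 0 ≤ η p) (hη1 : ∀ p, η p ≤ 1) {Λ : ℝ} (hΛ0 : 0 ≤ Λ)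
    (hΛ : ∀ p v, ‖v‖ < R → fderiv ℝ η p (dir v) ≤ Λ) :
    ENNReal.ofReal (∫ P, η P.1 * (W P * wdiff k (posPartOn D R ψ F) P)) ≤
      ENNReal.ofReal Λ * (∫⁻ x, ENNReal.ofReal (posPartOn D R ψ F x ^ 2)) +
        ∫⁻ x, ‖A x‖ₑ * ‖posPartOn D R ψ F x‖ₑ := by
  set G := posPartOn D R ψ F with hG_def
  have hGw : MemLp (wdiff k G) 2 :=
    memLp_wdiff_posPartOn hk hk0 hks hκ hD hDf hψ hF hF2 hU hM hr₀ hψM hFψ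
  have hηD : ∀ p, p ∉ D → η p = 0 := fun p hp =>
    image_eq_zero_of_notMem_tsupport fun h => hp (hOD (hηO h))
  have hren := fun N : ℕ => renormalized_equation (N := N) hO hk hk0 hdir hF hF2 hU hM hr₀
    (Nat.cast_nonneg N) hFv hFm hFvF hA hW HW hψ hψM (fun p hp => hFψ p (hOD hp))
    (memLp_two_nearBall hk hks hκ R) hB hη hηc hηO
  have hwd : ∀ (N : ℕ) P, wdiff k (fun x => η x.1 * trunc N R ψ (F x) x.2) P =
      η P.1 * ((clip N (G (P.1, P.2.2)) - clip N (G (P.1, P.2.1))) * k (P.2.1 - P.2.2)) := by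
    intro N P
    simp only [wdiff]
    by_cases hP : P.1 ∈ D
    · rw [hG_def, posPartOn_of_mem (x := (P.1, P.2.1)) hP,
        posPartOn_of_mem (x := (P.1, P.2.2)) hP, trunc_eq_clip_posTrunc, trunc_eq_clip_posTrunc]
      ring
    · rw [hηD _ hP]; ring
  have hbd : ∀ N : ℕ, ENNReal.ofReal
      (∫ P, W P * wdiff k (fun x => η x.1 * trunc N R ψ (F x) x.2) P) ≤
      ENNReal.ofReal Λ * (∫⁻ x, ENNReal.ofReal (G x ^ 2)) + ∫⁻ x, ‖A x‖ₑ * ‖G x‖ₑ := fun N => by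
    have h := (hren N).2
    -- For a function that is not integrable the left-hand side is zero by convention, so no
    -- integrability of the right-hand side is required.
    have hle : ∀ u : V × E → ℝ, ENNReal.ofReal (∫ x, u x) ≤ ∫⁻ x, ENNReal.ofReal (u x) :=
      fun u => by
        by_cases hu : Integrable u
        · rw [integral_eq_lintegral_pos_part_sub_lintegral_neg_part hu]
          refine (ENNReal.ofReal_le_ofReal (sub_le_self _ ENNReal.toReal_nonneg)).trans ?_
          exact ENNReal.ofReal_toReal_le
        · rw [integral_undef hu]; simp
    have h1 : (∫ P, W P * wdiff k (fun x => η x.1 * trunc N R ψ (F x) x.2) P) =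
        (∫ x : V × E, truncPrim N R ψ (F x) x.2 * fderiv ℝ η x.1 (dir x.2)) +
          ∫ x : V × E, A x * (η x.1 * trunc N R ψ (F x) x.2) := by rw [h]; ring
    rw [h1]
    refine ENNReal.ofReal_add_le.trans (add_le_add ((hle _).trans ?_) ((hle _).trans ?_))
    · rw [← lintegral_const_mul' _ _ ENNReal.ofReal_ne_top]
      refine lintegral_mono fun x => ?_
      rw [← ENNReal.ofReal_mul hΛ0]
      refine ENNReal.ofReal_le_ofReal ?_
      by_cases hx : x.1 ∈ D
      · by_cases hxR : ‖x.2‖ < R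
        · have h2 := truncPrim_le (N := N) (R := R) (ψ := ψ) (F x) x.2
          rw [← posPartOn_of_mem (D := D) hx] at h2
          have h3 := truncPrim_nonneg (N := N) (R := R) (ψ := ψ) (F x) x.2
          calc truncPrim N R ψ (F x) x.2 * fderiv ℝ η x.1 (dir x.2)
              ≤ truncPrim N R ψ (F x) x.2 * Λ := mul_le_mul_of_nonneg_left (hΛ _ _ hxR) h3
            -- The factor `1 / 2` from the primitive is given away.
            _ ≤ (G x ^ 2) * Λ := mul_le_mul_of_nonneg_right
                (h2.trans (by linarith [sq_nonneg (posPartOn D R ψ F x)])) hΛ0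
            _ = _ := mul_comm _ _
        · rw [truncPrim, if_neg hxR, zero_mul]; positivity
      · have : fderiv ℝ η x.1 = 0 :=
          fderiv_of_notMem_tsupport ℝ fun h => hx (hOD (hηO h))
        rw [this]
        simp only [_root_.zero_apply, mul_zero]
        positivity
    · refine lintegral_mono fun x => ?_
      rw [← enorm_mul, ← ofReal_norm, norm_mul, Real.norm_eq_abs, Real.norm_eq_abs]
      refine ENNReal.ofReal_le_ofReal ((le_abs_self _).trans ?_)
      rw [abs_mul]
      refine mul_le_mul_of_nonneg_left ?_ (abs_nonneg _)
      rw [abs_of_nonneg (mul_nonneg (hη0 _) (trunc_nonneg _ _)), abs_of_nonneg (posPartOn_nonneg x)]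
      by_cases hx : x.1 ∈ D
      · rw [posPartOn_of_mem hx]
        exact (mul_le_of_le_one_left (trunc_nonneg _ _) (hη1 _)).trans (trunc_le_posTrunc _ _)
      · rw [hηD _ hx, zero_mul]; exact posPartOn_nonneg x
  have hlim : Tendsto (fun N : ℕ =>
      ∫ P, W P * wdiff k (fun x => η x.1 * trunc N R ψ (F x) x.2) P) atTop
      (𝓝 (∫ P, η P.1 * (W P * wdiff k G P))) := by
    -- Clipping is a contraction and `0 ≤ η ≤ 1`, so the energy of the unclipped `G` dominates for
    -- all `N`.
    refine tendsto_integral_of_dominated_convergence (fun P => |W P * wdiff k G P|)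
      (fun N => hW.1.mul (hren N).1.1) (hW.integrable_mul hGw).abs
      (fun N => Eventually.of_forall fun P => ?_) (Eventually.of_forall fun P => ?_)
    · rw [hwd, Real.norm_eq_abs, abs_mul, abs_mul, abs_mul, abs_mul, wdiff, abs_mul,
        abs_of_nonneg (hη0 P.1)]
      refine mul_le_mul_of_nonneg_left ?_ (abs_nonneg _)
      refine (mul_le_of_le_one_left (by positivity) (hη1 _)).trans ?_
      exact mul_le_mul_of_nonneg_right (abs_clip_sub_le _ _) (abs_nonneg _)
    · have hcl : ∀ r : ℝ, 0 ≤ r → Tendsto (fun N : ℕ => clip N r) atTop (𝓝 r) := fun r hr => by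
        refine tendsto_const_nhds.congr' ?_
        filter_upwards [eventually_ge_atTop ⌈r⌉₊] with N hN
        rw [clip, min_eq_left ((Nat.le_ceil r).trans (by exact_mod_cast hN)), max_eq_right hr]
      simp_rw [hwd]
      have h2 := ((((hcl (G (P.1, P.2.2)) (posPartOn_nonneg _)).sub
        (hcl (G (P.1, P.2.1)) (posPartOn_nonneg _))).mul_const (k (P.2.1 - P.2.2))).const_mul
          (η P.1)).const_mul (W P)
      convert! h2 using 2
      rw [wdiff]; ring
  exact le_of_tendsto ((ENNReal.continuous_ofReal.tendsto _).comp hlim)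
    (Eventually.of_forall hbd)

end TruncatedEnergy

/-! ### The kernel weight -/

section Weight

/-- The square root of the weight `|v|^{-(n+2s)}`. -/
noncomputable def kweight (n : ℕ) (s : ℝ) (v : Space n) : ℝ := ‖v‖ ^ (-((n : ℝ) + 2 * s) / 2)

variable {n : ℕ} {s : ℝ}

theorem measurable_kweight : Measurable (kweight n s) := by unfold kweight; fun_prop

theorem kweight_nonneg (v : Space n) : 0 ≤ kweight n s v := by unfold kweight; positivity

theorem kweight_neg (v : Space n) : kweight n s (-v) = kweight n s v := by
  unfold kweight; rw [norm_neg]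

theorem kweight_sq (hs : 0 < s) (v : Space n) :
    kweight n s v ^ 2 = ‖v‖ ^ (-((n : ℝ) + 2 * s)) := by
  unfold kweight
  rcases eq_or_lt_of_le (norm_nonneg v) with h | h
  · have h1 : -((n : ℝ) + 2 * s) ≠ 0 := by
      have : (0 : ℝ) ≤ n := Nat.cast_nonneg n
      linarith
    rw [← h, Real.zero_rpow h1, Real.zero_rpow (by simpa using h1)]
    simp
  · rw [sq, ← Real.rpow_add h]; congr 1; ring

/-- In polar coordinates the square has density `y ^ (1 - 2s)` near zero, integrable as `s < 1`, and
`y ^ (-1 - 2s)` at infinity, integrable as `s > 0`. -/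
theorem memLp_kweight (hn : 1 ≤ n) (hs0 : 0 < s) (hs1 : s < 1) :
    MemLp (fun z => min ‖z‖ 1 * kweight n s z) 2 := by
  have hm : Measurable fun z : Space n => min ‖z‖ 1 * kweight n s z := by
    have := measurable_kweight (n := n) (s := s)
    fun_prop
  refine (memLp_two_iff_integrable_sq hm.aestronglyMeasurable).2 ?_
  have : Nontrivial (Space n) := by
    have : Nonempty (Fin n) := ⟨⟨0, hn⟩⟩
    infer_instance
  have h := integrable_fun_norm_addHaar (volume : Measure (Space n))
    (f := fun y : ℝ => (min y 1 * y ^ (-((n : ℝ) + 2 * s) / 2)) ^ 2)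
  refine h.2 ?_
  have hpow : ∀ y : ℝ, 0 < y → y ^ (n - 1) * (y ^ (-((n : ℝ) + 2 * s) / 2)) ^ 2 =
      y ^ (-1 - 2 * s) := fun y hy => by
    rw [← Real.rpow_natCast y (n - 1), ← Real.rpow_natCast _ 2, ← Real.rpow_mul hy.le,
      ← Real.rpow_add hy, Nat.cast_sub hn]
    congr 1; push_cast; ring
  rw [← Ioc_union_Ioi_eq_Ioi zero_le_one]
  have hfr : Module.finrank ℝ (Space n) = n := by simp
  rw [hfr]
  refine IntegrableOn.union ?_ ?_
  · have h1 : IntegrableOn (fun y : ℝ => y ^ (1 - 2 * s)) (Ioc 0 1) :=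
      (intervalIntegrable_iff_integrableOn_Ioc_of_le zero_le_one).1
        (intervalIntegral.intervalIntegrable_rpow' (by linarith))
    refine h1.congr_fun (fun y hy => ?_) measurableSet_Ioc
    simp only [smul_eq_mul]
    rw [min_eq_left hy.2, mul_pow, mul_left_comm, hpow y hy.1, ← Real.rpow_natCast y 2,
      ← Real.rpow_add hy.1]
    congr 1; push_cast; ring
  · have h1 : IntegrableOn (fun y : ℝ => y ^ (-1 - 2 * s)) (Ioi 1) :=
      integrableOn_Ioi_rpow_of_lt (by linarith) one_pos
    refine h1.congr_fun (fun y hy => ?_) measurableSet_Ioi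
    simp only [smul_eq_mul]
    have hy' : 1 < y := hy
    rw [min_eq_right hy'.le, one_mul, hpow y (by linarith)]

end Weight

/-! ### Cutoff functions in time and position -/

section Cutoff

variable {V : Type*} [NormedAddCommGroup V] [NormedSpace ℝ V] [FiniteDimensional ℝ V]
  [MeasureSpace V] [BorelSpace V] [(volume : Measure V).IsAddHaarMeasure]

/-- A smooth cutoff function near a set, with the optimal order of its gradient. -/
theorem exists_smooth_cutoff (S : Set V) {δ : ℝ} (hδ : 0 < δ) :
    ∃ h : V → ℝ, ContDiff ℝ ∞ h ∧ (∀ p, 0 ≤ h p) ∧ (∀ p, h p ≤ 1) ∧ (∀ p ∈ S, h p = 1) ∧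
      (∀ p, 3 / 4 * δ ≤ Metric.infDist p S → h p = 0) ∧ ∀ p, ‖fderiv ℝ h p‖ ≤ 4 / δ := by
  -- Equal to `1` up to distance `δ / 4` and to `0` from `δ / 2` on, with slope `4 / δ`. Mollifying
  -- at radius `δ / 4` keeps the value `1` on `S`, the value `0` from `3δ / 4` on, and the Lipschitz
  -- constant.
  let h₀ : V → ℝ := fun p => max 0 (min 1 (2 - 4 / δ * Metric.infDist p S))
  have hδ' : 0 < 4 / δ := by positivity
  have h₀lip : ∀ p q, |h₀ p - h₀ q| ≤ 4 / δ * ‖p - q‖ := fun p q => by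
    have h1 : |h₀ p - h₀ q| ≤ |(2 - 4 / δ * Metric.infDist p S) -
        (2 - 4 / δ * Metric.infDist q S)| := by
      have e : ∀ r, h₀ r = max (min (2 - 4 / δ * Metric.infDist r S) 1) 0 := fun r => by
        simp only [h₀]; rw [max_comm, min_comm]
      rw [e, e]
      exact (abs_max_sub_max_le_abs _ _ _).trans (by
        simpa using abs_min_sub_min_le_max (2 - 4 / δ * Metric.infDist p S) 1
          (2 - 4 / δ * Metric.infDist q S) 1)
    refine h1.trans ?_
    have h2 := (Metric.lipschitz_infDist_pt S).dist_le_mul p q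
    rw [Real.dist_eq, dist_eq_norm, NNReal.coe_one, one_mul] at h2
    rw [show (2 - 4 / δ * Metric.infDist p S) - (2 - 4 / δ * Metric.infDist q S) =
      -(4 / δ * (Metric.infDist p S - Metric.infDist q S)) by ring, abs_neg, abs_mul,
      abs_of_pos hδ']
    gcongr
  have h₀c : Continuous h₀ := by
    have := (Metric.lipschitz_infDist_pt S).continuous
    simp only [h₀]; fun_prop
  have h₀0 : ∀ p, 0 ≤ h₀ p := fun p => le_max_left _ _
  have h₀1 : ∀ p, h₀ p ≤ 1 := fun p => max_le zero_le_one (min_le_left _ _)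
  let φ : ContDiffBump (0 : V) := ⟨δ / 8, δ / 4, by positivity, by linarith⟩
  have hφr : φ.rOut = δ / 4 := rfl
  set h : V → ℝ := fun p => ∫ q, φ.normed volume q * h₀ (p - q) with hh
  have hconv : h = convolution (φ.normed volume) h₀ (ContinuousLinearMap.lsmul ℝ ℝ) volume := rfl
  have hi : ∀ p, Integrable fun q => φ.normed volume q * h₀ (p - q) := fun p =>
    φ.hasCompactSupport_normed.convolutionExists_left (ContinuousLinearMap.lsmul ℝ ℝ)
      φ.continuous_normed h₀c.locallyIntegrable p
  have hinf : ∀ p q, Metric.infDist p S ≤ Metric.infDist q S + ‖p - q‖ := fun p q => by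
    have h2 := (Metric.lipschitz_infDist_pt S).dist_le_mul p q
    rw [Real.dist_eq, dist_eq_norm, NNReal.coe_one, one_mul] at h2
    linarith [le_abs_self (Metric.infDist p S - Metric.infDist q S)]
  have h48 : 4 / δ * (δ / 4) = 1 := by field_simp
  have h42 : 4 / δ * (δ / 2) = 2 := by field_simp; norm_num
  refine ⟨h, ?_, fun p => ?_, fun p => ?_, fun p hp => ?_, fun p hp => ?_, fun p => ?_⟩
  · rw [hconv]
    exact φ.hasCompactSupport_normed.contDiff_convolution_left _ φ.contDiff_normed
      h₀c.locallyIntegrable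
  · exact integral_nonneg fun q => mul_nonneg (φ.nonneg_normed q) (h₀0 _)
  · have : ∫ q, φ.normed volume q * 1 = 1 := by rw [integral_mul_const, φ.integral_normed, one_mul]
    rw [← this]
    exact integral_mono (hi p) (φ.integrable_normed.mul_const 1) fun q =>
      mul_le_mul_of_nonneg_left (h₀1 _) (φ.nonneg_normed q)
  · have h1 : ∀ q, Metric.infDist q S ≤ δ / 4 → h₀ q = 1 := fun q hq => by
      simp only [h₀]
      have : 4 / δ * Metric.infDist q S ≤ 4 / δ * (δ / 4) := mul_le_mul_of_nonneg_left hq hδ'.le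
      rw [min_eq_left (by linarith), max_eq_right zero_le_one]
    have hp0 : Metric.infDist p S = 0 := Metric.infDist_zero_of_mem hp
    have h2 : h p = h₀ p := by
      rw [hconv]
      refine ContDiffBump.normed_convolution_eq_right (μ := (volume : Measure V)) (φ := φ)
        fun q hq => ?_
      rw [hφr, mem_ball_iff_norm] at hq
      rw [h1 q (by linarith [hinf q p]), h1 p (by rw [hp0]; positivity)]
    rw [h2, h1 p (by rw [hp0]; positivity)]
  · have h1 : ∀ q, δ / 2 ≤ Metric.infDist q S → h₀ q = 0 := fun q hq => by
      simp only [h₀]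
      have : 4 / δ * (δ / 2) ≤ 4 / δ * Metric.infDist q S := mul_le_mul_of_nonneg_left hq hδ'.le
      exact max_eq_left ((min_le_right _ _).trans (by linarith))
    have h2 : h p = h₀ p := by
      rw [hconv]
      refine ContDiffBump.normed_convolution_eq_right (μ := (volume : Measure V)) (φ := φ)
        fun q hq => ?_
      rw [hφr, mem_ball_iff_norm, norm_sub_rev] at hq
      rw [h1 q (by linarith [hinf p q]), h1 p (by linarith)]
    rw [h2, h1 p (by linarith)]
  · have hlip : LipschitzWith (Real.toNNReal (4 / δ)) h := by
      refine LipschitzWith.of_dist_le_mul fun p q => ?_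
      rw [Real.coe_toNNReal _ hδ'.le, Real.dist_eq, dist_eq_norm, hh]
      simp only
      rw [← integral_sub (hi p) (hi q)]
      have h1 : ∫ z, φ.normed volume z * (4 / δ * ‖p - q‖) = 4 / δ * ‖p - q‖ := by
        rw [integral_mul_const, φ.integral_normed, one_mul]
      rw [← h1, ← Real.norm_eq_abs]
      refine norm_integral_le_of_norm_le
        ((φ.integrable_normed (μ := (volume : Measure V))).mul_const _)
        (Eventually.of_forall fun z => ?_)
      rw [← mul_sub, norm_mul, Real.norm_of_nonneg (φ.nonneg_normed z)]
      refine mul_le_mul_of_nonneg_left ?_ (φ.nonneg_normed z)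
      have := h₀lip (p - z) (q - z)
      rwa [sub_sub_sub_cancel_right] at this
    have := norm_fderiv_le_of_lipschitz ℝ hlip (x₀ := p)
    rwa [Real.coe_toNNReal _ hδ'.le] at this

/-- Cutoff functions in `(t,x)` that increase to `1` on `[S,0) × Ω'`, with one-sided control of
their transport derivatives. -/
theorem exists_transport_cutoffs {n : ℕ} {T S δ : ℝ} {Ω Ω' : Set (Space n)}
    (hΩ' : IsCompact Ω') (hne : Ω'.Nonempty) (hδ : 0 < δ) (hδS : δ ≤ S - T)
    (hδΩ : ∀ x ∈ Ω', ∀ y, dist x y < δ → y ∈ Ω) (R : ℝ) :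
    ∃ K : Set (Space n), IsCompact K ∧ K ⊆ Ω ∧ Ω' ⊆ K ∧ ∃ η : ℕ → ℝ × Space n → ℝ, ∀ k,
      ContDiff ℝ ∞ (η k) ∧ HasCompactSupport (η k) ∧ tsupport (η k) ⊆ Ioo T 0 ×ˢ K ∧
      (∀ p, 0 ≤ η k p) ∧ (∀ p, η k p ≤ 1) ∧
      (∀ p (v : Space n), ‖v‖ < R → fderiv ℝ (η k) p (1, v) ≤ 4 / δ * max R 1) ∧
      ∀ t x, S ≤ t → t ≤ -2 / ((k:ℝ) + 1) → x ∈ Ω' → η k (t, x) = 1 := by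
  -- The radius lies strictly between `3δ / 4`, where the cutoff ends, and `δ`, within which `Ω` is
  -- not left.
  set K := Metric.cthickening (7 / 8 * δ) Ω' with hK_def
  have hKc : IsCompact K := hΩ'.cthickening
  have hΩK : Ω' ⊆ K := Metric.self_subset_cthickening _
  have hKΩ : K ⊆ Ω := by
    rw [hK_def, hΩ'.cthickening_eq_biUnion_closedBall (by positivity)]
    refine iUnion₂_subset fun x hx y hy => hδΩ x hx y ?_
    rw [dist_comm]
    exact (Metric.mem_closedBall.1 hy).trans_lt (by linarith)
  refine ⟨K, hKc, hKΩ, hΩK, ?_⟩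
  have hS0 : (Ici S ×ˢ Ω').Nonempty := nonempty_Ici.prod hne
  -- Using `[S, ∞)` instead of `[S, 0]` keeps this factor equal to `1` up to and past time zero; the
  -- cut at time zero is left to the monotone factor `ζ k`.
  obtain ⟨h, hh, hh0, hh1, hhS, hhz, hhd⟩ := exists_smooth_cutoff (Ici S ×ˢ Ω') hδ
  let ζ : ℕ → ℝ → ℝ := fun k t => Real.smoothTransition (-(k + 1) * t - 1)
  have hζ : ∀ k, ContDiff ℝ ∞ (ζ k) := fun k =>
    Real.smoothTransition.contDiff.comp (by fun_prop)
  have hζa : ∀ k, Antitone (ζ k) := fun k a b hab => by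
    refine Real.smoothTransition.monotone ?_
    have : (0:ℝ) < k + 1 := by positivity
    nlinarith
  have hζ0 : ∀ (k : ℕ) (t : ℝ), -1 / ((k:ℝ) + 1) ≤ t → ζ k t = 0 := fun k t ht => by
    refine Real.smoothTransition.zero_of_nonpos ?_
    have h1 : (0:ℝ) < k + 1 := by positivity
    rw [div_le_iff₀ h1] at ht
    linarith
  have hζ1 : ∀ (k : ℕ) (t : ℝ), t ≤ -2 / ((k:ℝ) + 1) → ζ k t = 1 := fun k t ht => by
    refine Real.smoothTransition.one_of_one_le ?_
    have h1 : (0:ℝ) < k + 1 := by positivity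
    rw [le_div_iff₀ h1] at ht
    linarith
  refine ⟨fun k p => h p * ζ k p.1, fun k => ?_⟩
  have hsub : Function.support (fun p : ℝ × Space n => h p * ζ k p.1) ⊆
      Icc (S - 7 / 8 * δ) (-1 / ((k:ℝ) + 1)) ×ˢ K := by
    rintro ⟨t, x⟩ hp
    rw [Function.mem_support] at hp
    have h1 : h (t, x) ≠ 0 := left_ne_zero_of_mul hp
    have h2 : ζ k t ≠ 0 := right_ne_zero_of_mul hp
    have h3 : Metric.infDist (t, x) (Ici S ×ˢ Ω') < 7 / 8 * δ := by
      by_contra h3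
      exact h1 (hhz _ (by linarith))
    obtain ⟨⟨t', x'⟩, ⟨ht', hx'⟩, hd⟩ := (Metric.infDist_lt_iff hS0).1 h3
    rw [Prod.dist_eq, max_lt_iff] at hd
    have hd1 := abs_lt.1 (show |t - t'| < _ from hd.1)
    refine ⟨⟨?_, ?_⟩, ?_⟩
    · have : S ≤ t' := ht'
      change S - 7 / 8 * δ ≤ t
      linarith
    · change t ≤ _
      by_contra h4
      exact h2 (hζ0 k t (not_le.1 h4).le)
    · exact Metric.mem_cthickening_of_dist_le _ _ _ _ hx' hd.2.le
  have hcl : IsCompact (Icc (S - 7 / 8 * δ) (-1 / ((k:ℝ) + 1)) ×ˢ K) := isCompact_Icc.prod hKc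
  have hts := closure_minimal hsub hcl.isClosed
  refine ⟨hh.mul ((hζ k).comp contDiff_fst), ?_, ?_, ?_, ?_, ?_, ?_⟩
  · exact hcl.of_isClosed_subset (isClosed_tsupport _) hts
  · refine hts.trans (prod_mono_left fun t ht => ⟨?_, ?_⟩)
    · linarith [ht.1]
    · exact ht.2.trans_lt (div_neg_of_neg_of_pos (by norm_num) (by positivity))
  · exact fun p => mul_nonneg (hh0 p) (Real.smoothTransition.nonneg _)
  · exact fun p => mul_le_one₀ (hh1 p) (Real.smoothTransition.nonneg _)
      (Real.smoothTransition.le_one _)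
  · intro p v hv
    have e1 : HasFDerivAt h (fderiv ℝ h p) p := (hh.differentiable (by simp) p).hasFDerivAt
    have e2 : HasFDerivAt (fun p : ℝ × Space n => ζ k p.1)
        (deriv (ζ k) p.1 • ContinuousLinearMap.fst ℝ ℝ (Space n)) p :=
      HasDerivAt.comp_hasFDerivAt (h₂ := ζ k) p
        ((hζ k).differentiable (by simp) p.1).hasDerivAt hasFDerivAt_fst
    have e3 : HasFDerivAt (fun p : ℝ × Space n => h p * ζ k p.1) _ p := e1.mul e2
    rw [e3.fderiv]
    simp only [_root_.add_apply, _root_.smul_apply, smul_eq_mul,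
      ContinuousLinearMap.coe_fst', mul_one]
    -- This derivative is unbounded in `k` but has the favourable sign, so the upper bound is
    -- uniform in `k`.
    have hd0 : deriv (ζ k) p.1 ≤ 0 := (hζa k).deriv_nonpos
    have h1 : h p * deriv (ζ k) p.1 ≤ 0 := mul_nonpos_of_nonneg_of_nonpos (hh0 p) hd0
    have h2 : fderiv ℝ h p (1, v) ≤ 4 / δ * max R 1 := by
      refine (le_abs_self _).trans (((fderiv ℝ h p).le_opNorm (1, v)).trans ?_)
      refine mul_le_mul (hhd p) ?_ (norm_nonneg _) (by positivity)
      -- The product carries the maximum norm, which is where `max R 1` comes from.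
      rw [Prod.norm_def, norm_one]
      exact max_le (le_max_right _ _) (hv.le.trans (le_max_left _ _))
    have h3 : ζ k p.1 * fderiv ℝ h p (1, v) ≤ 4 / δ * max R 1 := by
      have h4 : 0 ≤ ζ k p.1 := Real.smoothTransition.nonneg _
      have h5 : ζ k p.1 ≤ 1 := Real.smoothTransition.le_one _
      have h6 : 0 ≤ 4 / δ * max R 1 := by
        have : 0 < max R 1 := lt_max_of_lt_right one_pos
        positivity
      calc ζ k p.1 * fderiv ℝ h p (1, v) ≤ ζ k p.1 * (4 / δ * max R 1) :=
            mul_le_mul_of_nonneg_left h2 h4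
        _ ≤ _ := mul_le_of_le_one_left h6 h5
    linarith
  · intro t x ht htk hx
    change h (t, x) * ζ k t = 1
    rw [hhS (t, x) (mk_mem_prod (mem_Ici.2 ht) hx), hζ1 k t htk, mul_one]

end Cutoff

/-! ### The principal value `𝓛ψ` -/

section Barrier

variable {n : ℕ} {s κ : ℝ} {K : ℝ → Space n → Space n → Space n → ℝ} {R r₀ M : ℝ}
  {ψ : Space n → ℝ}

/-- Quantitative consequences of `C^{1,1}` regularity near the ball of radius `R`. -/
structure TaylorBound (R r₀ M : ℝ) (ψ : Space n → ℝ) : Prop where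
  pos : 0 < r₀
  le_one : r₀ ≤ 1
  nonneg : 0 ≤ M
  bound : ∀ v, ‖v‖ < R → |ψ v| ≤ M
  lip : ∀ v w, ‖v‖ < R + r₀ → ‖w‖ < R + r₀ → |ψ v - ψ w| ≤ M * ‖v - w‖
  taylor : ∀ v w, ‖v‖ < R → ‖w - v‖ < r₀ →
    |ψ w - ψ v - fderiv ℝ ψ v (w - v)| ≤ M * ‖w - v‖ ^ 2

theorem IsC11NearBall.exists_taylorBound (hR : 0 < R) (h : IsC11NearBall R ψ) :
    ∃ r₀ M, TaylorBound R r₀ M ψ := by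
  obtain ⟨ρ, hρ, L, hd, hL⟩ := h
  have h0 : (0 : Space n) ∈ Metric.ball (0 : Space n) ρ := Metric.mem_ball_self (hR.trans hρ)
  have hda : ∀ v ∈ Metric.ball (0 : Space n) ρ, HasFDerivAt ψ (fderiv ℝ ψ v) v := fun v hv =>
    ((hd v hv).differentiableAt (Metric.isOpen_ball.mem_nhds hv)).hasFDerivAt
  set M₁ := ‖fderiv ℝ ψ 0‖ + L * ρ with hM₁
  have hLρ : 0 ≤ L * ρ := mul_nonneg L.2 (hR.trans hρ).le
  have hM₁0 : 0 ≤ M₁ := by positivity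
  have hb : ∀ v ∈ Metric.ball (0 : Space n) ρ, ‖fderiv ℝ ψ v‖ ≤ M₁ := fun v hv => by
    have h1 := hL.norm_sub_le hv h0
    rw [sub_zero] at h1
    have h2 : (L : ℝ) * ‖v‖ ≤ L * ρ := mul_le_mul_of_nonneg_left (mem_ball_zero_iff.1 hv).le L.2
    have h3 := norm_sub_norm_le (fderiv ℝ ψ v) (fderiv ℝ ψ 0)
    linarith
  have hlip : ∀ v ∈ Metric.ball (0 : Space n) ρ, ∀ w ∈ Metric.ball (0 : Space n) ρ,
      |ψ v - ψ w| ≤ M₁ * ‖v - w‖ := fun v hv w hw =>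
    (convex_ball (0 : Space n) ρ).norm_image_sub_le_of_norm_hasFDerivWithin_le
      (fun z hz => (hda z hz).hasFDerivWithinAt) hb hw hv
  -- One constant serves all three bounds: `|ψ 0| + M₁ * R` for the size, `M₁` for the slope and `L`
  -- for the Taylor remainder.
  refine ⟨min 1 (ρ - R), M₁ + L + |ψ 0| + M₁ * R, lt_min one_pos (by linarith), min_le_left _ _,
    by positivity, fun v hv => ?_, fun v w hv hw => ?_, fun v w hv hw => ?_⟩
  · have h1 := hlip v (mem_ball_zero_iff.2 (hv.trans hρ)) 0 h0
    rw [sub_zero] at h1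
    have h2 := abs_sub_abs_le_abs_sub (ψ v) (ψ 0)
    have h3 : M₁ * ‖v‖ ≤ M₁ * R := mul_le_mul_of_nonneg_left hv.le hM₁0
    linarith [L.2]
  · have h1 := min_le_right 1 (ρ - R)
    refine (hlip v (mem_ball_zero_iff.2 (by linarith)) w
      (mem_ball_zero_iff.2 (by linarith))).trans (mul_le_mul_of_nonneg_right ?_ (norm_nonneg _))
    have : 0 ≤ M₁ * R := by positivity
    linarith [L.2, abs_nonneg (ψ 0)]
  · have h1 := min_le_right 1 (ρ - R)
    have hvb : v ∈ Metric.ball (0 : Space n) ρ := mem_ball_zero_iff.2 (hv.trans hρ)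
    have hwb : w ∈ Metric.ball (0 : Space n) ρ := by
      rw [mem_ball_zero_iff]
      have := norm_add_le v (w - v)
      rw [add_sub_cancel] at this
      linarith
    have hseg : segment ℝ v w ⊆ Metric.ball (0 : Space n) ρ :=
      (convex_ball (0 : Space n) ρ).segment_subset hvb hwb
    -- Mean value inequality for `ψ` minus its linear part at `v`, whose derivative is at most `L *
    -- ‖w - v‖` along the segment.
    have h2 := (convex_segment v w).norm_image_sub_le_of_norm_hasFDerivWithin_le'
      (f := ψ) (φ := fderiv ℝ ψ v) (C := L * ‖w - v‖)
      (fun z hz => (hda z (hseg hz)).hasFDerivWithinAt) (fun z hz => ?_)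
      (left_mem_segment ℝ v w) (right_mem_segment ℝ v w)
    · rw [Real.norm_eq_abs] at h2
      refine h2.trans ?_
      rw [mul_assoc, ← sq]
      refine mul_le_mul_of_nonneg_right ?_ (sq_nonneg _)
      have : 0 ≤ M₁ * R := by positivity
      linarith [abs_nonneg (ψ 0)]
    · refine (hL.norm_sub_le (hseg hz) hvb).trans (mul_le_mul_of_nonneg_left ?_ L.2)
      rw [← dist_eq_norm, ← dist_eq_norm, dist_comm, dist_comm w]
      have := mem_segment_iff_wbtw.1 hz
      have := this.dist_add_dist
      linarith [dist_nonneg (x := z) (y := w)]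

/-- The growth condition includes measurability of the product with a positive continuous weight,
and that weight can be divided out. -/
theorem HasModerateGrowth.aestronglyMeasurable (h : HasModerateGrowth s ψ) :
    AEStronglyMeasurable ψ := by
  have h1 : Continuous fun w : Space n => (1 + ‖w‖) ^ ((n : ℝ) + 2 * s) :=
    Continuous.rpow_const (by fun_prop) fun w => Or.inl (by positivity)
  refine (h.1.mul h1.aestronglyMeasurable).congr (Eventually.of_forall fun w => ?_)
  have h2 : 0 < 1 + ‖w‖ := by positivity
  simp only [Pi.mul_apply]
  rw [mul_assoc, ← Real.rpow_add h2, neg_add_cancel, Real.rpow_zero, mul_one]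

/-- The majorant of the tail of the integral that defines `𝓛ψ`. -/
noncomputable def tailWeight (s M : ℝ) (ψ : Space n → ℝ) (w : Space n) : ℝ :=
  (|ψ w| + M) * (1 + ‖w‖) ^ (-((n : ℝ) + 2 * s))

theorem integrable_tailWeight (hs : 0 < s) (hψ : HasModerateGrowth s ψ) :
    Integrable (tailWeight s M ψ) := by
  have h1 : Integrable fun w : Space n => (1 + ‖w‖) ^ (-((n : ℝ) + 2 * s)) :=
    integrable_one_add_norm (by simp; linarith)
  refine (hψ.abs.add (h1.const_mul M)).congr (Eventually.of_forall fun w => ?_)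
  have h2 : 0 ≤ (1 + ‖w‖) ^ (-((n : ℝ) + 2 * s)) := by positivity
  simp only [Pi.add_apply, tailWeight, abs_mul, abs_of_nonneg h2]
  ring

/-- Away from the diagonal and with `v` in a ball, `1 + |w|` is at most a multiple of `|v - w|`, so
the kernel is controlled by the weight of the growth condition. -/
theorem kweight_sq_le_far (hs : 0 < s) {ε : ℝ} (hε : 0 < ε) (hR : 0 < R) {v w : Space n}
    (hv : ‖v‖ < R) (hvw : ε ≤ ‖v - w‖) :
    kweight n s (v - w) ^ 2 ≤
      ((1 + R) / ε + 1) ^ ((n : ℝ) + 2 * s) * (1 + ‖w‖) ^ (-((n : ℝ) + 2 * s)) := by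
  rw [kweight_sq hs]
  have hn : (0 : ℝ) ≤ (n : ℝ) + 2 * s := by positivity
  have h1 : 0 < ‖v - w‖ := hε.trans_le hvw
  have h2 : 1 + ‖w‖ ≤ ((1 + R) / ε + 1) * ‖v - w‖ := by
    have h3 : 1 + R ≤ (1 + R) / ε * ‖v - w‖ := by
      rw [div_mul_eq_mul_div, le_div_iff₀ hε]
      exact mul_le_mul_of_nonneg_left hvw (by positivity)
    have h4 := norm_sub_norm_le w v
    rw [norm_sub_rev] at h4
    linarith
  have hc : 0 < (1 + R) / ε + 1 := by positivity
  rw [Real.rpow_neg h1.le, Real.rpow_neg (by positivity), ← div_eq_mul_inv,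
    le_div_iff₀ (by positivity), inv_mul_le_iff₀ (by positivity), mul_comm (‖v - w‖ ^ _),
    ← Real.mul_rpow hc.le h1.le]
  exact Real.rpow_le_rpow (by positivity) h2 hn

theorem IsKernel.nonneg (hK : IsKernel s κ K) (hκ : 0 < κ) {t : ℝ} {x v w : Space n}
    (h : v ≠ w) : 0 ≤ K t x v w := by
  refine le_trans ?_ (hK.lower t x v w h)
  split_ifs
  · positivity
  · exact le_rfl

theorem IsKernel.abs_mul_le (hK : IsKernel s κ K) (hκ : 0 < κ) (hs : 0 < s) (t : ℝ)
    (x : Space n) {v w : Space n} {y : ℝ} (hy : v = w → y = 0) :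
    |K t x v w * y| ≤ κ * kweight n s (v - w) ^ 2 * |y| := by
  by_cases h : v = w
  · rw [hy h]; simp
  · rw [abs_mul, abs_of_nonneg (hK.nonneg hκ h), kweight_sq hs]
    exact mul_le_mul_of_nonneg_right (hK.upper t x v w h) (abs_nonneg _)

theorem IsKernel.measurable_pair (hK : IsKernel s κ K) (t : ℝ) (x : Space n) :
    Measurable fun q : Space n × Space n => K t x q.1 q.2 :=
  hK.measurable.comp (by fun_prop : Measurable fun q : Space n × Space n => (t, x, q.1, q.2))

theorem IsKernel.measurable_slice (hK : IsKernel s κ K) (t : ℝ) (x v : Space n) :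
    Measurable fun w => K t x v w :=
  (hK.measurable_pair t x).comp (by fun_prop : Measurable fun w => (v, w))

theorem TaylorBound.abs_far_le (hT : TaylorBound R r₀ M ψ) (hK : IsKernel s κ K) (hκ : 0 < κ)
    (hs : 0 < s) (hR : 0 < R) {ε : ℝ} (hε : 0 < ε) (t : ℝ) (x : Space n) {v w : Space n}
    (hv : ‖v‖ < R) (hvw : ε ≤ ‖w - v‖) :
    |K t x v w * (ψ w - ψ v)| ≤
      κ * ((1 + R) / ε + 1) ^ ((n : ℝ) + 2 * s) * tailWeight s M ψ w := by
  rw [norm_sub_rev] at hvw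
  have h1 := hK.abs_mul_le hκ hs t x (v := v) (w := w) (y := ψ w - ψ v) fun h => by rw [h, sub_self]
  have h2 : |ψ w - ψ v| ≤ |ψ w| + M := (abs_sub _ _).trans (by linarith [hT.bound v hv])
  refine h1.trans ((mul_le_mul (mul_le_mul_of_nonneg_left (kweight_sq_le_far hs hε hR hv hvw) hκ.le)
    h2 (abs_nonneg _) (by positivity)).trans (le_of_eq ?_))
  rw [tailWeight]; ring

theorem TaylorBound.integrableOn_far (hT : TaylorBound R r₀ M ψ) (hK : IsKernel s κ K)
    (hκ : 0 < κ) (hs : 0 < s) (hR : 0 < R) (hψ : HasModerateGrowth s ψ) {ε : ℝ} (hε : 0 < ε)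
    (t : ℝ) (x : Space n) {v : Space n} (hv : ‖v‖ < R) :
    IntegrableOn (fun w => K t x v w * (ψ w - ψ v)) {w | ε < ‖w - v‖} := by
  have hm : MeasurableSet {w : Space n | ε < ‖w - v‖} :=
    measurableSet_lt measurable_const (by fun_prop)
  refine ((integrable_tailWeight (M := M) hs hψ).const_mul
    (κ * ((1 + R) / ε + 1) ^ ((n : ℝ) + 2 * s))).integrableOn.mono'
    ((hK.measurable_slice t x v).aestronglyMeasurable.mul
      (hψ.aestronglyMeasurable.sub aestronglyMeasurable_const)).restrict ?_
  refine (ae_restrict_mem hm).mono fun w hw => ?_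
  exact hT.abs_far_le hK hκ hs hR hε t x hv (le_of_lt hw)

/-- The integrand of `𝓛ψ` with the linear part of `ψ` subtracted near the diagonal. -/
noncomputable def compensated (K : ℝ → Space n → Space n → Space n → ℝ) (ψ : Space n → ℝ)
    (r₀ : ℝ) (t : ℝ) (x v w : Space n) : ℝ :=
  K t x v w * (ψ w - ψ v - if ‖w - v‖ < r₀ then fderiv ℝ ψ v (w - v) else 0)

/-- The Taylor remainder is quadratic near the diagonal, which beats the singularity; far away the
growth condition takes over. The majorant does not depend on `(t,x)`, and on `v` only through a
translation. -/
theorem TaylorBound.abs_compensated_le (hT : TaylorBound R r₀ M ψ) (hK : IsKernel s κ K)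
    (hκ : 0 < κ) (hs : 0 < s) (hR : 0 < R) (t : ℝ) (x : Space n) {v : Space n} (hv : ‖v‖ < R)
    (w : Space n) :
    |compensated K ψ r₀ t x v w| ≤ κ * M * (min ‖w - v‖ 1 * kweight n s (w - v)) ^ 2 +
      κ * ((1 + R) / r₀ + 1) ^ ((n : ℝ) + 2 * s) * tailWeight s M ψ w := by
  have h0 : 0 ≤ tailWeight s M ψ w := by
    have := hT.nonneg
    unfold tailWeight; positivity
  have hM := hT.nonneg
  have hr := hT.pos
  unfold compensated
  split_ifs with h
  · have h1 := hK.abs_mul_le hκ hs t x (v := v) (w := w)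
      (y := ψ w - ψ v - fderiv ℝ ψ v (w - v)) fun h => by simp [h]
    refine h1.trans (le_add_of_le_of_nonneg ?_ (by positivity))
    rw [min_eq_left (h.le.trans hT.le_one), ← kweight_neg, neg_sub]
    calc _ ≤ κ * kweight n s (w - v) ^ 2 * (M * ‖w - v‖ ^ 2) :=
          mul_le_mul_of_nonneg_left (hT.taylor v w hv h) (by positivity)
      _ = _ := by ring
  · rw [sub_zero]
    refine (hT.abs_far_le hK hκ hs hR hT.pos t x hv (not_lt.1 h)).trans
      (le_add_of_nonneg_left (by positivity))

theorem integrable_compensated_bound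
    (hs : 0 < s) (hs1 : s < 1) (hn : 1 ≤ n) (hψ : HasModerateGrowth s ψ) (v : Space n) (a b : ℝ) :
    Integrable fun w => a * (min ‖w - v‖ 1 * kweight n s (w - v)) ^ 2 + b * tailWeight s M ψ w :=
  (((memLp_kweight hn hs hs1).integrable_sq.comp_sub_right v).const_mul a).add
    ((integrable_tailWeight hs hψ).const_mul b)

theorem TaylorBound.integrable_compensated (hT : TaylorBound R r₀ M ψ) (hK : IsKernel s κ K)
    (hκ : 0 < κ) (hs : 0 < s) (hs1 : s < 1) (hn : 1 ≤ n) (hR : 0 < R)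
    (hψ : HasModerateGrowth s ψ) (t : ℝ) (x : Space n) {v : Space n} (hv : ‖v‖ < R) :
    Integrable (compensated K ψ r₀ t x v) := by
  refine (integrable_compensated_bound hs hs1 hn hψ v _ _).mono' ?_
    (Eventually.of_forall (hT.abs_compensated_le hK hκ hs hR t x hv))
  refine (hK.measurable_slice t x v).aestronglyMeasurable.mul
    ((hψ.aestronglyMeasurable.sub aestronglyMeasurable_const).sub ?_)
  exact (Measurable.ite (measurableSet_lt (by fun_prop) measurable_const) (by fun_prop)
    measurable_const).aestronglyMeasurable

/-- The reflection symmetry `K(v, v+z) = K(v, v-z)` makes the subtracted linear part odd about `v`,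
so it integrates to zero over the symmetric region. -/
theorem TaylorBound.truncL_eq (hT : TaylorBound R r₀ M ψ) (hK : IsKernel s κ K)
    (hκ : 0 < κ) (hs : 0 < s) (hs1 : s < 1) (hn : 1 ≤ n) (hR : 0 < R)
    (hψ : HasModerateGrowth s ψ) (t : ℝ) (x : Space n) {v : Space n} (hv : ‖v‖ < R) {ε : ℝ}
    (hε : 0 < ε) :
    truncL K t x ψ v ε = ∫ w in {w | ε < ‖w - v‖}, compensated K ψ r₀ t x v w := by
  have hm : MeasurableSet {w : Space n | ε < ‖w - v‖} :=
    measurableSet_lt measurable_const (by fun_prop)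
  have h1 := hT.integrableOn_far hK hκ hs hR hψ hε t x hv
  have h2 := (hT.integrable_compensated hK hκ hs hs1 hn hR hψ t x hv).integrableOn
    (s := {w | ε < ‖w - v‖})
  rw [truncL, ← sub_eq_zero, ← integral_sub h1 h2, ← integral_indicator hm]
  set u : Space n → ℝ := {w | ε < ‖w - v‖}.indicator
    (fun w => K t x v w * (ψ w - ψ v) - compensated K ψ r₀ t x v w) with hu
  have hodd : ∀ z, u (v - z) = - u (v + z) := fun z => by
    simp only [hu, indicator, mem_ofPred_eq, add_sub_cancel_left, sub_sub_cancel_left, norm_neg,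
      compensated]
    rw [← hK.symm_reflect]
    split_ifs <;> first | (simp only [map_neg]; ring) | simp
  have h3 : ∫ w, u w = ∫ z, u (v + z) := (integral_add_left_eq_self u v).symm
  have h4 : ∫ z, u (v - z) = ∫ w, u w := integral_sub_left_eq_self u volume v
  simp_rw [hodd] at h4
  rw [integral_neg, ← h3] at h4
  change ∫ w, u w = 0
  linarith

/-- Once compensated, the integrand is absolutely integrable and the truncations converge by
domination. Existence of a limit is what makes `limUnder` in `opL` meaningful. -/
theorem TaylorBound.tendsto_truncL (hT : TaylorBound R r₀ M ψ) (hK : IsKernel s κ K)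
    (hκ : 0 < κ) (hs : 0 < s) (hs1 : s < 1) (hn : 1 ≤ n) (hR : 0 < R)
    (hψ : HasModerateGrowth s ψ) (t : ℝ) (x : Space n) {v : Space n} (hv : ‖v‖ < R) :
    Tendsto (truncL K t x ψ v) (𝓝[>] 0) (𝓝 (opL K t x ψ v)) := by
  have hi := hT.integrable_compensated hK hκ hs hs1 hn hR hψ t x hv
  have hm : ∀ ε, MeasurableSet {w : Space n | ε < ‖w - v‖} := fun ε =>
    measurableSet_lt measurable_const (by fun_prop)
  have h1 : Tendsto (truncL K t x ψ v) (𝓝[>] 0) (𝓝 (∫ w, compensated K ψ r₀ t x v w)) := by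
    have h2 : Tendsto (fun ε => ∫ w, {w | ε < ‖w - v‖}.indicator (compensated K ψ r₀ t x v) w)
        (𝓝[>] 0) (𝓝 (∫ w, compensated K ψ r₀ t x v w)) := by
      refine tendsto_integral_filter_of_dominated_convergence _
        (Eventually.of_forall fun ε => hi.1.indicator (hm ε))
        (Eventually.of_forall fun ε =>
          Eventually.of_forall fun w => norm_indicator_le_norm_self _ _)
        hi.norm (Eventually.of_forall fun w => ?_)
      by_cases hw : w = v
      · have : compensated K ψ r₀ t x v w = 0 := by simp [compensated, hw]
        simp [indicator, this]
      · have hp : 0 < ‖w - v‖ := norm_sub_pos_iff.2 hw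
        refine tendsto_const_nhds.congr' ?_
        filter_upwards [nhdsWithin_le_nhds (Iio_mem_nhds hp)] with ε hε
        rw [indicator_of_mem (by exact hε)]
    refine h2.congr' ?_
    filter_upwards [self_mem_nhdsWithin] with ε hε
    rw [hT.truncL_eq hK hκ hs hs1 hn hR hψ t x hv hε, integral_indicator (hm ε)]
  exact tendsto_nhds_limUnder ⟨_, h1⟩

/-- The integral of the majorant is translation invariant in `v`, hence uniform. This uniformity is
what lets the limit `ε → 0` pass under the integral over `v`. -/
theorem TaylorBound.exists_abs_truncL_le (hT : TaylorBound R r₀ M ψ) (hK : IsKernel s κ K)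
    (hκ : 0 < κ) (hs : 0 < s) (hs1 : s < 1) (hn : 1 ≤ n) (hR : 0 < R)
    (hψ : HasModerateGrowth s ψ) :
    ∃ c, ∀ t x v, ‖v‖ < R → ∀ ε, 0 < ε → |truncL K t x ψ v ε| ≤ c := by
  set a := κ * M
  set b := κ * ((1 + R) / r₀ + 1) ^ ((n : ℝ) + 2 * s)
  refine ⟨(∫ w, a * (min ‖w‖ 1 * kweight n s w) ^ 2) + ∫ w, b * tailWeight s M ψ w,
    fun t x v hv ε hε => ?_⟩
  have hi := hT.integrable_compensated hK hκ hs hs1 hn hR hψ t x hv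
  rw [hT.truncL_eq hK hκ hs hs1 hn hR hψ t x hv hε, ← Real.norm_eq_abs]
  refine (norm_integral_le_integral_norm _).trans ((setIntegral_le_integral hi.norm
    (Eventually.of_forall fun w => norm_nonneg _)).trans ?_)
  refine (integral_mono hi.norm (integrable_compensated_bound hs hs1 hn hψ v a b)
    (hT.abs_compensated_le hK hκ hs hR t x hv)).trans (le_of_eq ?_)
  rw [integral_add (((memLp_kweight hn hs hs1).integrable_sq.comp_sub_right v).const_mul a)
    ((integrable_tailWeight hs hψ).const_mul b)]
  congr 1
  exact integral_sub_right_eq_self (μ := (volume : Measure (Space n)))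
    (fun w => a * (min ‖w‖ 1 * kweight n s w) ^ 2) v

end Barrier

/-! ### Duality between the form and the operator -/

section Pairing

variable {n : ℕ} {s κ : ℝ} {K : ℝ → Space n → Space n → Space n → ℝ} {R r₀ M : ℝ}
  {ψ : Space n → ℝ}

/-- `∬ K [ψ(w) - ψ(v)] [g(w) - g(v)] dw dv = -2 ∫ g 𝓛ψ dv` for `g` supported in the ball where
`𝓛ψ` is controlled. -/
theorem TaylorBound.integral_formIntegrand (hT : TaylorBound R r₀ M ψ) (hK : IsKernel s κ K)
    (hκ : 0 < κ) (hs : 0 < s) (hs1 : s < 1) (hn : 1 ≤ n) (hR : 0 < R)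
    (hψ : HasModerateGrowth s ψ) (t : ℝ) (x : Space n) {g : Space n → ℝ} (hg : Integrable g)
    (hg0 : ∀ v, R ≤ ‖v‖ → g v = 0) (hi : Integrable (formIntegrand K t x ψ g)) :
    ∫ q, formIntegrand K t x ψ g q = -2 * ∫ v, g v * opL K t x ψ v := by
  have hm : ∀ ε, MeasurableSet {q : Space n × Space n | ε < ‖q.2 - q.1‖} := fun ε =>
    measurableSet_lt measurable_const (by fun_prop)
  obtain ⟨c, hc⟩ := hT.exists_abs_truncL_le hK hκ hs hs1 hn hR hψ
  have h1 : Tendsto (fun ε => ∫ q, {q : Space n × Space n | ε < ‖q.2 - q.1‖}.indicator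
      (formIntegrand K t x ψ g) q) (𝓝[>] 0) (𝓝 (∫ q, formIntegrand K t x ψ g q)) := by
    refine tendsto_integral_filter_of_dominated_convergence _
      (Eventually.of_forall fun ε => hi.1.indicator (hm ε))
      (Eventually.of_forall fun ε => Eventually.of_forall fun w => norm_indicator_le_norm_self _ _)
      hi.norm (Eventually.of_forall fun q => ?_)
    by_cases hq : q.2 = q.1
    · have : formIntegrand K t x ψ g q = 0 := by simp [formIntegrand, hq]
      simp [indicator, this]
    · have hp : 0 < ‖q.2 - q.1‖ := norm_sub_pos_iff.2 hq
      refine tendsto_const_nhds.congr' ?_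
      filter_upwards [nhdsWithin_le_nhds (Iio_mem_nhds hp)] with ε hε
      rw [indicator_of_mem (by exact hε)]
  have htm : ∀ ε, AEStronglyMeasurable (truncL K t x ψ · ε) := by
    intro ε
    have e : (truncL K t x ψ · ε) = fun v =>
        ∫ w, {q : Space n × Space n | ε < ‖q.2 - q.1‖}.indicator
        (fun q => K t x q.1 q.2 * (ψ q.2 - ψ q.1)) (v, w) := by
      funext v
      rw [truncL, ← integral_indicator (measurableSet_lt measurable_const (by fun_prop))]
      rfl
    rw [e]
    have h2 : AEStronglyMeasurable (fun q : Space n × Space n => K t x q.1 q.2 * (ψ q.2 - ψ q.1))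
        ((volume : Measure (Space n)).prod volume) :=
      (hK.measurable_pair t x).aestronglyMeasurable.mul
        (hψ.aestronglyMeasurable.comp_snd.sub hψ.aestronglyMeasurable.comp_fst)
    exact (h2.indicator (hm ε)).integral_prod_right'
  have h3 : Tendsto (fun ε => ∫ v, g v * truncL K t x ψ v ε) (𝓝[>] 0)
      (𝓝 (∫ v, g v * opL K t x ψ v)) := by
    refine tendsto_integral_filter_of_dominated_convergence (fun v => |g v| * c)
      (Eventually.of_forall fun ε => hg.1.mul (htm ε)) ?_ (hg.abs.mul_const c)
      (Eventually.of_forall fun v => ?_)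
    · filter_upwards [self_mem_nhdsWithin] with ε hε
      refine Eventually.of_forall fun v => ?_
      rw [norm_mul, Real.norm_eq_abs, Real.norm_eq_abs]
      by_cases hv : ‖v‖ < R
      · exact mul_le_mul_of_nonneg_left (hc t x v hv ε hε) (abs_nonneg _)
      · simp [hg0 v (not_lt.1 hv)]
    · by_cases hv : ‖v‖ < R
      · exact (hT.tendsto_truncL hK hκ hs hs1 hn hR hψ t x hv).const_mul _
      · simp [hg0 v (not_lt.1 hv)]
  refine tendsto_nhds_unique h1 ((h3.const_mul (-2)).congr' ?_)
  filter_upwards [self_mem_nhdsWithin] with ε hε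
  have hε0 : 0 < ε := hε
  -- Off the diagonal the two terms of `g(w) - g(v)` are integrable separately. They are exchanged
  -- by swapping the velocities, so each contributes the same and the factor `-2` appears.
  set T : Space n × Space n → ℝ := {q : Space n × Space n | ε < ‖q.2 - q.1‖}.indicator
    (fun q => g q.1 * (K t x q.1 q.2 * (ψ q.2 - ψ q.1))) with hT_def
  have hTi : Integrable T ((volume : Measure (Space n)).prod volume) := by
    have hb := (hg.abs.mul_const (κ * ((1 + R) / ε + 1) ^ ((n : ℝ) + 2 * s))).mul_prod
      (integrable_tailWeight (M := M) hs hψ)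
    refine hb.mono' ((AEStronglyMeasurable.mul hg.1.comp_fst
      ((hK.measurable_pair t x).aestronglyMeasurable.mul
        (hψ.aestronglyMeasurable.comp_snd.sub hψ.aestronglyMeasurable.comp_fst))).indicator (hm ε))
      (Eventually.of_forall fun q => ?_)
    have h0 : 0 ≤ tailWeight s M ψ q.2 := by
      have := hT.nonneg
      unfold tailWeight; positivity
    by_cases hq : ε < ‖q.2 - q.1‖
    · rw [hT_def, indicator_of_mem (by exact hq), norm_mul, mul_assoc]
      by_cases hv : ‖q.1‖ < R
      · exact mul_le_mul_of_nonneg_left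
          (hT.abs_far_le hK hκ hs hR hε t x hv hq.le) (abs_nonneg _)
      · simp [hg0 _ (not_lt.1 hv)]
    · rw [hT_def, indicator_of_notMem (by exact hq), norm_zero]
      positivity
  have e1 : ∀ q, {q : Space n × Space n | ε < ‖q.2 - q.1‖}.indicator
      (formIntegrand K t x ψ g) q = -(T q.swap + T q) := fun q => by
    simp only [hT_def, indicator, mem_ofPred_eq, Prod.fst_swap, Prod.snd_swap,
      norm_sub_rev q.1 q.2, formIntegrand]
    rw [hK.symm t x q.2 q.1]
    split_ifs
    · ring
    · simp
  have e2 : ∫ q, T q = ∫ v, g v * truncL K t x ψ v ε := by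
    rw [Measure.volume_eq_prod, integral_prod _ hTi]
    refine integral_congr_ae (Eventually.of_forall fun v => ?_)
    simp only [truncL]
    rw [← integral_const_mul,
      ← integral_indicator (measurableSet_lt measurable_const (by fun_prop))]
    rfl
  have e3 : ∫ q : Space n × Space n, T q.swap = ∫ q, T q := integral_prod_swap T
  simp_rw [e1]
  have e4 : ∫ q : Space n × Space n, (T q.swap + T q) =
      (∫ q : Space n × Space n, T q.swap) + ∫ q, T q :=
    integral_add hTi.swap hTi
  rw [integral_neg, e4, e3, e2]
  ring

end Pairing

/-! ### Joint integrability of the form with `ψ` -/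

section JointIntegrability

variable {n : ℕ} {s κ : ℝ} {K : ℝ → Space n → Space n → Space n → ℝ} {R r₀ M : ℝ}
  {ψ : Space n → ℝ}

theorem IsKernel.measurable_joint (hK : IsKernel s κ K) :
    Measurable fun z : (ℝ × Space n) × (Space n × Space n) => K z.1.1 z.1.2 z.2.1 z.2.2 :=
  hK.measurable.comp (by fun_prop :
    Measurable fun z : (ℝ × Space n) × (Space n × Space n) => (z.1.1, z.1.2, z.2.1, z.2.2))

theorem integrable_mul_prod_velocities {G : (ℝ × Space n) × Space n → ℝ} (hG : Integrable G)
    {h : Space n → ℝ} (hh : Integrable h) :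
    Integrable fun z : (ℝ × Space n) × (Space n × Space n) => G (z.1, z.2.1) * h z.2.2 := by
  have h1 : Integrable (fun z : ((ℝ × Space n) × Space n) × Space n => G z.1 * h z.2) :=
    hG.mul_prod hh
  exact (MeasurePreserving.symm MeasurableEquiv.prodAssoc volume_preserving_prodAssoc
    |>.integrable_comp h1.1).2 h1

/-- Absolute convergence of the form `B(ψ, G)` integrated in `(t,x)`. -/
theorem TaylorBound.integrable_formIntegrand (hT : TaylorBound R r₀ M ψ) (hK : IsKernel s κ K)
    (hκ : 0 < κ) (hs : 0 < s) (hs1 : s < 1) (hn : 1 ≤ n) (hR : 0 < R)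
    (hψ : HasModerateGrowth s ψ) {D : Set (ℝ × Space n)} (hD : MeasurableSet D)
    (hDf : volume D ≠ ⊤) {G : (ℝ × Space n) × Space n → ℝ} (hGm : Measurable G)
    (hG : Integrable G) (hGw : MemLp (wdiff (kweight n s) G) 2)
    (hG0 : ∀ p v, p ∉ D ∨ R ≤ ‖v‖ → G (p, v) = 0) :
    Integrable fun z : (ℝ × Space n) × (Space n × Space n) =>
      formIntegrand K z.1.1 z.1.2 ψ (fun v => G (z.1, v)) z.2 := by
  have hwn : MemLp (wnear (kweight n s) R D) 2 :=
    memLp_two_indicator_mul hD hDf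
      (memLp_two_nearBall measurable_kweight kweight_neg (memLp_kweight hn hs hs1) R)
  have hT1 := integrable_mul_prod_velocities hG.abs (integrable_tailWeight (M := M) hs hψ)
  have hT2 := (measurePreserving_swap_velocities (V := ℝ × Space n) (E := Space n)).integrable_comp
    hT1.1 |>.2 hT1
  have hN := hGw.abs.integrable_mul hwn
  set c := κ * ((1 + R) / r₀ + 1) ^ ((n : ℝ) + 2 * s) with hc
  have hψm := hψ.aestronglyMeasurable
  have hm : AEStronglyMeasurable (fun z : (ℝ × Space n) × (Space n × Space n) =>
      formIntegrand K z.1.1 z.1.2 ψ (fun v => G (z.1, v)) z.2) := by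
    have h1 : AEStronglyMeasurable (fun z : (ℝ × Space n) × (Space n × Space n) =>
        ψ z.2.2 - ψ z.2.1) ((volume : Measure (ℝ × Space n)).prod
          ((volume : Measure (Space n)).prod (volume : Measure (Space n)))) :=
      hψm.comp_snd.comp_snd.sub hψm.comp_fst.comp_snd
    have h2 : Measurable (fun z : (ℝ × Space n) × (Space n × Space n) =>
        G (z.1, z.2.2) - G (z.1, z.2.1)) := by fun_prop
    exact hK.measurable_joint.aestronglyMeasurable.mul (h1.mul h2.aestronglyMeasurable)
  refine ((hN.const_mul (κ * M)).add ((hT1.const_mul c).add (hT2.const_mul c))).mono' hm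
    (Eventually.of_forall ?_)
  rintro ⟨p, v, w⟩
  have hM := hT.nonneg
  have htw : ∀ w, 0 ≤ tailWeight s M ψ w := fun w => by unfold tailWeight; positivity
  have hc0 : 0 ≤ c := by have := hT.pos; positivity
  have hnb : 0 ≤ nearBall R (v, w) := nearBall_nonneg R _
  have hkn : 0 ≤ kweight n s (v - w) := kweight_nonneg _
  have hwn0 : 0 ≤ wnear (kweight n s) R D (p, (v, w)) :=
    mul_nonneg (indicator_nonneg (fun _ _ => zero_le_one) _) (mul_nonneg hnb hkn)
  simp only [Pi.add_apply, Pi.mul_apply, Function.comp, Real.norm_eq_abs, Pi.abs_apply]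
  have e1 := mul_nonneg hc0 (mul_nonneg (abs_nonneg (G (p, v))) (htw w))
  have e2 := mul_nonneg hc0 (mul_nonneg (abs_nonneg (G (p, w))) (htw v))
  have e3 : 0 ≤ κ * M * (|wdiff (kweight n s) G (p, (v, w))| *
      wnear (kweight n s) R D (p, (v, w))) := by positivity
  by_cases h0 : p ∈ D ∧ (‖v‖ < R ∨ ‖w‖ < R)
  · obtain ⟨hp, hvw⟩ := h0
    -- Near the diagonal `ψ` is Lipschitz and the product is one of two square integrable functions.
    -- Away from it `G(v)` and `G(w)` are treated separately with the tail weight.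
    rcases lt_or_ge ‖v - w‖ r₀ with h | h
    · refine le_add_of_le_of_nonneg ?_ (by positivity)
      have hw1 : ‖v‖ < R + r₀ ∧ ‖w‖ < R + r₀ := by
        have h4 := norm_sub_norm_le v w
        have h5 := norm_sub_norm_le w v
        rw [norm_sub_rev] at h5
        have := hT.pos
        constructor <;> rcases hvw with hvw | hvw <;> linarith
      have h1 := hT.lip w v hw1.2 hw1.1
      rw [norm_sub_rev] at h1
      have h2 : ‖v - w‖ ≤ nearBall R (v, w) := by
        rw [nearBall, min_eq_left (h.le.trans hT.le_one)]
        refine le_mul_of_one_le_right (norm_nonneg _) ?_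
        rcases hvw with hvw | hvw <;> rw [if_pos hvw] <;> split_ifs <;> norm_num
      rw [formIntegrand]
      refine (hK.abs_mul_le hκ hs p.1 p.2 (v := v) (w := w) fun h => by simp [h]).trans ?_
      rw [abs_mul, wnear, indicator_of_mem hp, Pi.one_apply, one_mul, wdiff, abs_mul,
        abs_of_nonneg hkn]
      have h3 : |ψ w - ψ v| ≤ M * nearBall R (v, w) :=
        h1.trans (mul_le_mul_of_nonneg_left h2 hM)
      calc _ ≤ κ * kweight n s (v - w) ^ 2 *
            (M * nearBall R (v, w) * |G (p, w) - G (p, v)|) := by gcongr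
        _ = _ := by ring
    · refine le_add_of_nonneg_of_le e3 ?_
      have f1 : |K p.1 p.2 v w * (ψ w - ψ v)| * |G (p, v)| ≤
          c * (|G (p, v)| * tailWeight s M ψ w) := by
        by_cases hv : ‖v‖ < R
        · have := hT.abs_far_le hK hκ hs hR hT.pos p.1 p.2 (w := w) hv (by rwa [norm_sub_rev])
          calc _ ≤ c * tailWeight s M ψ w * |G (p, v)| :=
                mul_le_mul_of_nonneg_right this (abs_nonneg _)
            _ = _ := by ring
        · simp [hG0 p v (Or.inr (not_lt.1 hv))]
      have f2 : |K p.1 p.2 v w * (ψ w - ψ v)| * |G (p, w)| ≤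
          c * (|G (p, w)| * tailWeight s M ψ v) := by
        by_cases hv : ‖w‖ < R
        · have := hT.abs_far_le hK hκ hs hR hT.pos p.1 p.2 (w := v) hv h
          rw [hK.symm, ← abs_neg, ← mul_neg, neg_sub] at this
          calc _ ≤ c * tailWeight s M ψ v * |G (p, w)| :=
                mul_le_mul_of_nonneg_right this (abs_nonneg _)
            _ = _ := by ring
        · simp [hG0 p w (Or.inr (not_lt.1 hv))]
      rw [formIntegrand, ← mul_assoc, abs_mul]
      refine (mul_le_mul_of_nonneg_left (abs_sub (G (p, w)) (G (p, v))) (abs_nonneg _)).trans ?_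
      rw [mul_add]
      linarith
  · have h1 : G (p, v) = 0 ∧ G (p, w) = 0 := by
      by_cases hp : p ∈ D
      · have h2 : ¬(‖v‖ < R ∨ ‖w‖ < R) := fun h => h0 ⟨hp, h⟩
        rw [not_or, not_lt, not_lt] at h2
        exact ⟨hG0 _ _ (Or.inr h2.1), hG0 _ _ (Or.inr h2.2)⟩
      · exact ⟨hG0 _ _ (Or.inl hp), hG0 _ _ (Or.inl hp)⟩
    rw [formIntegrand, h1.1, h1.2, sub_zero, mul_zero, mul_zero, abs_zero]
    rw [h1.1, abs_zero] at e1
    rw [h1.2, abs_zero] at e2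
    exact add_nonneg e3 (add_nonneg e1 e2)

end JointIntegrability

/-! ### Finite energy and integrability of test functions -/

section TestFunctions

variable {V E : Type*} [NormedAddCommGroup V] [NormedSpace ℝ V] [FiniteDimensional ℝ V]
  [MeasureSpace V] [BorelSpace V] [(volume : Measure V).IsAddHaarMeasure]
  [NormedAddCommGroup E] [NormedSpace ℝ E] [FiniteDimensional ℝ E]
  [MeasureSpace E] [BorelSpace E] [(volume : Measure E).IsAddHaarMeasure]

/-- A smooth function with compact support is bounded and Lipschitz, so its differences are at most
a multiple of `min |v - w| 1`, and they vanish unless one velocity lies in a fixed ball. -/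
theorem memLp_wdiff_of_contDiff {k : E → ℝ} (hk : Measurable k) (hk0 : ∀ v, 0 ≤ k v)
    (hks : ∀ z, k (-z) = k z) (hκ : MemLp (fun z => min ‖z‖ 1 * k z) 2) {φ : V × E → ℝ}
    (hφ : ContDiff ℝ ∞ φ) (hφc : HasCompactSupport φ) : MemLp (wdiff k φ) 2 := by
  obtain ⟨c, hc⟩ := (hφ.of_le (by simp)).lipschitzWith_of_hasCompactSupport (n := 1) hφc one_ne_zero
  obtain ⟨b, hb⟩ := hφc.exists_bound_of_continuous hφ.continuous
  have hS : IsCompact (Prod.fst '' tsupport φ) := hφc.isCompact.image continuous_fst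
  obtain ⟨ρ, hρ⟩ := (hφc.isCompact.image continuous_snd).isBounded.subset_ball (0 : E)
  have h0 : ∀ p v, φ (p, v) ≠ 0 → p ∈ Prod.fst '' tsupport φ ∧ ‖v‖ < ρ := fun p v h =>
    have h1 := subset_tsupport φ (Function.mem_support.2 h)
    ⟨⟨_, h1, rfl⟩, mem_ball_zero_iff.1 (hρ ⟨_, h1, rfl⟩)⟩
  have hb0 : 0 ≤ b := (norm_nonneg _).trans (hb 0)
  have hwn : MemLp (wnear k ρ (Prod.fst '' tsupport φ)) 2 :=
    memLp_two_indicator_mul hS.isClosed.measurableSet hS.measure_lt_top.ne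
      (memLp_two_nearBall hk hks hκ ρ)
  refine (hwn.const_mul (c + 2 * b)).mono'
    (measurable_wdiff hk hφ.continuous.measurable).aestronglyMeasurable (Eventually.of_forall ?_)
  rintro ⟨p, v, w⟩
  have hnb : 0 ≤ nearBall ρ (v, w) := nearBall_nonneg ρ _
  have hkn := hk0 (v - w)
  simp only [wdiff, wnear, norm_mul, Real.norm_eq_abs, abs_of_nonneg hkn]
  by_cases h : φ (p, v) = 0 ∧ φ (p, w) = 0
  · rw [h.1, h.2, sub_zero, abs_zero, zero_mul]
    have : 0 ≤ (Prod.fst '' tsupport φ).indicator (1 : V → ℝ) p :=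
      indicator_nonneg (fun _ _ => zero_le_one) _
    have := c.2
    positivity
  · have h1 : p ∈ Prod.fst '' tsupport φ ∧ (‖v‖ < ρ ∨ ‖w‖ < ρ) := by
      rw [not_and_or] at h
      rcases h with h | h
      · exact ⟨(h0 p v h).1, Or.inl (h0 p v h).2⟩
      · exact ⟨(h0 p w h).1, Or.inr (h0 p w h).2⟩
    have h2 : min ‖v - w‖ 1 ≤ nearBall ρ (v, w) := by
      rw [nearBall]
      refine le_mul_of_one_le_right (by positivity) ?_
      rcases h1.2 with hvw | hvw <;> rw [if_pos hvw] <;> split_ifs <;> norm_num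
    have h3 : |φ (p, w) - φ (p, v)| ≤ (c + 2 * b) * min ‖v - w‖ 1 := by
      have h4 := hc.dist_le_mul (p, w) (p, v)
      rw [Real.dist_eq, Prod.dist_eq, dist_self, max_eq_right dist_nonneg, dist_eq_norm,
        norm_sub_rev] at h4
      have h5 := (abs_sub (φ (p, w)) (φ (p, v))).trans (add_le_add (hb (p, w)) (hb (p, v)))
      have hc0 := c.2
      rcases le_total ‖v - w‖ 1 with h6 | h6
      · rw [min_eq_left h6]
        have : 0 ≤ 2 * b * ‖v - w‖ := by positivity
        linarith
      · rw [min_eq_right h6]; linarith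
    rw [indicator_of_mem h1.1, Pi.one_apply, one_mul, ← mul_assoc]
    refine mul_le_mul_of_nonneg_right (h3.trans ?_) hkn
    exact mul_le_mul_of_nonneg_left h2 (by have := c.2; positivity)

variable {D : Set V} {R : ℝ} {ψ : E → ℝ} {F : V × E → ℝ}

theorem posPartOn_eq_zero {p : V} {v : E} (h : p ∉ D ∨ R ≤ ‖v‖) :
    posPartOn D R ψ F (p, v) = 0 := by
  rcases h with h | h
  · rw [posPartOn, indicator_of_notMem h, zero_mul]
  · rw [posPartOn, posTrunc, if_neg (not_lt.2 h), mul_zero]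

/-- Square integrable and supported in a set of finite measure. -/
theorem integrable_posPartOn (hD : MeasurableSet D) (hDf : (volume : Measure V) D ≠ ⊤)
    (hψ : Continuous ψ) (hF : Measurable F) (hF2 : MemLp F 2) :
    Integrable (posPartOn D R ψ F) := by
  have h1 := (memLp_posPartOn (R := R) hD hDf hψ hF hF2).integrable_mul
    (memLp_indicator_prod_ball (E := E) hD hDf R 1 (p := 2))
  refine h1.congr (Eventually.of_forall fun x => ?_)
  simp only [Pi.mul_apply]
  by_cases hx : x ∈ D ×ˢ Metric.ball (0 : E) R
  · rw [indicator_of_mem hx, mul_one]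
  · rw [indicator_of_notMem hx, mul_zero]
    rw [mem_prod, not_and_or, mem_ball_zero_iff, not_lt] at hx
    exact (posPartOn_eq_zero hx).symm

end TestFunctions

/-! ### The form as an `L²` pairing -/

section KernelForms

variable {n : ℕ} {s κ : ℝ} {K : ℝ → Space n → Space n → Space n → ℝ} {R r₀ M : ℝ}
  {ψ : Space n → ℝ}

/-- The form `K [g(w) - g(v)] [h(w) - h(v)]` for functions on phase space. -/
def phaseForm (K : ℝ → Space n → Space n → Space n → ℝ) (g h : (ℝ × Space n) × Space n → ℝ)
    (P : (ℝ × Space n) × (Space n × Space n)) : ℝ :=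
  formIntegrand K P.1.1 P.1.2 (fun v => g (P.1, v)) (fun v => h (P.1, v)) P.2

theorem measurable_phaseForm (hK : IsKernel s κ K) {g h : (ℝ × Space n) × Space n → ℝ}
    (hg : Measurable g) (hh : Measurable h) : Measurable (phaseForm K g h) :=
  hK.measurable_joint.mul (Measurable.mul (by fun_prop) (by fun_prop))

theorem abs_phaseForm_le (hK : IsKernel s κ K) (hκ : 0 < κ) (hs : 0 < s)
    (g h : (ℝ × Space n) × Space n → ℝ) (P : (ℝ × Space n) × (Space n × Space n)) :
    |phaseForm K g h P| ≤ κ * (|wdiff (kweight n s) g P| * |wdiff (kweight n s) h P|) := by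
  refine (hK.abs_mul_le hκ hs P.1.1 P.1.2 (v := P.2.1) (w := P.2.2) fun h => by simp [h]).trans
    (le_of_eq ?_)
  rw [wdiff, wdiff, abs_mul, abs_mul, abs_mul, abs_of_nonneg (kweight_nonneg (P.2.1 - P.2.2))]
  ring

theorem integrable_phaseForm (hK : IsKernel s κ K) (hκ : 0 < κ) (hs : 0 < s)
    {g h : (ℝ × Space n) × Space n → ℝ} (hg : Measurable g) (hh : Measurable h)
    (hgw : MemLp (wdiff (kweight n s) g) 2) (hhw : MemLp (wdiff (kweight n s) h) 2) :
    Integrable (phaseForm K g h) :=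
  ((hgw.abs.integrable_mul hhw.abs).const_mul κ).mono'
    (measurable_phaseForm hK hg hh).aestronglyMeasurable
    (Eventually.of_forall (abs_phaseForm_le hK hκ hs g h))

/-- Half the kernel times the difference of `g`, divided by the weight. -/
noncomputable def halfFlux (s : ℝ) (K : ℝ → Space n → Space n → Space n → ℝ)
    (g : (ℝ × Space n) × Space n → ℝ) (P : (ℝ × Space n) × (Space n × Space n)) : ℝ :=
  (1 / 2) * (K P.1.1 P.1.2 P.2.1 P.2.2 * (g (P.1, P.2.2) - g (P.1, P.2.1))) *
    (kweight n s (P.2.1 - P.2.2))⁻¹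

/-- The weight cancels off the diagonal; on the diagonal both sides vanish. The kernel is thereby
hidden in a single factor, which can be translated as a whole. -/
theorem halfFlux_mul_wdiff (g h : (ℝ × Space n) × Space n → ℝ)
    (P : (ℝ × Space n) × (Space n × Space n)) :
    halfFlux s K g P * wdiff (kweight n s) h P = 1 / 2 * phaseForm K g h P := by
  rw [halfFlux, wdiff, phaseForm, formIntegrand]
  by_cases hP : P.2.1 = P.2.2
  · simp [hP]
  · have : kweight n s (P.2.1 - P.2.2) ≠ 0 :=
      (Real.rpow_pos_of_pos (norm_sub_pos_iff.2 hP) _).ne'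
    field_simp

/-- The upper bound on the kernel is `κ` times the squared weight, so dividing by one weight leaves
a multiple of `wdiff`. -/
theorem memLp_halfFlux (hK : IsKernel s κ K) (hκ : 0 < κ) (hs : 0 < s)
    {g : (ℝ × Space n) × Space n → ℝ} (hg : Measurable g)
    (hgw : MemLp (wdiff (kweight n s) g) 2) : MemLp (halfFlux s K g) 2 := by
  have hk := measurable_kweight (n := n) (s := s)
  refine (hgw.abs.const_mul (κ / 2)).mono' (Measurable.aestronglyMeasurable ?_)
    (Eventually.of_forall fun P => ?_)
  · exact ((hK.measurable_joint.mul (by fun_prop)).const_mul _).mul (by fun_prop)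
  · have h1 := hK.abs_mul_le hκ hs P.1.1 P.1.2 (v := P.2.1) (w := P.2.2)
      (y := g (P.1, P.2.2) - g (P.1, P.2.1)) fun h => by simp [h]
    have h2 := kweight_nonneg (s := s) (P.2.1 - P.2.2)
    simp only [Pi.abs_apply]
    rw [halfFlux, wdiff, norm_mul, norm_mul, norm_inv, Real.norm_of_nonneg h2,
      Real.norm_of_nonneg (by norm_num : (0:ℝ) ≤ 1 / 2), Real.norm_eq_abs,
      abs_mul (g (P.1, P.2.2) - g (P.1, P.2.1)), abs_of_nonneg h2]
    rcases h2.eq_or_lt with h3 | h3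
    · rw [← h3]; simp
    · rw [← div_eq_mul_inv, div_le_iff₀ h3]
      calc _ ≤ 1 / 2 * (κ * kweight n s (P.2.1 - P.2.2) ^ 2 *
            |g (P.1, P.2.2) - g (P.1, P.2.1)|) := by gcongr
        _ = _ := by ring

end KernelForms

/-! ### The localized inequality with `𝓛ψ` -/

section LocalizedInequality

variable {n : ℕ} {s κ : ℝ} {K : ℝ → Space n → Space n → Space n → ℝ} {R r₀ M : ℝ}
  {ψ ψ₁ : Space n → ℝ}

/-- The part of the localized inequality that involves `𝓛ψ`. -/
theorem TaylorBound.ofReal_integral_phaseForm_le (hT : TaylorBound R r₀ M ψ)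
    (hK : IsKernel s κ K) (hκ : 0 < κ) (hs : 0 < s) (hs1 : s < 1) (hn : 1 ≤ n) (hR : 0 < R)
    (hψ : HasModerateGrowth s ψ) {D : Set (ℝ × Space n)} (hD : MeasurableSet D)
    (hDf : volume D ≠ ⊤) {G : (ℝ × Space n) × Space n → ℝ} (hGm : Measurable G)
    (hG : Integrable G) (hGw : MemLp (wdiff (kweight n s) G) 2)
    (hG0 : ∀ p v, p ∉ D ∨ R ≤ ‖v‖ → G (p, v) = 0) {η : ℝ × Space n → ℝ} (hη : Continuous η)
    (hη0 : ∀ p, 0 ≤ η p) (hη1 : ∀ p, η p ≤ 1) {L : ℝ≥0∞}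
    (hL : ∀ p ∈ D, ∀ v, ‖v‖ < R → ‖opL K p.1 p.2 ψ v‖ₑ ≤ L) :
    ENNReal.ofReal (-(1 / 2) * ∫ P, η P.1 * phaseForm K (fun x => ψ x.2) G P) ≤
      L * ∫⁻ x, ‖G x‖ₑ := by
  have hi : Integrable (phaseForm K (fun x => ψ x.2) G) :=
    hT.integrable_formIntegrand hK hκ hs hs1 hn hR hψ hD hDf hGm hG hGw hG0
  have hi' : Integrable fun P => η P.1 * phaseForm K (fun x => ψ x.2) G P := by
    refine hi.bdd_mul (c := 1) (by fun_prop) (Eventually.of_forall fun P => ?_)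
    rw [Real.norm_of_nonneg (hη0 _)]
    exact hη1 _
  rw [Measure.volume_eq_prod] at hi hi' hG
  have e1 : -(1 / 2) * ∫ P, η P.1 * phaseForm K (fun x => ψ x.2) G P =
      ∫ p, η p * ∫ v, G (p, v) * opL K p.1 p.2 ψ v := by
    rw [Measure.volume_eq_prod, integral_prod _ hi', ← integral_const_mul]
    refine integral_congr_ae ?_
    filter_upwards [hi.prod_right_ae, hG.prod_right_ae] with p hp1 hp2
    have h1 := hT.integral_formIntegrand hK hκ hs hs1 hn hR hψ p.1 p.2 hp2
      (fun v hv => hG0 p v (Or.inr hv)) hp1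
    simp only [integral_const_mul]
    change _ * (η p * ∫ q, formIntegrand K p.1 p.2 ψ (fun v => G (p, v)) q) = _
    rw [h1]; ring
  have e2 : ∀ x : (ℝ × Space n) × Space n, ‖G x‖ₑ * ‖opL K x.1.1 x.1.2 ψ x.2‖ₑ ≤ L * ‖G x‖ₑ :=
    fun x => by
      by_cases hx : x.1 ∈ D ∧ ‖x.2‖ < R
      · rw [mul_comm]; gcongr; exact hL _ hx.1 _ hx.2
      · rw [not_and_or, not_lt] at hx
        rw [hG0 x.1 x.2 hx]; simp
  rw [e1]
  calc _ ≤ ‖∫ p, η p * ∫ v, G (p, v) * opL K p.1 p.2 ψ v‖ₑ := Real.ofReal_le_enorm _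
    _ ≤ ∫⁻ p, ‖η p * ∫ v, G (p, v) * opL K p.1 p.2 ψ v‖ₑ := enorm_integral_le_lintegral_enorm _
    _ ≤ ∫⁻ p, ∫⁻ v, L * ‖G (p, v)‖ₑ := by
        refine lintegral_mono fun p => ?_
        rw [enorm_mul]
        have h1 : ‖η p‖ₑ ≤ 1 := by
          rw [Real.enorm_eq_ofReal (hη0 p)]
          exact ENNReal.ofReal_le_one.2 (hη1 p)
        refine (mul_le_of_le_one_left' h1).trans ((enorm_integral_le_lintegral_enorm _).trans ?_)
        refine lintegral_mono fun v => ?_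
        rw [enorm_mul]
        exact e2 (p, v)
    _ = L * ∫⁻ x, ‖G x‖ₑ := by
        rw [← lintegral_const_mul _ hGm.enorm]
        exact (lintegral_prod _ (hGm.enorm.const_mul L).aemeasurable).symm

/-- The localized energy inequality for a solution on a base set of finite measure. -/
theorem TaylorBound.localized_energy_le (hT : TaylorBound R r₀ M ψ)
    (hK : IsKernel s κ K) (hκ : 0 < κ) (hs : 0 < s) (hs1 : s < 1) (hn : 1 ≤ n) (hR : 0 < R)
    (hψ : HasModerateGrowth s ψ) (hψ₁c : Continuous ψ₁)
    (hψ₁M : ∀ v w, |ψ₁ v - ψ₁ w| ≤ M * ‖v - w‖)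
    {D O : Set (ℝ × Space n)} (hD : MeasurableSet D) (hDf : volume D ≠ ⊤) (hO : IsOpen O)
    (hOD : O ⊆ D) {F : (ℝ × Space n) × Space n → ℝ} (hF : Measurable F) (hF2 : MemLp F 2)
    (hFD : ∀ p v, p ∉ D → F (p, v) = 0) (hU : MemLp (wdiff (kweight n s) F) 2)
    (hFψ : ∀ p ∈ D, ∀ v, R ≤ ‖v‖ → ‖v‖ < R + r₀ → F (p, v) ≤ ψ₁ v)
    {A : (ℝ × Space n) × Space n → ℝ} (hA : Integrable A)
    (HW : ∀ φ : (ℝ × Space n) × Space n → ℝ, ContDiff ℝ ∞ φ → HasCompactSupport φ →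
      tsupport φ ⊆ O ×ˢ Metric.ball 0 (R + 2) →
      -∫ x, F x * fderiv ℝ φ x ((1, x.2), 0) =
        -((1 / 2) * ∫ P, phaseForm K F φ P) + ∫ x, A x * φ x)
    {η : ℝ × Space n → ℝ} (hη : ContDiff ℝ 1 η) (hηc : HasCompactSupport η) (hηO : tsupport η ⊆ O)
    (hη0 : ∀ p, 0 ≤ η p) (hη1 : ∀ p, η p ≤ 1) {Λ : ℝ} (hΛ0 : 0 ≤ Λ)
    (hΛ : ∀ p (v : Space n), ‖v‖ < R → fderiv ℝ η p (1, v) ≤ Λ) {L : ℝ≥0∞}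
    (hL : ∀ p ∈ D, ∀ v, ‖v‖ < R → ‖opL K p.1 p.2 ψ v‖ₑ ≤ L) :
    ENNReal.ofReal (∫ P, η P.1 * (1 / 2 * (phaseForm K F (posPartOn D R ψ₁ F) P -
        phaseForm K (fun x => ψ x.2) (posPartOn D R ψ₁ F) P))) ≤
      ENNReal.ofReal Λ * (∫⁻ x, ENNReal.ofReal (posPartOn D R ψ₁ F x ^ 2)) +
        (∫⁻ x, ‖A x‖ₑ * ‖posPartOn D R ψ₁ F x‖ₑ) + L * ∫⁻ x, ‖posPartOn D R ψ₁ F x‖ₑ := by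
  have hk := measurable_kweight (n := n) (s := s)
  have hκk := memLp_kweight hn hs hs1
  set G := posPartOn D R ψ₁ F with hG_def
  have hGm : Measurable G := measurable_posPartOn hD hψ₁c hF
  have hG2 : MemLp G 2 := memLp_posPartOn hD hDf hψ₁c hF hF2
  have hGw : MemLp (wdiff (kweight n s) G) 2 :=
    memLp_wdiff_posPartOn hk kweight_nonneg kweight_neg hκk hD hDf hψ₁c hF hF2 hU hT.nonneg hT.pos
      hψ₁M hFψ
  have hG0 : ∀ p v, p ∉ D ∨ R ≤ ‖v‖ → G (p, v) = 0 := fun p v => posPartOn_eq_zero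
  have hGi : Integrable G := integrable_posPartOn hD hDf hψ₁c hF hF2
  -- The field `F (1, v)` need not be integrable, so it is cut to velocities below `R + 2`. The test
  -- functions live there: the ball of radius `R`, enlarged by `1` in the mollification.
  set Fv : (ℝ × Space n) × Space n → ℝ × Space n :=
    (D ×ˢ Metric.ball (0 : Space n) (R + 2)).indicator fun x => F x • ((1 : ℝ), x.2) with hFv_def
  have hDB : MeasurableSet (D ×ˢ Metric.ball (0 : Space n) (R + 2)) :=
    hD.prod Metric.isOpen_ball.measurableSet
  have hFvm : Measurable Fv := (hF.smul (by fun_prop)).indicator hDB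
  have hFvi : Integrable Fv := by
    have h1 := hF2.integrable_mul
      (memLp_indicator_prod_ball (E := Space n) hD hDf (R + 2) (R + 3) (p := 2))
    refine h1.mono hFvm.aestronglyMeasurable (Eventually.of_forall fun x => ?_)
    rw [hFv_def]
    simp only [Pi.mul_apply]
    by_cases hx : x ∈ D ×ˢ Metric.ball (0 : Space n) (R + 2)
    · rw [indicator_of_mem hx, indicator_of_mem hx, norm_smul, norm_mul]
      refine mul_le_mul_of_nonneg_left ?_ (norm_nonneg _)
      have h2 := mem_ball_zero_iff.1 hx.2
      rw [Prod.norm_def, norm_one, Real.norm_of_nonneg (by linarith)]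
      exact max_le (by linarith) (by simpa using (by linarith : ‖x.2‖ ≤ R + 3))
    · rw [indicator_of_notMem hx, norm_zero]; exact norm_nonneg _
  have hFvF : ∀ p (v : Space n), ‖v‖ < R + 2 → Fv (p, v) = F (p, v) • ((1 : ℝ), v) :=
    fun p v hv => by
      by_cases hp : p ∈ D
      · rw [hFv_def, indicator_of_mem (by exact ⟨hp, mem_ball_zero_iff.2 hv⟩)]
      · rw [hFv_def, indicator_of_notMem fun h => hp h.1, hFD p v hp, zero_smul]
  have hmain := KineticNonlocal.localized_energy_le (R := R) (r₀ := r₀) (M := M) (ψ := ψ₁)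
    hO hOD hk kweight_nonneg kweight_neg hκk
    (dir := fun v : Space n => ((1 : ℝ), v)) (by fun_prop) hD hDf hF hF2 hU hT.nonneg hT.pos
    hFvi hFvm (fun p v hv => hFvF p v (by linarith)) hA (memLp_halfFlux hK hκ hs hF hU)
    (B := Metric.ball 0 (R + 2)) (fun φ hφ hφc hφs => ?_) hψ₁c hψ₁M hFψ
    (Metric.closedBall_subset_ball (by linarith)) hη hηc hηO hη0 hη1 hΛ0 hΛ
  · have hFG := integrable_phaseForm hK hκ hs hF hGm hU hGw
    have hψG : Integrable (phaseForm K (fun x => ψ x.2) G) :=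
      hT.integrable_formIntegrand hK hκ hs hs1 hn hR hψ hD hDf hGm hGi hGw hG0
    have hb : ∀ {u : (ℝ × Space n) × (Space n × Space n) → ℝ}, Integrable u →
        Integrable fun P => η P.1 * u P := fun hu => by
      have hηc := hη.continuous
      refine hu.bdd_mul (c := 1) (by fun_prop) (Eventually.of_forall fun P => ?_)
      rw [Real.norm_of_nonneg (hη0 _)]
      exact hη1 _
    have hL' := hT.ofReal_integral_phaseForm_le hK hκ hs hs1 hn hR hψ hD hDf hGm hGi hGw hG0
      hη.continuous hη0 hη1 hL
    have e : ∫ P, η P.1 * (1 / 2 * (phaseForm K F G P - phaseForm K (fun x => ψ x.2) G P)) =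
        (∫ P, η P.1 * (halfFlux s K F P * wdiff (kweight n s) G P)) +
          -(1 / 2) * ∫ P, η P.1 * phaseForm K (fun x => ψ x.2) G P := by
      simp_rw [halfFlux_mul_wdiff]
      rw [← integral_const_mul, ← integral_add (hb (hFG.const_mul _)) ((hb hψG).const_mul _)]
      exact integral_congr_ae (Eventually.of_forall fun P => by ring)
    rw [e]
    exact ENNReal.ofReal_add_le.trans (add_le_add hmain hL')
  · have h1 := HW φ hφ hφc hφs
    simp_rw [halfFlux_mul_wdiff]
    rw [integral_const_mul, ← h1]
    congr 1
    refine integral_congr_ae (Eventually.of_forall fun x => ?_)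
    by_cases hx : x ∈ tsupport φ
    · have h2 := mem_ball_zero_iff.1 (hφs hx).2
      have h3 := hFvF x.1 x.2 h2
      simp only
      rw [h3, ← smul_eq_mul, ← map_smul]
      congr 1
      simp
    · have h2 : fderiv ℝ φ x = 0 :=
        image_eq_zero_of_notMem_tsupport fun h => hx (tsupport_fderiv_subset ℝ h)
      simp [h2]

end LocalizedInequality

/-! ### From the solution to a representative on phase space -/

section PhaseSpace

variable {n : ℕ} {s κ : ℝ} {K : ℝ → Space n → Space n → Space n → ℝ} {R r₀ M : ℝ}
  {ψ ψ₁ : Space n → ℝ} {Q D : Set (ℝ × Space n)} {f : ℝ → Space n → Space n → ℝ}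

theorem measurePreserving_assoc_withVel (Q : Set (ℝ × Space n)) :
    MeasurePreserving (MeasurableEquiv.prodAssoc : (ℝ × Space n) × Space n ≃ᵐ ℝ × Space n × Space n)
      (volume.restrict (Q ×ˢ univ)) (volume.restrict (withVel Q)) := by
  have h := (volume_preserving_prodAssoc (α₁ := ℝ) (β₁ := Space n)
    (γ₁ := Space n)).restrict_preimage_emb MeasurableEquiv.prodAssoc.measurableEmbedding (withVel Q)
  have e : (MeasurableEquiv.prodAssoc : (ℝ × Space n) × Space n ≃ᵐ ℝ × Space n × Space n) ⁻¹'
      withVel Q = Q ×ˢ univ := by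
    ext x
    exact (and_iff_left (mem_univ _)).symm
  rwa [e] at h

theorem integral_withVel (Q : Set (ℝ × Space n)) (u : ℝ × Space n × Space n → ℝ) :
    ∫ p in withVel Q, u p = ∫ x in Q ×ˢ univ, u (x.1.1, x.1.2, x.2) :=
  ((measurePreserving_assoc_withVel Q).integral_comp
    MeasurableEquiv.prodAssoc.measurableEmbedding u).symm

theorem lintegral_withVel (Q : Set (ℝ × Space n)) (u : ℝ × Space n × Space n → ℝ≥0∞) :
    ∫⁻ p in withVel Q, u p = ∫⁻ x in Q ×ˢ univ, u (x.1.1, x.1.2, x.2) :=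
  ((measurePreserving_assoc_withVel Q).lintegral_comp_emb
    MeasurableEquiv.prodAssoc.measurableEmbedding u).symm

theorem ae_of_ae_withVel (hQ : MeasurableSet Q) {p : ℝ × Space n × Space n → Prop}
    (h : ∀ᵐ x ∂(volume.restrict (withVel Q)), p x) :
    ∀ᵐ x : (ℝ × Space n) × Space n, x.1 ∈ Q → p (x.1.1, x.1.2, x.2) := by
  have h1 := (measurePreserving_assoc_withVel Q).quasiMeasurePreserving.ae h
  rw [ae_restrict_iff' (hQ.prod MeasurableSet.univ)] at h1
  filter_upwards [h1] with x hx hxQ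
  exact hx ⟨hxQ, mem_univ _⟩

theorem lintegral_wdiff_sq (hs : 0 < s) {F : (ℝ × Space n) × Space n → ℝ} (hF : Measurable F) :
    ∫⁻ P, ‖wdiff (kweight n s) F P ^ 2‖ₑ = ∫⁻ p, gagliardoSq s fun v => F (p, v) := by
  have hm := measurable_wdiff (measurable_kweight (n := n) (s := s)) hF
  refine (lintegral_prod _ (hm.pow_const 2).enorm.aemeasurable).trans ?_
  refine lintegral_congr fun p => lintegral_congr fun q => ?_
  rw [Real.enorm_of_nonneg (sq_nonneg _), wdiff, mul_pow, kweight_sq hs]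

theorem gagliardoSq_congr {g h : Space n → ℝ} (hgh : g =ᵐ[volume] h) :
    gagliardoSq s g = gagliardoSq s h := by
  have h1 := Measure.quasiMeasurePreserving_fst (μ := (volume : Measure (Space n)))
    (ν := (volume : Measure (Space n))) |>.ae hgh
  have h2 := Measure.quasiMeasurePreserving_snd (μ := (volume : Measure (Space n)))
    (ν := (volume : Measure (Space n))) |>.ae hgh
  refine lintegral_congr_ae ?_
  filter_upwards [h1, h2] with q hq1 hq2
  rw [hq1, hq2]

theorem formB_congr_left {g h φ : Space n → ℝ} (hgh : g =ᵐ[volume] h) (t : ℝ) (x : Space n) :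
    formB K t x g φ = formB K t x h φ := by
  have h1 := Measure.quasiMeasurePreserving_fst (μ := (volume : Measure (Space n)))
    (ν := (volume : Measure (Space n))) |>.ae hgh
  have h2 := Measure.quasiMeasurePreserving_snd (μ := (volume : Measure (Space n)))
    (ν := (volume : Measure (Space n))) |>.ae hgh
  rw [formB, formB]
  congr 1
  refine integral_congr_ae ?_
  filter_upwards [h1, h2] with q hq1 hq2
  rw [formIntegrand, formIntegrand, hq1, hq2]

theorem ae_slice {p : (ℝ × Space n) × Space n → Prop} (h : ∀ᵐ x, x.1 ∈ D → p x) :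
    ∀ᵐ z : ℝ × Space n, z ∈ D → ∀ᵐ v, p (z, v) := by
  rw [Measure.volume_eq_prod] at h
  filter_upwards [Measure.ae_ae_of_ae_prod h] with z hz hzD
  exact hz.mono fun v hv => hv hzD

/-- A measurable representative of `f` on `D`, extended by zero, that obeys the bound by the
barrier in a shell everywhere rather than almost everywhere. -/
theorem MemL2Hs.exists_representative (hs : 0 < s) (hf : MemL2Hs s Q f) (hQ : MeasurableSet Q)
    (hD : MeasurableSet D) (hDQ : D ⊆ Q) (hψ₁ : Continuous ψ₁)
    (hle : ∀ᵐ x : (ℝ × Space n) × Space n, x.1 ∈ D → R ≤ ‖x.2‖ → ‖x.2‖ < R + r₀ →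
      f x.1.1 x.1.2 x.2 ≤ ψ₁ x.2) :
    ∃ F : (ℝ × Space n) × Space n → ℝ, Measurable F ∧ MemLp F 2 ∧ (∀ p v, p ∉ D → F (p, v) = 0) ∧
      MemLp (wdiff (kweight n s) F) 2 ∧
      (∀ p ∈ D, ∀ v, R ≤ ‖v‖ → ‖v‖ < R + r₀ → F (p, v) ≤ ψ₁ v) ∧
      ∀ᵐ x, x.1 ∈ D → F x = f x.1.1 x.1.2 x.2 := by
  have hDu : MeasurableSet (D ×ˢ (univ : Set (Space n))) := hD.prod MeasurableSet.univ
  have hQu : MeasurableSet (Q ×ˢ (univ : Set (Space n))) := hQ.prod MeasurableSet.univ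
  have h1 : MemLp (fun x : (ℝ × Space n) × Space n => f x.1.1 x.1.2 x.2) 2
      (volume.restrict (Q ×ˢ univ)) :=
    hf.1.comp_measurePreserving (measurePreserving_assoc_withVel Q)
  have h2 : MemLp (fun x : (ℝ × Space n) × Space n => f x.1.1 x.1.2 x.2) 2
      (volume.restrict (D ×ˢ univ)) :=
    h1.mono_measure (Measure.restrict_mono (prod_mono_left hDQ) le_rfl)
  obtain ⟨F₀, hF₀m, hF₀⟩ := h2.1
  have hF₀' : Measurable F₀ := hF₀m.measurable
  rw [Filter.EventuallyEq, ae_restrict_iff' hDu] at hF₀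
  -- Taking the minimum with the barrier in the shell changes the function only on a null set, and
  -- turns the almost everywhere bound into one that holds at every point.
  set F : (ℝ × Space n) × Space n → ℝ := (D ×ˢ univ).indicator fun x =>
    if R ≤ ‖x.2‖ ∧ ‖x.2‖ < R + r₀ then min (F₀ x) (ψ₁ x.2) else F₀ x with hF_def
  have hFm : Measurable F := by
    refine Measurable.indicator (Measurable.ite ?_ ?_ hF₀') hDu
    · exact (measurableSet_le measurable_const measurable_snd.norm).inter
        (measurableSet_lt measurable_snd.norm measurable_const)
    · exact hF₀'.min (by fun_prop)
  have hFf : ∀ᵐ x, x.1 ∈ D → F x = f x.1.1 x.1.2 x.2 := by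
    filter_upwards [hF₀, hle] with x hx hx2 hxD
    have hx' := hx ⟨hxD, mem_univ _⟩
    rw [hF_def, indicator_of_mem (by exact ⟨hxD, mem_univ _⟩)]
    split_ifs with h
    · rw [← hx', min_eq_left (hx2 hxD h.1 h.2)]
    · exact hx'.symm
  have hFD : ∀ p v, p ∉ D → F (p, v) = 0 := fun p v hp => by
    rw [hF_def, indicator_of_notMem fun h => hp h.1]
  refine ⟨F, hFm, ?_, hFD, ?_, fun p hp v hv1 hv2 => ?_, hFf⟩
  · have h3 := (memLp_indicator_iff_restrict hDu).2 h2
    refine h3.ae_eq ?_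
    filter_upwards [hFf] with x hx
    by_cases hxD : x.1 ∈ D
    · rw [indicator_of_mem (by exact ⟨hxD, mem_univ _⟩), hx hxD]
    · rw [indicator_of_notMem fun h => hxD h.1, hFD x.1 x.2 hxD]
  · have hm := measurable_wdiff (measurable_kweight (n := n) (s := s)) hFm
    refine (memLp_two_iff_integrable_sq hm.aestronglyMeasurable).2
      ⟨(hm.pow_const 2).aestronglyMeasurable, ?_⟩
    rw [HasFiniteIntegral, lintegral_wdiff_sq hs hFm]
    refine lt_of_le_of_lt ?_ hf.2
    rw [← lintegral_indicator hQ]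
    refine lintegral_mono_ae ?_
    filter_upwards [ae_slice hFf] with p hp
    by_cases hpD : p ∈ D
    · rw [indicator_of_mem (hDQ hpD), gagliardoSq_congr (hp hpD)]
    · have : gagliardoSq s (fun v => F (p, v)) = 0 := by
        simp [gagliardoSq, hFD p _ hpD]
      rw [this]; exact zero_le
  · rw [hF_def, indicator_of_mem (by exact ⟨hp, mem_univ _⟩), if_pos ⟨hv1, hv2⟩]
    exact min_le_right _ _

/-- The weak equation in terms of a representative on a smaller base set. -/
theorem IsWeakSolution.weak_eq_phaseForm (hK : IsKernel s κ K) (hκ : 0 < κ) (hs : 0 < s)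
    (hs1 : s < 1) (hn : 1 ≤ n) {a : ℝ × Space n × Space n → ℝ} (hf : IsWeakSolution s K a Q f)
    (hQ : MeasurableSet Q) (hDQ : D ⊆ Q) {O : Set (ℝ × Space n)} (hO : IsOpen O) (hOD : O ⊆ D)
    {F : (ℝ × Space n) × Space n → ℝ} (hF : Measurable F)
    (hU : MemLp (wdiff (kweight n s) F) 2) (hFf : ∀ᵐ x, x.1 ∈ D → F x = f x.1.1 x.1.2 x.2)
    {φ : (ℝ × Space n) × Space n → ℝ} (hφ : ContDiff ℝ ∞ φ) (hφc : HasCompactSupport φ) {ρ : ℝ}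
    (hφO : tsupport φ ⊆ O ×ˢ Metric.ball 0 ρ) :
    -∫ x, F x * fderiv ℝ φ x ((1, x.2), 0) = -((1 / 2) * ∫ P, phaseForm K F φ P) +
      ∫ x, (D ×ˢ Metric.ball 0 ρ).indicator (fun x => a (x.1.1, x.1.2, x.2)) x * φ x := by
  have hQu : MeasurableSet (Q ×ˢ (univ : Set (Space n))) := hQ.prod MeasurableSet.univ
  set e : (ℝ × Space n × Space n) ≃L[ℝ] ((ℝ × Space n) × Space n) :=
    (ContinuousLinearEquiv.prodAssoc ℝ ℝ (Space n) (Space n)).symm with he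
  have hea : ∀ p, e p = ((p.1, p.2.1), p.2.2) := fun p => rfl
  have hts : tsupport (φ ∘ e) = e ⁻¹' tsupport φ := tsupport_comp_eq_preimage φ e.toHomeomorph
  have h1 := hf.weak_eq (φ ∘ e) (hφ.comp e.contDiff) (hφc.comp_homeomorph e.toHomeomorph)
    (by
      rw [hts]
      exact fun p hp => (hO.subset_interior_iff.2 (hOD.trans hDQ)) (hφO hp).1)
  have htr : ∀ x : (ℝ × Space n) × Space n, transport (φ ∘ e) (x.1.1, x.1.2, x.2) =
      fderiv ℝ φ x ((1, x.2), 0) := fun x => by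
    rw [transport, e.comp_right_fderiv]
    rfl
  have hφ0 : ∀ x : (ℝ × Space n) × Space n, x ∉ D ×ˢ Metric.ball (0 : Space n) ρ →
      x ∉ tsupport φ := fun x hx h => hx ⟨hOD (hφO h).1, (hφO h).2⟩
  have hφz : ∀ x : (ℝ × Space n) × Space n, x ∉ D ×ˢ Metric.ball (0 : Space n) ρ → φ x = 0 :=
    fun x hx => image_eq_zero_of_notMem_tsupport (hφ0 x hx)
  rw [integral_withVel, integral_withVel, ← integral_indicator hQu, ← integral_indicator hQu,
    ← integral_indicator hQ] at h1
  have e1 : ∫ x, (Q ×ˢ univ).indicator (fun x : (ℝ × Space n) × Space n =>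
      f x.1.1 x.1.2 x.2 * transport (φ ∘ e) (x.1.1, x.1.2, x.2)) x =
      ∫ x, F x * fderiv ℝ φ x ((1, x.2), 0) := by
    refine integral_congr_ae ?_
    filter_upwards [hFf] with x hx
    by_cases hxD : x ∈ D ×ˢ Metric.ball (0 : Space n) ρ
    · rw [indicator_of_mem (by exact ⟨hDQ hxD.1, mem_univ _⟩), hx hxD.1, htr]
    · have h2 : fderiv ℝ φ x = 0 :=
        image_eq_zero_of_notMem_tsupport fun h => hφ0 x hxD (tsupport_fderiv_subset ℝ h)
      simp [indicator, htr, h2]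
  have e2 : ∫ x, (Q ×ˢ univ).indicator (fun x : (ℝ × Space n) × Space n =>
      a (x.1.1, x.1.2, x.2) * (φ ∘ e) (x.1.1, x.1.2, x.2)) x =
      ∫ x, (D ×ˢ Metric.ball 0 ρ).indicator (fun x => a (x.1.1, x.1.2, x.2)) x * φ x := by
    refine integral_congr_ae (Eventually.of_forall fun x => ?_)
    have h2 : (φ ∘ e) (x.1.1, x.1.2, x.2) = φ x := rfl
    by_cases hxD : x ∈ D ×ˢ Metric.ball (0 : Space n) ρ
    · simp only
      rw [indicator_of_mem (by exact ⟨hDQ hxD.1, mem_univ _⟩), indicator_of_mem hxD, h2]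
    · simp only [indicator, h2, hφz x hxD, mul_zero, ite_self]
  have e3 : ∫ p, Q.indicator (fun p => formB K p.1 p.2 (f p.1 p.2)
      fun v => (φ ∘ e) (p.1, p.2, v)) p = (1 / 2) * ∫ P, phaseForm K F φ P := by
    -- Finite energy of `φ` makes the double form integrable, so the iterated integral of `formB` is
    -- an integral over the whole space.
    have hφw := memLp_wdiff_of_contDiff (measurable_kweight (n := n) (s := s)) kweight_nonneg
      kweight_neg (memLp_kweight hn hs hs1) hφ hφc
    have hi := integrable_phaseForm hK hκ hs hF hφ.continuous.measurable hU hφw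
    have e4 : ∫ P, phaseForm K F φ P = ∫ p, ∫ q, phaseForm K F φ (p, q) := integral_prod _ hi
    rw [e4, ← integral_const_mul]
    refine integral_congr_ae ?_
    filter_upwards [ae_slice hFf] with p hp
    by_cases hpD : p ∈ D
    · rw [indicator_of_mem (hDQ hpD), ← formB_congr_left (hp hpD)]
      rfl
    · have h2 : ∀ v, φ (p, v) = 0 := fun v => hφz _ fun h => hpD h.1
      have h3 : ∀ v, (φ ∘ e) (p.1, p.2, v) = 0 := h2
      simp only [indicator, formB, phaseForm, formIntegrand, h2, h3, sub_zero, mul_zero,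
        integral_zero, ite_self]
  rw [← e1, ← e2, ← e3]
  exact h1

end PhaseSpace

/-! ### Removal of the cutoffs and the energy inequality -/

section Conclusion

theorem ofReal_setIntegral_le_of_cutoffs {V Y : Type*} [MeasureSpace V] [MeasureSpace Y]
    [SFinite (volume : Measure V)] [SFinite (volume : Measure Y)] {D Q' : Set V}
    (hQ' : MeasurableSet Q') {σ : V × Y → ℝ} (hσ : Integrable σ)
    (hσ0 : ∀ᵐ P, P.1 ∈ D → 0 ≤ σ P) {η : ℕ → V → ℝ} (hηm : ∀ k, Measurable (η k))
    (hη0 : ∀ k p, 0 ≤ η k p) (hη1 : ∀ k p, η k p ≤ 1) (hηD : ∀ k p, p ∉ D → η k p = 0)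
    (hηt : ∀ᵐ p, p ∈ Q' → ∀ᶠ k in atTop, η k p = 1) {B : ℝ≥0∞}
    (hB : ∀ k, ENNReal.ofReal (∫ P, η k P.1 * σ P) ≤ B) :
    ENNReal.ofReal (∫ P in Q' ×ˢ univ, σ P) ≤ B := by
  have hQu : MeasurableSet (Q' ×ˢ (univ : Set Y)) := hQ'.prod MeasurableSet.univ
  have hb : ∀ k P, ‖η k P.1 * σ P‖ ≤ ‖σ P‖ := fun k P => by
    rw [norm_mul, Real.norm_of_nonneg (hη0 k _)]
    exact mul_le_of_le_one_left (norm_nonneg _) (hη1 k _)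
  have hm : ∀ k, AEStronglyMeasurable fun P : V × Y => η k P.1 * σ P := fun k =>
    ((hηm k).comp measurable_fst).aestronglyMeasurable.mul hσ.1
  have hi : ∀ k, Integrable fun P : V × Y => η k P.1 * σ P := fun k =>
    hσ.mono (hm k) (Eventually.of_forall (hb k))
  have hlim : Tendsto (fun k => ∫ P in Q' ×ˢ univ, η k P.1 * σ P) atTop
      (𝓝 (∫ P in Q' ×ˢ univ, σ P)) := by
    refine tendsto_integral_of_dominated_convergence (fun P => ‖σ P‖) (fun k => (hm k).restrict)
      hσ.norm.integrableOn (fun k => Eventually.of_forall (hb k)) ?_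
    have h1 : ∀ᵐ P : V × Y, P.1 ∈ Q' → ∀ᶠ k in atTop, η k P.1 = 1 :=
      (Measure.quasiMeasurePreserving_fst (μ := (volume : Measure V))
        (ν := (volume : Measure Y))).ae hηt
    filter_upwards [ae_restrict_of_ae h1, ae_restrict_mem hQu] with P hP hPQ
    refine tendsto_const_nhds.congr' ?_
    filter_upwards [hP hPQ.1] with k hk
    rw [hk, one_mul]
  refine le_of_tendsto ((ENNReal.continuous_ofReal.tendsto _).comp hlim)
    (Eventually.of_forall fun k => ?_)
  -- The sign of `σ` on `D` is used here: the cutoff integral outside `Q'` is nonnegative and may be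
  -- dropped.
  refine (ENNReal.ofReal_le_ofReal (setIntegral_le_integral (hi k) ?_)).trans (hB k)
  filter_upwards [hσ0] with P hP
  by_cases hPD : P.1 ∈ D
  · exact mul_nonneg (hη0 k _) (hP hPD)
  · simp [hηD k _ hPD]

variable {n : ℕ} {s κ : ℝ} {K : ℝ → Space n → Space n → Space n → ℝ} {R r₀ M : ℝ}
  {ψ ψ₁ : Space n → ℝ} {Q D : Set (ℝ × Space n)} {f : ℝ → Space n → Space n → ℝ}
  {F : (ℝ × Space n) × Space n → ℝ}

theorem minusPart_eq (f : ℝ → Space n → Space n → ℝ) (ψ : Space n → ℝ) (t : ℝ) (x v : Space n) :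
    minusPart f ψ t x v = plusPart f ψ t x v + ψ v - f t x v := by
  rw [minusPart, plusPart]
  rcases le_total (f t x v) (ψ v) with h | h
  · rw [max_eq_left (by linarith), max_eq_right (by linarith)]; ring
  · rw [max_eq_right (by linarith), max_eq_left (by linarith)]; ring

theorem plusPart_mul_minusPart (f : ℝ → Space n → Space n → ℝ) (ψ : Space n → ℝ) (t : ℝ)
    (x v : Space n) : plusPart f ψ t x v * minusPart f ψ t x v = 0 := by
  rw [minusPart, plusPart]
  rcases le_total (f t x v) (ψ v) with h | h
  · rw [max_eq_right (by linarith : f t x v - ψ v ≤ 0), zero_mul]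
  · rw [max_eq_right (by linarith : ψ v - f t x v ≤ 0), mul_zero]

/-- The barrier condition makes `f₊` vanish outside the ball, so the cut at `|v| = R` loses nothing.
-/
theorem ae_posPartOn_eq (hr₀ : 0 < r₀) (hψ₁ : ∀ v, ‖v‖ < R + r₀ → ψ₁ v = ψ v)
    (hFf : ∀ᵐ x, x.1 ∈ D → F x = f x.1.1 x.1.2 x.2)
    (hle : ∀ᵐ x : (ℝ × Space n) × Space n, x.1 ∈ D → R ≤ ‖x.2‖ → f x.1.1 x.1.2 x.2 ≤ ψ x.2) :
    ∀ᵐ x, x.1 ∈ D → posPartOn D R ψ₁ F x = plusPart f ψ x.1.1 x.1.2 x.2 := by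
  filter_upwards [hFf, hle] with x hx hx2 hxD
  rw [posPartOn_of_mem hxD, posTrunc, plusPart]
  split_ifs with h
  · rw [hψ₁ _ (by linarith), hx hxD]
  · rw [max_eq_right (by linarith [hx2 hxD (not_lt.1 h)])]

/-- Bilinearity applied to `f₋ = f₊ + ψ - f`. The right-hand sides involve only forms already known
to be integrable; in particular `f₋` itself need not have finite energy. -/
theorem ae_formIntegrand_eq (hFf : ∀ᵐ x, x.1 ∈ D → F x = f x.1.1 x.1.2 x.2)
    {G : (ℝ × Space n) × Space n → ℝ}
    (hG : ∀ᵐ x, x.1 ∈ D → G x = plusPart f ψ x.1.1 x.1.2 x.2) :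
    ∀ᵐ P : (ℝ × Space n) × (Space n × Space n), P.1 ∈ D →
      formIntegrand K P.1.1 P.1.2 (plusPart f ψ P.1.1 P.1.2) (plusPart f ψ P.1.1 P.1.2) P.2 =
        phaseForm K G G P ∧
      formIntegrand K P.1.1 P.1.2 (plusPart f ψ P.1.1 P.1.2) (minusPart f ψ P.1.1 P.1.2) P.2 =
        phaseForm K G G P - (phaseForm K F G P - phaseForm K (fun x => ψ x.2) G P) := by
  filter_upwards [ae_both_velocities hFf, ae_both_velocities hG] with P hF hG hD
  simp only [phaseForm, formIntegrand, minusPart_eq, hF.1 hD, hF.2 hD, hG.1 hD, hG.2 hD]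
  constructor
  · trivial
  · ring

/-- Since `f₊ f₋ = 0` pointwise, the mixed product of differences reduces to `-f₊(v) f₋(w) - f₊(w)
f₋(v)`, which is nonpositive. -/
theorem formIntegrand_sub_nonneg (hK : IsKernel s κ K) (hκ : 0 < κ)
    (f : ℝ → Space n → Space n → ℝ) (ψ : Space n → ℝ) (t : ℝ) (x : Space n)
    (q : Space n × Space n) :
    0 ≤ formIntegrand K t x (plusPart f ψ t x) (plusPart f ψ t x) q -
      formIntegrand K t x (plusPart f ψ t x) (minusPart f ψ t x) q := by
  rw [formIntegrand, formIntegrand, ← mul_sub]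
  by_cases hq : q.1 = q.2
  · simp [hq]
  · refine mul_nonneg (hK.nonneg hκ hq) ?_
    have h1 := plusPart_mul_minusPart f ψ t x q.1
    have h2 := plusPart_mul_minusPart f ψ t x q.2
    have p1 : 0 ≤ plusPart f ψ t x q.1 := le_max_right _ _
    have p2 : 0 ≤ plusPart f ψ t x q.2 := le_max_right _ _
    have m1 : 0 ≤ minusPart f ψ t x q.1 := le_max_right _ _
    have m2 : 0 ≤ minusPart f ψ t x q.2 := le_max_right _ _
    have h3 := mul_nonneg p1 m2
    have h4 := mul_nonneg p2 m1
    have h5 := sq_nonneg (plusPart f ψ t x q.2 - plusPart f ψ t x q.1)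
    nlinarith

theorem setIntegral_formB {Q' : Set (ℝ × Space n)} {g h : ℝ → Space n → Space n → ℝ}
    (hi : IntegrableOn (fun z : (ℝ × Space n) × (Space n × Space n) =>
      formIntegrand K z.1.1 z.1.2 (g z.1.1 z.1.2) (h z.1.1 z.1.2) z.2) (Q' ×ˢ univ)) :
    ∫ p in Q', formB K p.1 p.2 (g p.1 p.2) (h p.1 p.2) =
      ∫ z in Q' ×ˢ univ,
        1 / 2 * formIntegrand K z.1.1 z.1.2 (g z.1.1 z.1.2) (h z.1.1 z.1.2) z.2 := by
  have h1 := setIntegral_prod (μ := (volume : Measure (ℝ × Space n)))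
    (ν := (volume : Measure (Space n × Space n))) _ hi
  rw [integral_const_mul]
  refine Eq.trans ?_ (congrArg (1 / 2 * ·) h1.symm)
  simp only [formB, integral_const_mul, Measure.restrict_univ]

/-- Absolute convergence and the energy inequality on `Q'`, in terms of a truncated cylinder `D`
with cutoff functions. -/
theorem IsWeakSolution.energy_inequality (hK : IsKernel s κ K) (hκ : 0 < κ) (hs : 0 < s)
    (hs1 : s < 1) (hn : 1 ≤ n) (hR : 0 < R) (hT : TaylorBound R r₀ M ψ)
    (hψ : HasModerateGrowth s ψ) {a : ℝ × Space n × Space n → ℝ} (hf : IsWeakSolution s K a Q f)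
    (hQ : MeasurableSet Q) (hD : MeasurableSet D) (hDf : volume D ≠ ⊤) (hDQ : D ⊆ Q)
    {O : Set (ℝ × Space n)} (hO : IsOpen O) (hOD : O ⊆ D) {r r' : ℝ≥0∞}
    (hr : ENNReal.HolderConjugate r r') (ha : MemLp a r (volume.restrict (withVel Q)))
    (hle : ∀ᵐ p ∂(volume.restrict (withVel Q)), R ≤ ‖p.2.2‖ → f p.1 p.2.1 p.2.2 ≤ ψ p.2.2)
    {Q' : Set (ℝ × Space n)} (hQ' : MeasurableSet Q') (hQD : Q' ⊆ D) {Λ : ℝ} (hΛ0 : 0 ≤ Λ)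
    {η : ℕ → ℝ × Space n → ℝ} (hη : ∀ k, ContDiff ℝ ∞ (η k)) (hηc : ∀ k, HasCompactSupport (η k))
    (hηO : ∀ k, tsupport (η k) ⊆ O) (hη0 : ∀ k p, 0 ≤ η k p) (hη1 : ∀ k p, η k p ≤ 1)
    (hΛ : ∀ k p (v : Space n), ‖v‖ < R → fderiv ℝ (η k) p (1, v) ≤ Λ)
    (hηt : ∀ᵐ p, p ∈ Q' → ∀ᶠ k in atTop, η k p = 1) :
    IntegrableOn (fun z : (ℝ × Space n) × (Space n × Space n) =>
      formIntegrand K z.1.1 z.1.2 (plusPart f ψ z.1.1 z.1.2) (plusPart f ψ z.1.1 z.1.2) z.2)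
      (Q' ×ˢ univ) ∧
    IntegrableOn (fun z : (ℝ × Space n) × (Space n × Space n) =>
      formIntegrand K z.1.1 z.1.2 (plusPart f ψ z.1.1 z.1.2) (minusPart f ψ z.1.1 z.1.2) z.2)
      (Q' ×ˢ univ) ∧
    ENNReal.ofReal ((∫ p in Q', formB K p.1 p.2 (plusPart f ψ p.1 p.2) (plusPart f ψ p.1 p.2)) -
        ∫ p in Q', formB K p.1 p.2 (plusPart f ψ p.1 p.2) (minusPart f ψ p.1 p.2)) ≤
      ENNReal.ofReal Λ *
          (∫⁻ p in withVel Q, ENNReal.ofReal (plusPart f ψ p.1 p.2.1 p.2.2 ^ 2)) +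
        eLpNorm a r (volume.restrict (withVel Q)) *
          eLpNorm (fun p : ℝ × Space n × Space n => plusPart f ψ p.1 p.2.1 p.2.2) r'
            (volume.restrict (withVel Q)) +
        supL K Q R ψ *
          ∫⁻ p in withVel Q, ENNReal.ofReal (plusPart f ψ p.1 p.2.1 p.2.2) := by
  have hM := hT.nonneg
  -- The barrier is Lipschitz only near the ball. A global Lipschitz extension serves the truncation
  -- estimates, while the original `ψ` stays in `𝓛ψ`, which sees its values everywhere.
  obtain ⟨ψ₁, hψ₁L, hψ₁E⟩ := LipschitzOnWith.extend_real (K := M.toNNReal) (f := ψ)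
    (s := Metric.ball 0 (R + r₀)) (LipschitzOnWith.of_dist_le_mul fun v hv w hw => by
      rw [Real.dist_eq, dist_eq_norm, Real.coe_toNNReal _ hM]
      exact hT.lip v w (mem_ball_zero_iff.1 hv) (mem_ball_zero_iff.1 hw))
  have hψ₁ : ∀ v, ‖v‖ < R + r₀ → ψ₁ v = ψ v := fun v hv => (hψ₁E (mem_ball_zero_iff.2 hv)).symm
  have hψ₁M : ∀ v w, |ψ₁ v - ψ₁ w| ≤ M * ‖v - w‖ := fun v w => by
    have := hψ₁L.dist_le_mul v w
    rwa [Real.dist_eq, dist_eq_norm, Real.coe_toNNReal _ hM] at this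
  have hleD : ∀ᵐ x : (ℝ × Space n) × Space n, x.1 ∈ D → R ≤ ‖x.2‖ →
      f x.1.1 x.1.2 x.2 ≤ ψ x.2 := by
    filter_upwards [ae_of_ae_withVel hQ hle] with x hx hxD
    exact hx (hDQ hxD)
  obtain ⟨F, hF, hF2, hFD, hU, hFψ, hFf⟩ := hf.memL2Hs.exists_representative (R := R) (r₀ := r₀)
    hs hQ hD hDQ hψ₁L.continuous (by
      filter_upwards [hleD] with x hx hxD h1 h2
      rw [hψ₁ _ h2]
      exact hx hxD h1)
  set G := posPartOn D R ψ₁ F with hG_def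
  have hGf : ∀ᵐ x, x.1 ∈ D → G x = plusPart f ψ x.1.1 x.1.2 x.2 :=
    ae_posPartOn_eq hT.pos hψ₁ hFf hleD
  have hGz : ∀ x : (ℝ × Space n) × Space n, x.1 ∉ D → G x = 0 := fun x hx =>
    posPartOn_eq_zero (Or.inl hx)
  have hGm : Measurable G := measurable_posPartOn hD hψ₁L.continuous hF
  have hGi : Integrable G := integrable_posPartOn hD hDf hψ₁L.continuous hF hF2
  have hGw : MemLp (wdiff (kweight n s) G) 2 :=
    memLp_wdiff_posPartOn measurable_kweight kweight_nonneg kweight_neg (memLp_kweight hn hs hs1)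
      hD hDf hψ₁L.continuous hF hF2 hU hM hT.pos hψ₁M hFψ
  have hGG := integrable_phaseForm hK hκ hs hGm hGm hGw hGw
  have hFG := integrable_phaseForm hK hκ hs hF hGm hU hGw
  have hψG : Integrable (phaseForm K (fun x => ψ x.2) G) :=
    hT.integrable_formIntegrand hK hκ hs hs1 hn hR hψ hD hDf hGm hGi hGw
      fun p v => posPartOn_eq_zero
  have hforms := ae_formIntegrand_eq (K := K) hFf hGf
  have hQ'u : MeasurableSet (Q' ×ˢ (univ : Set (Space n × Space n))) := hQ'.prod MeasurableSet.univ
  have hformsQ' : ∀ᵐ P ∂(volume.restrict (Q' ×ˢ (univ : Set (Space n × Space n)))), _ :=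
    (ae_restrict_of_ae hforms).mp ((ae_restrict_mem hQ'u).mono fun P hP h => h (hQD hP.1))
  have hi1 : IntegrableOn (fun z : (ℝ × Space n) × (Space n × Space n) =>
      formIntegrand K z.1.1 z.1.2 (plusPart f ψ z.1.1 z.1.2) (plusPart f ψ z.1.1 z.1.2) z.2)
      (Q' ×ˢ univ) :=
    hGG.integrableOn.congr (hformsQ'.mono fun P hP => hP.1.symm)
  have hi2 : IntegrableOn (fun z : (ℝ × Space n) × (Space n × Space n) =>
      formIntegrand K z.1.1 z.1.2 (plusPart f ψ z.1.1 z.1.2) (minusPart f ψ z.1.1 z.1.2) z.2)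
      (Q' ×ˢ univ) :=
    (hGG.sub (hFG.sub hψG)).integrableOn.congr (hformsQ'.mono fun P hP => hP.2.symm)
  refine ⟨hi1, hi2, ?_⟩
  have hlhs : (∫ p in Q', formB K p.1 p.2 (plusPart f ψ p.1 p.2) (plusPart f ψ p.1 p.2)) -
      ∫ p in Q', formB K p.1 p.2 (plusPart f ψ p.1 p.2) (minusPart f ψ p.1 p.2) =
      ∫ P in Q' ×ˢ univ, 1 / 2 * (phaseForm K F G P - phaseForm K (fun x => ψ x.2) G P) := by
    rw [setIntegral_formB hi1, setIntegral_formB hi2,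
      ← integral_sub (hi1.const_mul (1 / 2)) (hi2.const_mul (1 / 2))]
    refine integral_congr_ae (hformsQ'.mono fun P hP => ?_)
    simp only
    rw [hP.1, hP.2]; ring
  have hBuQ : MeasurableSet (D ×ˢ Metric.ball (0 : Space n) (R + 2)) :=
    hD.prod Metric.isOpen_ball.measurableSet
  have hQu : MeasurableSet (Q ×ˢ (univ : Set (Space n))) := hQ.prod MeasurableSet.univ
  have haQ := ha.comp_measurePreserving (measurePreserving_assoc_withVel Q)
  -- On a set of finite measure `a` is integrable whatever the exponent `r ≥ 1`.
  set A : (ℝ × Space n) × Space n → ℝ :=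
    (D ×ˢ Metric.ball 0 (R + 2)).indicator fun x => a (x.1.1, x.1.2, x.2) with hA_def
  have hA : Integrable A := by
    rw [hA_def, integrable_indicator_iff hBuQ]
    have h1 : MemLp (fun x : (ℝ × Space n) × Space n => a (x.1.1, x.1.2, x.2)) r
        (volume.restrict (D ×ˢ Metric.ball 0 (R + 2))) :=
      haQ.mono_measure (Measure.restrict_mono (prod_mono hDQ (subset_univ _)) le_rfl)
    have : IsFiniteMeasure ((volume : Measure ((ℝ × Space n) × Space n)).restrict
        (D ×ˢ Metric.ball 0 (R + 2))) := by
      refine isFiniteMeasure_restrict.2 ?_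
      rw [Measure.volume_eq_prod, Measure.prod_prod]
      exact ENNReal.mul_ne_top hDf Metric.isBounded_ball.measure_lt_top.ne
    exact memLp_one_iff_integrable.1 (h1.mono_exponent hr.one_le)
  rw [hlhs]
  refine ofReal_setIntegral_le_of_cutoffs (D := D) (η := η) hQ' ((hFG.sub hψG).const_mul (1 / 2)) ?_
    (fun k => (hη k).continuous.measurable) hη0 hη1 (fun k p hp =>
      image_eq_zero_of_notMem_tsupport fun h => hp (hOD (hηO k h))) hηt fun k => ?_
  · filter_upwards [hforms] with P hP hPD
    have h1 := formIntegrand_sub_nonneg hK hκ f ψ P.1.1 P.1.2 P.2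
    rw [(hP hPD).1, (hP hPD).2, sub_sub_cancel] at h1
    exact mul_nonneg (by norm_num) h1
  refine (hT.localized_energy_le hK hκ hs hs1 hn hR hψ hψ₁L.continuous hψ₁M hD hDf hO hOD hF hF2
    hFD hU hFψ hA (fun φ hφ hφc hφs => hf.weak_eq_phaseForm hK hκ hs hs1 hn hQ hDQ hO hOD hF hU hFf
      hφ hφc hφs) ((hη k).of_le (by simp)) (hηc k) (hηO k) (hη0 k) (hη1 k) hΛ0 (hΛ k)
    (L := supL K Q R ψ) fun p hp v hv => ?_).trans ?_
  · exact le_iSup₂_of_le p (hDQ hp) (le_iSup₂_of_le v (mem_ball_zero_iff.2 hv) le_rfl)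
  have hp0 : ∀ t x v, 0 ≤ plusPart f ψ t x v := fun t x v => le_max_right _ _
  have hGq : ∀ᵐ x : (ℝ × Space n) × Space n, ‖G x‖ₑ ≤ (Q ×ˢ univ).indicator
      (fun x => ENNReal.ofReal (plusPart f ψ x.1.1 x.1.2 x.2)) x := by
    filter_upwards [hGf] with x hx
    by_cases hxD : x.1 ∈ D
    · rw [indicator_of_mem (by exact ⟨hDQ hxD, mem_univ _⟩), hx hxD,
        Real.enorm_of_nonneg (hp0 _ _ _)]
    · rw [hGz x hxD, enorm_zero]; exact zero_le
  refine add_le_add (add_le_add (mul_le_mul_right ?_ _) ?_) (mul_le_mul_right ?_ _)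
  · rw [lintegral_withVel, ← lintegral_indicator hQu]
    refine lintegral_mono_ae ?_
    filter_upwards [hGf] with x hx
    by_cases hxD : x.1 ∈ D
    · rw [indicator_of_mem (by exact ⟨hDQ hxD, mem_univ _⟩), ← hG_def, hx hxD]
    · simp [← hG_def, hGz x hxD]
  · have hfp : AEStronglyMeasurable (fun p : ℝ × Space n × Space n =>
        plusPart f ψ p.1 p.2.1 p.2.2) (volume.restrict (withVel Q)) := by
      have h1 : AEStronglyMeasurable (fun p : ℝ × Space n × Space n => ψ p.2.2)
          ((volume : Measure ℝ).prod ((volume : Measure (Space n)).prod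
            (volume : Measure (Space n)))) :=
        hψ.aestronglyMeasurable.comp_snd.comp_snd
      exact (hf.memL2Hs.1.1.sub h1.restrict).sup aestronglyMeasurable_const
    have h2 : ∫⁻ p in withVel Q, ‖a p‖ₑ * ‖plusPart f ψ p.1 p.2.1 p.2.2‖ₑ ≤
        eLpNorm a r (volume.restrict (withVel Q)) *
          eLpNorm (fun p : ℝ × Space n × Space n => plusPart f ψ p.1 p.2.1 p.2.2) r'
            (volume.restrict (withVel Q)) := by
      have h3 := eLpNorm_smul_le_mul_eLpNorm (r := 1) hfp ha.1 (hpqr := hr)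
      rw [eLpNorm_one_eq_lintegral_enorm] at h3
      simpa only [Pi.smul_apply', smul_eq_mul, enorm_mul] using h3
    refine le_trans ?_ h2
    rw [lintegral_withVel, ← lintegral_indicator hQu]
    refine lintegral_mono_ae ?_
    filter_upwards [hGf] with x hx
    by_cases hxD : x.1 ∈ D
    · rw [indicator_of_mem (by exact ⟨hDQ hxD, mem_univ _⟩), ← hG_def, hx hxD]
      gcongr
      exact enorm_indicator_le_enorm_self _ _
    · simp [← hG_def, hGz x hxD]
  · rw [lintegral_withVel, ← lintegral_indicator hQu]
    exact lintegral_mono_ae hGq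

end Conclusion

/-! ### The distance `δ` -/

section CylinderDist

variable {n : ℕ} {T S : ℝ} {Ω Ω' : Set (Space n)}

theorem ofReal_cylinderDist :
    ENNReal.ofReal (cylinderDist T S Ω Ω') =
      min (ENNReal.ofReal |T - S|) (⨅ x ∈ Ω', Metric.infEDist x Ωᶜ) :=
  ENNReal.ofReal_toReal (ne_top_of_le_ne_top ENNReal.ofReal_ne_top (min_le_left _ _))

/-- A compact set has a whole thickening inside the open set, which bounds the distance to the
complement from below. -/
theorem cylinderDist_pos (hTS : T < S) (hΩ : IsOpen Ω) (hΩ' : IsCompact Ω') (h : Ω' ⊆ Ω) :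
    0 < cylinderDist T S Ω Ω' := by
  rw [← ENNReal.ofReal_pos, ofReal_cylinderDist]
  refine lt_min (ENNReal.ofReal_pos.2 (abs_pos.2 (by linarith))) ?_
  obtain ⟨ε, hε, hεΩ⟩ := hΩ'.exists_thickening_subset_open hΩ h
  refine (ENNReal.ofReal_pos.2 hε).trans_le
    (le_iInf₂ fun x hx => Metric.le_infEDist.2 fun y hy => ?_)
  rw [edist_dist]
  refine ENNReal.ofReal_le_ofReal (not_lt.1 fun hlt => hy (hεΩ ?_))
  exact Metric.mem_thickening_iff.2 ⟨x, hx, by rwa [dist_comm]⟩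

theorem cylinderDist_le (hTS : T < S) : cylinderDist T S Ω Ω' ≤ S - T := by
  rw [← ENNReal.ofReal_le_ofReal_iff (by linarith), ofReal_cylinderDist]
  refine (min_le_left _ _).trans (ENNReal.ofReal_le_ofReal ?_)
  rw [abs_of_neg (by linarith)]
  linarith

theorem mem_of_dist_lt_cylinderDist {x y : Space n} (hx : x ∈ Ω')
    (hxy : dist x y < cylinderDist T S Ω Ω') : y ∈ Ω := by
  by_contra hy
  have h1 : Metric.infEDist x Ωᶜ ≤ edist x y := Metric.infEDist_le_edist_of_mem hy
  have h2 : edist x y < ENNReal.ofReal (cylinderDist T S Ω Ω') := by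
    rw [edist_dist]
    exact (ENNReal.ofReal_lt_ofReal_iff (dist_nonneg.trans_lt hxy)).2 hxy
  rw [ofReal_cylinderDist] at h2
  have h3 := (min_le_right (ENNReal.ofReal |T - S|) _).trans
    (iInf₂_le (f := fun x _ => Metric.infEDist x Ωᶜ) x hx)
  exact absurd (h2.trans_le h3) (not_lt.2 h1)

end CylinderDist

end KineticNonlocal

/-! ### The energy inequality -/

open KineticNonlocal in
theorem lemma2p2 (n : ℕ) (s κ : ℝ) (hs0 : 0 < s) (hs1 : s < 1) (hκ : 1 < κ)
    (hsn : 2 * s < (n : ℝ)) :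
    ∃ C : ℝ, 0 < C ∧
      ∀ (K : ℝ → Space n → Space n → Space n → ℝ), IsKernel s κ K →
      ∀ (T S : ℝ), T < S → S < 0 →
      ∀ (Ω Ω' : Set (Space n)), IsOpen Ω → IsCompact Ω' → Ω' ⊆ Ω →
      ∀ (R : ℝ), 0 < R →
      ∀ (ψ : Space n → ℝ), IsC11NearBall R ψ → HasModerateGrowth s ψ →
      ∀ (Q Q' : Set (ℝ × Space n)), Q = Ioc T 0 ×ˢ Ω → Q' = Icc S 0 ×ˢ Ω' →
      ∀ (r r' : ℝ≥0∞), ENNReal.HolderConjugate r r' →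
      ∀ (a : ℝ × Space n × Space n → ℝ), MemLp a r (volume.restrict (withVel Q)) →
      ∀ (f : ℝ → Space n → Space n → ℝ), IsWeakSolution s K a Q f →
      (∀ᵐ p ∂(volume.restrict (withVel Q)), R ≤ ‖p.2.2‖ → f p.1 p.2.1 p.2.2 ≤ ψ p.2.2) →
      ∀ (fp fm : ℝ → Space n → Space n → ℝ), fp = plusPart f ψ → fm = minusPart f ψ →
      ∀ δ : ℝ, δ = cylinderDist T S Ω Ω' →
      -- the principal value that defines `𝓛ψ` exists
      (∀ t x v, ‖v‖ < R → Tendsto (truncL K t x ψ v) (𝓝[>] 0) (𝓝 (opL K t x ψ v))) ∧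
      -- both integrals on the left-hand side converge absolutely
      IntegrableOn (fun z : (ℝ × Space n) × (Space n × Space n) =>
        formIntegrand K z.1.1 z.1.2 (fp z.1.1 z.1.2) (fp z.1.1 z.1.2) z.2) (Q' ×ˢ univ) ∧
      IntegrableOn (fun z : (ℝ × Space n) × (Space n × Space n) =>
        formIntegrand K z.1.1 z.1.2 (fp z.1.1 z.1.2) (fm z.1.1 z.1.2) z.2) (Q' ×ˢ univ) ∧
      -- the energy inequality
      ENNReal.ofReal ((∫ p in Q', formB K p.1 p.2 (fp p.1 p.2) (fp p.1 p.2)) -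
          ∫ p in Q', formB K p.1 p.2 (fp p.1 p.2) (fm p.1 p.2)) ≤
        ENNReal.ofReal (C / δ) *
          (ENNReal.ofReal (max R 1) *
              (∫⁻ p in withVel Q, ENNReal.ofReal (fp p.1 p.2.1 p.2.2 ^ 2)) +
            ENNReal.ofReal (max δ 1) *
              (supL K Q R ψ * (∫⁻ p in withVel Q, ENNReal.ofReal (fp p.1 p.2.1 p.2.2)) +
                eLpNorm a r (volume.restrict (withVel Q)) *
                  eLpNorm (fun p : ℝ × Space n × Space n => fp p.1 p.2.1 p.2.2) r'
                    (volume.restrict (withVel Q)))) := by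
  have hn : 1 ≤ n := by
    have : (0 : ℝ) < n := by linarith
    exact_mod_cast this
  have hκ0 : 0 < κ := by linarith
  -- The constant is that of the cutoff gradient, `4 / δ`; it depends on neither the kernel nor the
  -- dimension.
  refine ⟨4, by norm_num, ?_⟩
  rintro K hK T S hTS hS Ω Ω' hΩ hΩ' hΩΩ R hR ψ hψ1 hψ Q Q' hQ hQ' r r' hr a ha f hf hle fp fm rfl
    rfl δ hδ
  obtain ⟨r₀, M, hT⟩ := hψ1.exists_taylorBound hR
  refine ⟨fun t x v hv => hT.tendsto_truncL hK hκ0 hs0 hs1 hn hR hψ t x hv, ?_⟩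
  -- The distance `infDist` to the empty set is zero by convention, so the cutoff construction needs
  -- a point in the set; the empty case is trivial, as the left-hand side vanishes.
  rcases Ω'.eq_empty_or_nonempty with he | hne
  · rw [hQ', he, prod_empty]
    simp
  have hδ0 : 0 < δ := hδ ▸ cylinderDist_pos hTS hΩ hΩ' hΩΩ
  obtain ⟨Z, hZ, hZΩ, hΩZ, η, hη⟩ := exists_transport_cutoffs (T := T) (S := S) hΩ' hne hδ0
    (hδ ▸ cylinderDist_le hTS)
    (fun x hx y hxy => mem_of_dist_lt_cylinderDist (T := T) (S := S) hx (hδ ▸ hxy)) R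
  -- `Ω` may have infinite measure, so the argument runs on its intersection with a ball containing
  -- the supports of all cutoffs.
  obtain ⟨ρ, hρ⟩ := hZ.isBounded.subset_ball (0 : Space n)
  have hball : IsOpen (Ω ∩ Metric.ball 0 ρ) := hΩ.inter Metric.isOpen_ball
  have hDf : volume (Ioc T 0 ×ˢ (Ω ∩ Metric.ball (0 : Space n) ρ)) ≠ ⊤ := by
    rw [Measure.volume_eq_prod, Measure.prod_prod]
    exact ENNReal.mul_ne_top (by simp)
      (Metric.isBounded_ball.subset inter_subset_right).measure_lt_top.ne
  have hηt : ∀ᵐ p : ℝ × Space n, p ∈ Q' → ∀ᶠ k in atTop, η k p = 1 := by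
    -- All cutoffs vanish at `t = 0`, but this is a null set in `Q̄`.
    have h1 : ∀ᵐ p : ℝ × Space n, p.1 ≠ 0 :=
      (Measure.quasiMeasurePreserving_fst (μ := (volume : Measure ℝ))
        (ν := (volume : Measure (Space n)))).ae (Measure.ae_ne volume 0)
    filter_upwards [h1] with p hp hpQ
    rw [hQ'] at hpQ
    have hp0 : p.1 < 0 := lt_of_le_of_ne hpQ.1.2 hp
    have h2 : Tendsto (fun k : ℕ => -2 / ((k : ℝ) + 1)) atTop (𝓝 0) :=
      Tendsto.div_atTop tendsto_const_nhds
        (tendsto_atTop_add_const_right _ _ tendsto_natCast_atTop_atTop)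
    filter_upwards [h2.eventually (lt_mem_nhds hp0)] with k hk
    exact (hη k).2.2.2.2.2.2 p.1 p.2 hpQ.1.1 hk.le hpQ.2
  have hΛ0 : 0 ≤ 4 / δ * max R 1 := by positivity
  obtain ⟨h1, h2, h3⟩ := hf.energy_inequality (D := Ioc T 0 ×ˢ (Ω ∩ Metric.ball 0 ρ))
    (O := Ioo T 0 ×ˢ (Ω ∩ Metric.ball 0 ρ)) (Q' := Q') (η := η) hK hκ0 hs0 hs1 hn hR hT hψ
    (hQ ▸ measurableSet_Ioc.prod hΩ.measurableSet) (measurableSet_Ioc.prod hball.measurableSet) hDf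
    (hQ ▸ prod_mono_right inter_subset_left) (isOpen_Ioo.prod hball)
    (prod_mono_left Ioo_subset_Ioc_self) hr ha hle
    (hQ' ▸ measurableSet_Icc.prod hΩ'.isClosed.measurableSet)
    (hQ' ▸ prod_mono (fun t ht => ⟨hTS.trans_le ht.1, ht.2⟩) fun x hx =>
      ⟨hΩΩ hx, hρ (hΩZ hx)⟩) hΛ0 (fun k => (hη k).1) (fun k => (hη k).2.1)
    (fun k => (hη k).2.2.1.trans (prod_mono_right fun x hx => ⟨hZΩ hx, hρ hx⟩))
    (fun k => (hη k).2.2.2.1) (fun k => (hη k).2.2.2.2.1) (fun k => (hη k).2.2.2.2.2.1) hηt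
  refine ⟨h1, h2, h3.trans ?_⟩
  -- The source and barrier terms come with coefficient `1`; the factor `max δ 1` allows them to be
  -- put under the common factor `4 / δ`.
  have hc : 1 ≤ ENNReal.ofReal (4 / δ) * ENNReal.ofReal (max δ 1) := by
    rw [← ENNReal.ofReal_mul (by positivity), ENNReal.one_le_ofReal, div_mul_eq_mul_div,
      one_le_div hδ0]
    linarith [le_max_left δ 1]
  rw [ENNReal.ofReal_mul (by positivity), mul_add, ← mul_assoc, ← mul_assoc, add_assoc]
  refine add_le_add_right ?_ _
  rw [add_comm (eLpNorm a r _ * _)]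
  exact le_mul_of_one_le_left' hc
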